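/- **Theorem.** Constructive Zermelo–Fraenkel set theory $\mathbf{CZF}$ proves: if the elementary NID principle holds, then for every function $f : B \to A$ between sets the M-type associated to $f$ exists. Here the terms are as follows. $\mathbf{CZF}$ is the theory in intuitionistic first-order logic with equality and the relation symbol $\in$ whose axioms are extensionality, pairing, union, infinity, bounded separation, set induction, strong collection and subset collection. An *elementary rule* on a set $X$ is a pair $(a,b)$ of subsets of $X$ for which $a$ is a singleton. A subset $Y \subseteq X$ is *closed* under $(a,b)$ if $a \subseteq Y$ implies that $b \cap Y$ is inhabited; for a set $\mathcal R$ of rules, $Y$ is $\mathcal R$-closed if it is closed under all rules in $\mathcal R$. A class $M$ of subsets of $X$ is *set-generated* if there is a set $G \subseteq M$ such that for all $\alpha \in M$ and $a \in \alpha$ there is $\beta \in G$ with $a \in \beta \subseteq \alpha$. *Elementary NID* states that for every set $X$ and every set $\mathcal R$ of elementary rules on $X$, the class of $\mathcal R$-closed subsets of $X$ is set-generated. For $f : B \to A$, the *polynomial functor* is $P_f(X) = \{(a,t) : a \in A,\ t : f^{-1}(a) \to X\}$, with $P_f(h)(a,t) = (a, h\circ t)$ for a function $h$. A $P_f$-*coalgebra*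 is a set $X$ with a function $v : X \to P_f(X)$; a *morphism* $(X,v) \to (Y,w)$ is a function $h : X \to Y$ with $w \circ h = P_f(h)\circ v$. The *M-type* associated to $f$ is a final $P_f$-coalgebra: a coalgebra $(M,u)$ such that every $P_f$-coalgebra $(X,v)$ has exactly one morphism to $(M,u)$. -/

import Mathlib

namespace CZFLogic

/-! ## Intuitionistic first-order logic with equality over one binary relation symbol

The only terms are variables, so substitution is renaming of variables. Formulas use de Bruijn
indices: a quantifier binds the variable `0` of its body, and the variable `n + 1` of the body is
the variable `n` outside. All connectives and both quantifiers are primitive. -/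

/-- Formulas of the language of set theory. -/
inductive Fm : Type
  | falsum : Fm
  | mem (x y : ℕ) : Fm
  | eq (x y : ℕ) : Fm
  | and (φ ψ : Fm) : Fm
  | or (φ ψ : Fm) : Fm
  | imp (φ ψ : Fm) : Fm
  | all (φ : Fm) : Fm
  | ex (φ : Fm) : Fm

namespace Fm

/-- Extend a renaming under a quantifier. -/
def up (σ : ℕ → ℕ) : ℕ → ℕ
  | 0 => 0
  | n + 1 => σ n + 1

/-- Capture-avoiding renaming of the free variables. -/
def rename : (ℕ → ℕ) → Fm → Fm
  | _, falsum => falsum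
  | σ, mem x y => mem (σ x) (σ y)
  | σ, eq x y => eq (σ x) (σ y)
  | σ, and φ ψ => and (rename σ φ) (rename σ ψ)
  | σ, or φ ψ => or (rename σ φ) (rename σ ψ)
  | σ, imp φ ψ => imp (rename σ φ) (rename σ ψ)
  | σ, all φ => all (rename (up σ) φ)
  | σ, ex φ => ex (rename (up σ) φ)

/-- Regard a formula as one in the scope of a new quantifier. -/
def lift (φ : Fm) : Fm := φ.rename Nat.succ

/-- Substitute the variable `t` for the variable `0`, and remove the latter. -/
def inst (φ : Fm) (t : ℕ) : Fm :=
  φ.rename (fun n => match n with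
    | 0 => t
    | k + 1 => k)

/-- Bounded (restricted, `Δ₀`) formulas: every quantifier is of the form `∀ x ∈ y` or `∃ x ∈ y`. -/
inductive IsBounded : Fm → Prop
  | falsum : IsBounded falsum
  | mem (x y : ℕ) : IsBounded (mem x y)
  | eq (x y : ℕ) : IsBounded (eq x y)
  | and {φ ψ : Fm} : IsBounded φ → IsBounded ψ → IsBounded (and φ ψ)
  | or {φ ψ : Fm} : IsBounded φ → IsBounded ψ → IsBounded (or φ ψ)
  | imp {φ ψ : Fm} : IsBounded φ → IsBounded ψ → IsBounded (imp φ ψ)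
  | ball (y : ℕ) {φ : Fm} : IsBounded φ → IsBounded (all (imp (mem 0 (y + 1)) φ))
  | bex (y : ℕ) {φ : Fm} : IsBounded φ → IsBounded (ex (and (mem 0 (y + 1)) φ))

end Fm

/-- Natural deduction for intuitionistic first-order logic with equality: `Derivable T Γ φ` says
that `φ` is derivable from the hypotheses `Γ` and the axioms `T`. Axioms hold for all values of
their free variables. -/
inductive Derivable (T : Set Fm) : List Fm → Fm → Prop
  | ax {Γ : List Fm} {φ : Fm} : φ ∈ T → Derivable T Γ φ
  | hyp {Γ : List Fm} {φ : Fm} : φ ∈ Γ → Derivable T Γ φ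
  | falsumE {Γ : List Fm} {φ : Fm} : Derivable T Γ .falsum → Derivable T Γ φ
  | andI {Γ : List Fm} {φ ψ : Fm} :
      Derivable T Γ φ → Derivable T Γ ψ → Derivable T Γ (.and φ ψ)
  | andE₁ {Γ : List Fm} {φ ψ : Fm} : Derivable T Γ (.and φ ψ) → Derivable T Γ φ
  | andE₂ {Γ : List Fm} {φ ψ : Fm} : Derivable T Γ (.and φ ψ) → Derivable T Γ ψ
  | orI₁ {Γ : List Fm} {φ ψ : Fm} : Derivable T Γ φ → Derivable T Γ (.or φ ψ)
  | orI₂ {Γ : List Fm} {φ ψ : Fm} : Derivable T Γ ψ → Derivable T Γ (.or φ ψ)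
  | orE {Γ : List Fm} {φ ψ χ : Fm} : Derivable T Γ (.or φ ψ) →
      Derivable T (φ :: Γ) χ → Derivable T (ψ :: Γ) χ → Derivable T Γ χ
  | impI {Γ : List Fm} {φ ψ : Fm} : Derivable T (φ :: Γ) ψ → Derivable T Γ (.imp φ ψ)
  | impE {Γ : List Fm} {φ ψ : Fm} :
      Derivable T Γ (.imp φ ψ) → Derivable T Γ φ → Derivable T Γ ψ
  | allI {Γ : List Fm} {φ : Fm} : Derivable T (Γ.map Fm.lift) φ → Derivable T Γ (.all φ)
  | allE {Γ : List Fm} {φ : Fm} (t : ℕ) : Derivable T Γ (.all φ) → Derivable T Γ (φ.inst t)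
  | exI {Γ : List Fm} {φ : Fm} (t : ℕ) : Derivable T Γ (φ.inst t) → Derivable T Γ (.ex φ)
  | exE {Γ : List Fm} {φ ψ : Fm} : Derivable T Γ (.ex φ) →
      Derivable T (φ :: Γ.map Fm.lift) ψ.lift → Derivable T Γ ψ
  | eqRefl {Γ : List Fm} (t : ℕ) : Derivable T Γ (.eq t t)
  | eqSubst {Γ : List Fm} {φ : Fm} (s t : ℕ) :
      Derivable T Γ (.eq s t) → Derivable T Γ (φ.inst s) → Derivable T Γ (φ.inst t)

/-! ## Writing formulas with named bound variables

A `Form` is a formula that may be placed under any number `d` of quantifiers; the variable bound by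
the `k`-th quantifier from outside (counted from `0`) is named `k`, so that its de Bruijn index
below `d` quantifiers is `d - 1 - k`. Thus `all fun x => all fun y => x ∊ y` is `∀ x ∀ y, x ∈ y`.
A `Form` is turned into a formula by placing it under no quantifier. -/

/-- Names of bound variables. -/
abbrev Var : Type := ℕ

/-- Formulas with named bound variables. -/
abbrev Form : Type := ℕ → Fm

namespace Form

def mem (x y : Var) : Form := fun d => .mem (d - 1 - x) (d - 1 - y)

def eq (x y : Var) : Form := fun d => .eq (d - 1 - x) (d - 1 - y)

def and (p q : Form) : Form := fun d => .and (p d) (q d)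

def or (p q : Form) : Form := fun d => .or (p d) (q d)

def imp (p q : Form) : Form := fun d => .imp (p d) (q d)

def all (p : Var → Form) : Form := fun d => .all (p d (d + 1))

def ex (p : Var → Form) : Form := fun d => .ex (p d (d + 1))

infix:70 " ∊ " => Form.mem
infix:70 " ≐ " => Form.eq
infixr:60 " ⩑ " => Form.and
infixr:55 " ⩒ " => Form.or
infixr:50 " ⟹ " => Form.imp

def iff (p q : Form) : Form := (p ⟹ q) ⩑ (q ⟹ p)

infix:45 " ⟺ " => Form.iff

/-- `∀ x ∈ a, p x` -/
def ball (a : Var) (p : Var → Form) : Form := all fun x => x ∊ a ⟹ p x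

/-- `∃ x ∈ a, p x` -/
def bex (a : Var) (p : Var → Form) : Form := ex fun x => x ∊ a ⩑ p x

/-- `∃! x, p x` -/
def exUnique (p : Var → Form) : Form := ex fun x => p x ⩑ all fun y => p y ⟹ y ≐ x

/-- For axiom schemes: the formula `φ(x₀, …, xₘ₋₁)`, where the `xᵢ` are put for the first `m` free
variables of `φ`; the other free variables of `φ` are parameters, which no quantifier binds. -/
def app (φ : Fm) (xs : List Var) : Form := fun d =>
  φ.rename fun i => if h : i < xs.length then d - 1 - xs[i] else i - xs.length + d

/-! ## The axioms of constructive Zermelo-Fraenkel set theory -/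

/-- `a ⊆ b` -/
def subset (a b : Var) : Form := ball a fun x => x ∊ b

def extensionality : Form :=
  all fun a => all fun b => (all fun x => x ∊ a ⟺ x ∊ b) ⟹ a ≐ b

def pairing : Form :=
  all fun a => all fun b => ex fun c => all fun x => x ∊ c ⟺ x ≐ a ⩒ x ≐ b

def union : Form :=
  all fun a => ex fun c => all fun x => x ∊ c ⟺ bex a fun y => x ∊ y

/-- `∅ ∈ a`, and `x ∪ {x} ∈ a` for all `x ∈ a` -/
def inductiveSet (a : Var) : Form :=
  (bex a fun z => all fun w => w ∊ z ⟹ fun _ => .falsum) ⩑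
  (ball a fun x => bex a fun y => all fun w => w ∊ y ⟺ w ∊ x ⩒ w ≐ x)

def infinity : Form :=
  ex fun a => inductiveSet a ⩑ all fun b => inductiveSet b ⟹ subset a b

/-- `φ` has the free variable `x` and parameters. -/
def separation (φ : Fm) : Form :=
  all fun a => ex fun c => all fun x => x ∊ c ⟺ x ∊ a ⩑ app φ [x]

/-- `φ` has the free variable `x` and parameters. -/
def setInduction (φ : Fm) : Form :=
  (all fun a => (ball a fun x => app φ [x]) ⟹ app φ [a]) ⟹ all fun a => app φ [a]

/-- `φ` has the free variables `x`, `y` and parameters. -/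
def strongCollection (φ : Fm) : Form :=
  all fun a => (ball a fun x => ex fun y => app φ [x, y]) ⟹
    ex fun b =>
      (ball a fun x => bex b fun y => app φ [x, y]) ⩑
      (ball b fun y => bex a fun x => app φ [x, y])

/-- `φ` has the free variables `x`, `y`, `u` and parameters. -/
def subsetCollection (φ : Fm) : Form :=
  all fun a => all fun b => ex fun c => all fun u =>
    (ball a fun x => bex b fun y => app φ [x, y, u]) ⟹
      bex c fun e =>
        (ball a fun x => bex e fun y => app φ [x, y, u]) ⩑
        (ball e fun y => bex a fun x => app φ [x, y, u])

end Form

open Form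

/-- The axioms of `CZF`. -/
inductive CZFAxiom : Fm → Prop
  | extensionality : CZFAxiom (extensionality 0)
  | pairing : CZFAxiom (pairing 0)
  | union : CZFAxiom (union 0)
  | infinity : CZFAxiom (infinity 0)
  | boundedSeparation (φ : Fm) : φ.IsBounded → CZFAxiom (separation φ 0)
  | setInduction (φ : Fm) : CZFAxiom (setInduction φ 0)
  | strongCollection (φ : Fm) : CZFAxiom (strongCollection φ 0)
  | subsetCollection (φ : Fm) : CZFAxiom (subsetCollection φ 0)

/-- The formula `p` is a theorem of `CZF`. -/
def CZFProves (p : Form) : Prop := Derivable {φ | CZFAxiom φ} [] (p 0)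

namespace Form

/-! ## Pairs and functions -/

/-- `z = {x, y}` -/
def isUnorderedPair (z x y : Var) : Form :=
  x ∊ z ⩑ y ∊ z ⩑ ball z fun w => w ≐ x ⩒ w ≐ y

/-- `z = {x}` -/
def isSingleton (z x : Var) : Form := x ∊ z ⩑ ball z fun w => w ≐ x

/-- `p = (x, y)`, that is, `p = {{x}, {x, y}}` -/
def isPair (p x y : Var) : Form :=
  (bex p fun z => isSingleton z x) ⩑
  (bex p fun z => isUnorderedPair z x y) ⩑
  (ball p fun z => isSingleton z x ⩒ isUnorderedPair z x y)

/-- `(x, y) ∈ r` -/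
def pairMem (x y r : Var) : Form := bex r fun p => isPair p x y

/-- The set `g` is a function from the class `D` to the class `C`: a set of pairs `(x, y)` with
`x ∈ D` and `y ∈ C`, which has exactly one such pair for each `x ∈ D`. -/
def isFunction (g : Var) (D C : Var → Form) : Form :=
  (ball g fun p => ex fun x => ex fun y => isPair p x y ⩑ D x ⩑ C y) ⩑
  (all fun x => D x ⟹ exUnique fun y => pairMem x y g)

/-! ## Elementary non-deterministic inductive definitions -/

/-- `R` is a set of elementary rules on `X`: of pairs `(a, b)` of subsets of `X` for which `a` is a
singleton. -/
def isElementaryRuleSet (R X : Var) : Form :=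
  ball R fun r => ex fun a => ex fun b =>
    isPair r a b ⩑ subset a X ⩑ subset b X ⩑ ex fun x => isSingleton a x

/-- `Y` is a subset of `X` closed under every rule `(a, b)` of `R`: if `a ⊆ Y`, then `b ∩ Y` is
inhabited. -/
def isClosed (R X Y : Var) : Form :=
  subset Y X ⩑ all fun a => all fun b => pairMem a b R ⟹ subset a Y ⟹ bex b fun x => x ∊ Y

/-- The class `M` of sets is set-generated. -/
def setGenerated (M : Var → Form) : Form :=
  ex fun G => (ball G fun β => M β) ⩑
    all fun α => M α ⟹ ball α fun a => bex G fun β => a ∊ β ⩑ subset β α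

/-- For every set `X` and every set `R` of elementary rules on `X`, the class of `R`-closed subsets
of `X` is set-generated. -/
def elementaryNID : Form :=
  all fun X => all fun R => isElementaryRuleSet R X ⟹ setGenerated fun Y => isClosed R X Y

/-! ## Polynomial functors and their final coalgebras

Here `f` is a function from `B` to `A`. -/

/-- `p ∈ P_f(X)`, that is, `p = (a, t)` for some `a ∈ A` and some function `t` from `f⁻¹(a)`
to `X`. -/
def memPoly (A B f X p : Var) : Form :=
  ex fun a => ex fun t => isPair p a t ⩑ a ∊ A ⩑
    isFunction t (fun b => b ∊ B ⩑ pairMem b a f) (fun x => x ∊ X)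

/-- `v` is a function from `X` to `P_f(X)`. -/
def isCoalgebra (A B f X v : Var) : Form :=
  isFunction v (fun x => x ∊ X) (fun p => memPoly A B f X p)

/-- `s = h ∘ t` -/
def isComp (s h t : Var) : Form :=
  all fun p => p ∊ s ⟺
    ex fun b => ex fun x => ex fun y => isPair p b y ⩑ pairMem b x t ⩑ pairMem x y h

/-- `q = P_f(h)(p)`, that is, `p = (a, t)` and `q = (a, h ∘ t)` for some `a` and `t`. -/
def isPolyMap (h p q : Var) : Form :=
  ex fun a => ex fun t => ex fun s => isPair p a t ⩑ isPair q a s ⩑ isComp s h t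

/-- `h` is a morphism of coalgebras from `(X, v)` to `(Y, w)`: a function from `X` to `Y` with
`w(h(x)) = P_f(h)(v(x))` for all `x ∈ X`. -/
def isCoalgebraMorphism (h X v Y w : Var) : Form :=
  isFunction h (fun x => x ∊ X) (fun y => y ∊ Y) ⩑
  ball X fun x => ex fun p => ex fun y => ex fun q =>
    pairMem x p v ⩑ pairMem x y h ⩑ pairMem y q w ⩑ isPolyMap h p q

/-- `(M, u)` is a final `P_f`-coalgebra. -/
def isMType (A B f M u : Var) : Form :=
  isCoalgebra A B f M u ⩑
  all fun X => all fun v => isCoalgebra A B f X v ⟹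
    exUnique fun h => isCoalgebraMorphism h X v M u

/-- For every function `f` from a set `B` to a set `A`, the M-type associated to `f` exists. -/
def allMTypesExist : Form :=
  all fun A => all fun B => all fun f =>
    isFunction f (fun b => b ∊ B) (fun a => a ∊ A) ⟹
      ex fun M => ex fun u => isMType A B f M u

end Form

end CZFLogic

/-! Fix f : B → A. The elements of the M-type are realised as labelled trees: sets T of pairs (σ,
a), where the finite list σ over B is the address of a node and a ∈ A is its label. Each address has
at most one label, the empty list has one, and σb is an address exactly when σ is an address with
label f(b). Since there is no power set, the difficulty is that the trees should form a set, and
this is where elementary NID enters. The rules ({(σ, f(b))}, {σb} × A) are elementary, and every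
tree is closed under them. If G generates the closed sets and (∅, a₀) is the root of a tree T, then
some β ∈ G satisfies (∅, a₀) ∈ β ⊆ T. As β is closed and T gives an address only one label,
induction on addresses yields β = T (`IsTree.mem_of_step`). Thus all trees lie in G, and bounded
separation singles them out (`exists_treeSet`).

The structure map sends a tree to its root label together with its subtrees. For a coalgebra (X, v),
the tree of x consists of the (σ, a) such that the run of v from x along σ ends in a state with
label a. The set of runs is obtained by closing a set under a relation, a second application of
elementary NID, now to rules ({z}, {z'}) (`exists_closure`). That x ↦ tree of x is a morphism comes
down to the fact that a run along bσ is a step along b followed by a run along σ (`run_cons`). Two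
morphisms agree by induction on addresses from the front (`front_induction`,
`mem_of_mem_of_isMorphism`).

The theorem asserts formal derivability in CZF. The derivation is not written out: intuitionistic
logic is complete for Kripke models (`derivable_of_forall_model`, a Henkin construction with a
classical metatheory), so it suffices to carry out the argument at every world of every Kripke model
of the axioms. The domain at a world then behaves like a universe of sets in which equality is
equality in Lean. Statements are read at all later worlds, and each use of separation, collection or
induction needs an explicit formula. -/

namespace CZFLogic

/-! ## Renaming and free variables -/

namespace Fm

/-- The free variables of a formula. -/
def FV : Fm → Set ℕ
  | falsum => ∅
  | mem x y => {x, y}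
  | eq x y => {x, y}
  | and φ ψ => FV φ ∪ FV ψ
  | or φ ψ => FV φ ∪ FV ψ
  | imp φ ψ => FV φ ∪ FV ψ
  | all φ => {n | n + 1 ∈ FV φ}
  | ex φ => {n | n + 1 ∈ FV φ}

theorem FV_finite (φ : Fm) : φ.FV.Finite := by
  induction φ with
  | falsum => simp [FV]
  | mem x y => simp [FV]
  | eq x y => simp [FV]
  | and _ _ h₁ h₂ => exact h₁.union h₂
  | or _ _ h₁ h₂ => exact h₁.union h₂
  | imp _ _ h₁ h₂ => exact h₁.union h₂
  | all _ h => exact h.preimage (Nat.succ_injective.injOn)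
  | ex _ h => exact h.preimage (Nat.succ_injective.injOn)

theorem rename_congr {φ : Fm} {σ τ : ℕ → ℕ} (h : ∀ n ∈ φ.FV, σ n = τ n) :
    φ.rename σ = φ.rename τ := by
  have key : ∀ {φ : Fm} {σ τ : ℕ → ℕ}, (∀ n, n + 1 ∈ φ.FV → σ n = τ n) →
      ∀ n ∈ φ.FV, up σ n = up τ n := by
    intro φ σ τ h n hn
    cases n with
    | zero => rfl
    | succ n => simp [up, h n hn]
  induction φ generalizing σ τ with
  | falsum => rfl
  | mem x y => simp [rename, h x (by simp [FV]), h y (by simp [FV])]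
  | eq x y => simp [rename, h x (by simp [FV]), h y (by simp [FV])]
  | and _ _ h₁ h₂ =>
    simp [rename, h₁ fun n hn => h n (Or.inl hn), h₂ fun n hn => h n (Or.inr hn)]
  | or _ _ h₁ h₂ =>
    simp [rename, h₁ fun n hn => h n (Or.inl hn), h₂ fun n hn => h n (Or.inr hn)]
  | imp _ _ h₁ h₂ =>
    simp [rename, h₁ fun n hn => h n (Or.inl hn), h₂ fun n hn => h n (Or.inr hn)]
  | all _ ih => simp [rename, ih (key h)]
  | ex _ ih => simp [rename, ih (key h)]

theorem up_comp (σ τ : ℕ → ℕ) : up τ ∘ up σ = up (τ ∘ σ) := by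
  funext n; cases n <;> rfl

theorem up_id : up id = id := by
  funext n; cases n <;> rfl

theorem rename_rename (φ : Fm) (σ τ : ℕ → ℕ) : (φ.rename σ).rename τ = φ.rename (τ ∘ σ) := by
  induction φ generalizing σ τ <;> simp_all [rename, ← up_comp]

theorem rename_id (φ : Fm) : φ.rename id = φ := by
  induction φ <;> simp_all [rename, up_id]

theorem FV_rename (φ : Fm) (σ : ℕ → ℕ) : ∀ n ∈ (φ.rename σ).FV, ∃ m ∈ φ.FV, σ m = n := by
  have key : ∀ {φ : Fm} {σ : ℕ → ℕ}, (∀ n ∈ (φ.rename (up σ)).FV, ∃ m ∈ φ.FV, up σ m = n) →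
      ∀ n, n + 1 ∈ (φ.rename (up σ)).FV → ∃ m, m + 1 ∈ φ.FV ∧ σ m = n := by
    intro φ σ h n hn
    obtain ⟨m, hm, e⟩ := h _ hn
    cases m with
    | zero => simp [up] at e
    | succ m => exact ⟨m, hm, by simpa [up] using e⟩
  induction φ generalizing σ with
  | falsum => simp [rename, FV]
  | mem x y => simp [rename, FV]
  | eq x y => simp [rename, FV]
  | and _ _ h₁ h₂ =>
    rintro n (hn | hn)
    · obtain ⟨m, hm, e⟩ := h₁ _ n hn
      exact ⟨m, Or.inl hm, e⟩
    · obtain ⟨m, hm, e⟩ := h₂ _ n hn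
      exact ⟨m, Or.inr hm, e⟩
  | or _ _ h₁ h₂ =>
    rintro n (hn | hn)
    · obtain ⟨m, hm, e⟩ := h₁ _ n hn
      exact ⟨m, Or.inl hm, e⟩
    · obtain ⟨m, hm, e⟩ := h₂ _ n hn
      exact ⟨m, Or.inr hm, e⟩
  | imp _ _ h₁ h₂ =>
    rintro n (hn | hn)
    · obtain ⟨m, hm, e⟩ := h₁ _ n hn
      exact ⟨m, Or.inl hm, e⟩
    · obtain ⟨m, hm, e⟩ := h₂ _ n hn
      exact ⟨m, Or.inr hm, e⟩
  | all _ ih => exact key (ih _)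
  | ex _ ih => exact key (ih _)

/-- Add a value for the variable `0` to an assignment. -/
def scons {α : Type*} (x : α) (ρ : ℕ → α) : ℕ → α
  | 0 => x
  | n + 1 => ρ n

@[simp] theorem scons_zero {α : Type*} (x : α) (ρ : ℕ → α) : scons x ρ 0 = x := rfl

@[simp] theorem scons_succ {α : Type*} (x : α) (ρ : ℕ → α) (n : ℕ) :
    scons x ρ (n + 1) = ρ n := rfl

theorem inst_eq (φ : Fm) (t : ℕ) : φ.inst t = φ.rename (scons t id) := by
  unfold inst
  congr 1

theorem inst_rename_up (φ : Fm) (σ : ℕ → ℕ) (t : ℕ) :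
    (φ.rename (up σ)).inst t = φ.rename (scons t σ) := by
  rw [inst_eq, rename_rename]
  congr 1
  funext n; cases n <;> rfl

theorem rename_inst (φ : Fm) (σ : ℕ → ℕ) (t : ℕ) :
    (φ.inst t).rename σ = (φ.rename (up σ)).inst (σ t) := by
  rw [inst_rename_up, inst_eq, rename_rename]
  congr 1
  funext n; cases n <;> rfl

theorem rename_lift (φ : Fm) (σ : ℕ → ℕ) : (φ.lift).rename (up σ) = (φ.rename σ).lift := by
  unfold lift
  rw [rename_rename, rename_rename]
  congr 1

theorem FV_inst {φ : Fm} {S : Set ℕ} {t : ℕ} (h : φ.all.FV ⊆ S) (ht : t ∈ S) :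
    (φ.inst t).FV ⊆ S := by
  intro n hn
  rw [inst_eq] at hn
  obtain ⟨m, hm, rfl⟩ := FV_rename _ _ n hn
  cases m with
  | zero => exact ht
  | succ m => exact h hm

/-- A numerical code of a formula. -/
def code : Fm → ℕ
  | falsum => Nat.pair 0 0
  | mem x y => Nat.pair 1 (Nat.pair x y)
  | eq x y => Nat.pair 2 (Nat.pair x y)
  | and φ ψ => Nat.pair 3 (Nat.pair φ.code ψ.code)
  | or φ ψ => Nat.pair 4 (Nat.pair φ.code ψ.code)
  | imp φ ψ => Nat.pair 5 (Nat.pair φ.code ψ.code)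
  | all φ => Nat.pair 6 φ.code
  | ex φ => Nat.pair 7 φ.code

/-- Only countability matters: it lets `exists_world` run through all formulas in one sequence. -/
theorem code_injective : Function.Injective code := by
  intro φ
  induction φ <;> intro ψ h <;> cases ψ <;> simp_all [code, Nat.pair_eq_pair]
  all_goals first | (obtain ⟨h₁, h₂⟩ := h) | skip
  all_goals first | exact ⟨by tauto, by tauto⟩ | tauto

instance : Countable Fm := code_injective.countable

theorem IsBounded.rename {φ : Fm} (h : φ.IsBounded) (σ : ℕ → ℕ) : (φ.rename σ).IsBounded := by
  induction h generalizing σ with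
  | falsum => exact .falsum
  | mem => exact .mem _ _
  | eq => exact .eq _ _
  | and _ _ h₁ h₂ => exact .and (h₁ σ) (h₂ σ)
  | or _ _ h₁ h₂ => exact .or (h₁ σ) (h₂ σ)
  | imp _ _ h₁ h₂ => exact .imp (h₁ σ) (h₂ σ)
  | ball y _ h => exact .ball (σ y) (h _)
  | bex y _ h => exact .bex (σ y) (h _)

end Fm

open Fm

namespace Derivable

variable {T : Set Fm}

/-- This turns a derivation about a fresh named variable into one about the index `0`, as the
quantifier rules demand. Axioms may have free variables, so the set of axioms has to be stable as
well. -/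
theorem rename_vars (hT : ∀ φ ∈ T, ∀ σ, φ.rename σ ∈ T) {Γ : List Fm} {φ : Fm}
    (h : Derivable T Γ φ) (σ : ℕ → ℕ) : Derivable T (Γ.map (Fm.rename σ)) (φ.rename σ) := by
  have hl : ∀ (Γ : List Fm) (σ : ℕ → ℕ), (Γ.map Fm.lift).map (Fm.rename (up σ)) =
      (Γ.map (Fm.rename σ)).map Fm.lift := by
    intro Γ σ
    simp [List.map_map, Function.comp_def, rename_lift]
  induction h generalizing σ with
  | ax h => exact .ax (hT _ h σ)
  | hyp h => exact .hyp (List.mem_map_of_mem h)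
  | falsumE _ ih => exact .falsumE (ih σ)
  | andI _ _ h₁ h₂ => exact .andI (h₁ σ) (h₂ σ)
  | andE₁ _ h => exact .andE₁ (h σ)
  | andE₂ _ h => exact .andE₂ (h σ)
  | orI₁ _ h => exact .orI₁ (h σ)
  | orI₂ _ h => exact .orI₂ (h σ)
  | orE _ _ _ h h₁ h₂ => exact .orE (h σ) (h₁ σ) (h₂ σ)
  | impI _ h => exact .impI (h σ)
  | impE _ _ h₁ h₂ => exact .impE (h₁ σ) (h₂ σ)
  | allI _ h =>
    refine .allI ?_
    rw [← hl]
    exact h _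
  | allE t _ h =>
    rw [rename_inst]
    exact .allE _ (h σ)
  | exI t _ h =>
    refine .exI (σ t) ?_
    rw [← rename_inst]
    exact h σ
  | exE _ _ h₁ h₂ =>
    refine .exE (h₁ σ) ?_
    rw [← hl, ← rename_lift]
    exact h₂ _
  | eqRefl t => exact .eqRefl _
  | eqSubst s t _ _ h₁ h₂ =>
    rw [rename_inst]
    refine .eqSubst (σ s) (σ t) (h₁ σ) ?_
    rw [← rename_inst]
    exact h₂ σ

theorem weaken {Γ : List Fm} {φ : Fm} (h : Derivable T Γ φ) {Δ : List Fm} (hΔ : Γ ⊆ Δ) :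
    Derivable T Δ φ := by
  induction h generalizing Δ with
  | ax h => exact .ax h
  | hyp h => exact .hyp (hΔ h)
  | falsumE _ ih => exact .falsumE (ih hΔ)
  | andI _ _ h₁ h₂ => exact .andI (h₁ hΔ) (h₂ hΔ)
  | andE₁ _ h => exact .andE₁ (h hΔ)
  | andE₂ _ h => exact .andE₂ (h hΔ)
  | orI₁ _ h => exact .orI₁ (h hΔ)
  | orI₂ _ h => exact .orI₂ (h hΔ)
  | orE _ _ _ h h₁ h₂ =>
    exact .orE (h hΔ) (h₁ (List.cons_subset_cons _ hΔ)) (h₂ (List.cons_subset_cons _ hΔ))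
  | impI _ h => exact .impI (h (List.cons_subset_cons _ hΔ))
  | impE _ _ h₁ h₂ => exact .impE (h₁ hΔ) (h₂ hΔ)
  | allI _ h => exact .allI (h (List.map_subset _ hΔ))
  | allE t _ h => exact .allE _ (h hΔ)
  | exI t _ h => exact .exI t (h hΔ)
  | exE _ _ h₁ h₂ => exact .exE (h₁ hΔ) (h₂ (List.cons_subset_cons _ (List.map_subset _ hΔ)))
  | eqRefl t => exact .eqRefl _
  | eqSubst s t _ _ h₁ h₂ => exact .eqSubst s t (h₁ hΔ) (h₂ hΔ)

end Derivable

/-! ## Derivability from a set of hypotheses -/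

/-- Derivability from a set of hypotheses. -/
def Prv (T G : Set Fm) (φ : Fm) : Prop := ∃ L : List Fm, (∀ ψ ∈ L, ψ ∈ G) ∧ Derivable T L φ

namespace Prv

variable {T G : Set Fm} {φ ψ χ : Fm}

theorem hyp (h : φ ∈ G) : Prv T G φ := ⟨[φ], by simpa using h, .hyp (by simp)⟩

theorem mono {G' : Set Fm} (h : Prv T G φ) (hG : G ⊆ G') : Prv T G' φ := by
  obtain ⟨L, hL, d⟩ := h
  exact ⟨L, fun ψ hψ => hG (hL ψ hψ), d⟩

theorem map₁ (h : Prv T G φ) (f : ∀ {L}, Derivable T L φ → Derivable T L ψ) : Prv T G ψ := by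
  obtain ⟨L, hL, d⟩ := h
  exact ⟨L, hL, f d⟩

theorem map₂ (h : Prv T G φ) (h' : Prv T G ψ)
    (f : ∀ {L}, Derivable T L φ → Derivable T L ψ → Derivable T L χ) : Prv T G χ := by
  obtain ⟨L, hL, d⟩ := h
  obtain ⟨L', hL', d'⟩ := h'
  refine ⟨L ++ L', ?_, f (d.weaken (by simp)) (d'.weaken (by simp))⟩
  intro ψ hψ
  rcases List.mem_append.1 hψ with h | h
  · exact hL _ h
  · exact hL' _ h

/-- All occurrences of `φ` are filtered out of the list and one is put in front, where the rules can
discharge it. -/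
theorem of_insert (h : Prv T (insert φ G) ψ) :
    ∃ L : List Fm, (∀ θ ∈ L, θ ∈ G) ∧ Derivable T (φ :: L) ψ := by
  classical
  obtain ⟨L, hL, d⟩ := h
  refine ⟨L.filter (· ≠ φ), ?_, d.weaken ?_⟩
  · intro θ hθ
    simp only [List.mem_filter, decide_eq_true_eq] at hθ
    exact (hL θ hθ.1).resolve_left hθ.2
  · intro θ hθ
    by_cases e : θ = φ
    · simp [e]
    · simp [e, hθ]

theorem impI (h : Prv T (insert φ G) ψ) : Prv T G (φ.imp ψ) := by
  obtain ⟨L, hL, d⟩ := h.of_insert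
  exact ⟨L, hL, .impI d⟩

theorem impE (h : Prv T G (φ.imp ψ)) (h' : Prv T G φ) : Prv T G ψ := h.map₂ h' .impE

theorem cut (h : Prv T (insert φ G) ψ) (h' : Prv T G φ) : Prv T G ψ := h.impI.impE h'

theorem orE (h : Prv T G (φ.or ψ)) (h₁ : Prv T (insert φ G) χ) (h₂ : Prv T (insert ψ G) χ) :
    Prv T G χ := by
  refine (h.map₂ (h₁.impI.map₂ h₂.impI .andI)) fun d d' => ?_
  refine d.orE ?_ ?_
  · exact .impE (d'.andE₁.weaken (by simp)) (.hyp (by simp))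
  · exact .impE (d'.andE₂.weaken (by simp)) (.hyp (by simp))

/-- Make room for `0` by moving the variables up, and move `c` to `0`. -/
def toZero (c n : ℕ) : ℕ := if n = c then 0 else n + 1

theorem rename_toZero {c : ℕ} (h : c ∉ φ.FV) : φ.rename (toZero c) = φ.lift := by
  refine rename_congr fun n hn => ?_
  have : n ≠ c := fun e => h (e ▸ hn)
  simp [toZero, this]

theorem inst_rename_toZero {c : ℕ} (h : c ∉ φ.all.FV) : (φ.inst c).rename (toZero c) = φ := by
  rw [inst_eq, rename_rename]
  conv_rhs => rw [← rename_id φ]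
  refine rename_congr fun n hn => ?_
  cases n with
  | zero => simp [toZero, scons]
  | succ n =>
    have : n ≠ c := fun e => h (e ▸ hn)
    simp [toZero, scons, this]

theorem map_toZero {c : ℕ} {L : List Fm} (hG : ∀ ψ ∈ G, c ∉ ψ.FV) (hL : ∀ ψ ∈ L, ψ ∈ G) :
    L.map (Fm.rename (toZero c)) = L.map Fm.lift :=
  List.map_congr_left fun ψ hψ => rename_toZero (hG ψ (hL ψ hψ))

/-- Generalisation over a fresh named variable. The renaming `toZero c` moves `c` to `0`, and on
formulas without `c` it coincides with `lift`. -/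
theorem allI (hT : ∀ φ ∈ T, ∀ σ, φ.rename σ ∈ T) {c : ℕ} (hG : ∀ ψ ∈ G, c ∉ ψ.FV)
    (hφ : c ∉ φ.all.FV) (h : Prv T G (φ.inst c)) : Prv T G φ.all := by
  obtain ⟨L, hL, d⟩ := h
  refine ⟨L, hL, .allI ?_⟩
  have := d.rename_vars hT (toZero c)
  rwa [inst_rename_toZero hφ, map_toZero hG hL] at this

theorem exE (hT : ∀ φ ∈ T, ∀ σ, φ.rename σ ∈ T) {c : ℕ} (hG : ∀ ψ ∈ G, c ∉ ψ.FV)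
    (hφ : c ∉ φ.all.FV) (hχ : c ∉ χ.FV) (h : Prv T (insert (φ.inst c) G) χ)
    (h' : Prv T G φ.ex) : Prv T G χ := by
  obtain ⟨L, hL, d⟩ := h.of_insert
  have := d.rename_vars hT (toZero c)
  rw [List.map_cons, inst_rename_toZero hφ, map_toZero hG hL, rename_toZero hχ] at this
  obtain ⟨L', hL', d'⟩ := h'
  refine ⟨L ++ L', ?_, .exE (d'.weaken (by simp)) (this.weaken ?_)⟩
  · intro ψ hψ
    rcases List.mem_append.1 hψ with h | h
    · exact hL _ h
    · exact hL' _ h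
  · exact List.cons_subset_cons _ (List.map_subset _ (by simp))

end Prv

/-! ## Saturated theories -/

/-- A consistent prime theory with witnesses over a set of variables that leaves out infinitely
many variables. -/
structure World (T : Set Fm) where
  S : Set ℕ
  G : Set Fm
  nonempty : S.Nonempty
  infinite : Sᶜ.Infinite
  fv_subset : ∀ φ ∈ G, φ.FV ⊆ S
  closed : ∀ φ : Fm, φ.FV ⊆ S → Prv T G φ → φ ∈ G
  consistent : Fm.falsum ∉ G
  prime : ∀ φ ψ : Fm, φ.or ψ ∈ G → φ ∈ G ∨ ψ ∈ G
  witness : ∀ φ : Fm, φ.ex ∈ G → ∃ c ∈ S, φ.inst c ∈ G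

/-- Half of the unused variables become available as witnesses, and the other half is saved so that
the resulting world can be extended again. -/
theorem exists_infinite_split {S : Set ℕ} (h : Sᶜ.Infinite) :
    ∃ S' : Set ℕ, S ⊆ S' ∧ S'ᶜ.Infinite ∧ (S' \ S).Infinite := by
  let e := h.natEmbedding
  have he : Function.Injective fun n => (e n : ℕ) :=
    Subtype.val_injective.comp e.injective
  refine ⟨S ∪ Set.range fun n => (e (2 * n) : ℕ), Set.subset_union_left, ?_, ?_⟩
  · refine Set.infinite_of_injective_forall_mem (f := fun n => (e (2 * n + 1) : ℕ))
      (fun m n hmn => by have := he hmn; omega) fun n => ?_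
    rintro (h | ⟨m, hm⟩)
    · exact (e (2 * n + 1)).2 h
    · have := he hm
      omega
  · refine Set.infinite_of_injective_forall_mem (f := fun n => (e (2 * n) : ℕ))
      (fun m n hmn => by have := he hmn; omega) fun n => ?_
    exact ⟨Or.inr ⟨n, rfl⟩, (e (2 * n)).2⟩

/-- Henkin's construction: the theory is extended maximally among those that do not prove `χ`. This
maximality makes it prime: if neither disjunct belonged to it, each would prove `χ` when added, and
so would the disjunction. -/
theorem exists_world {T : Set Fm} (hT : ∀ φ ∈ T, ∀ σ, φ.rename σ ∈ T) {S : Set ℕ} {G : Set Fm}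
    {χ : Fm} (hne : S.Nonempty) (hS : Sᶜ.Infinite) (hG : ∀ φ ∈ G, φ.FV ⊆ S) (hχ : χ.FV ⊆ S)
    (h : ¬ Prv T G χ) : ∃ w : World T, S ⊆ w.S ∧ G ⊆ w.G ∧ χ ∉ w.G := by
  obtain ⟨S', hSS', hinf, hfresh⟩ := exists_infinite_split hS
  -- A stage mentions only finitely many variables outside `S`, so a fresh one in `S' \ S` is always
  -- left.
  let St := {G : Set Fm // (∃ F : Set ℕ, F.Finite ∧ F ⊆ S' ∧ ∀ φ ∈ G, φ.FV ⊆ S ∪ F) ∧ ¬ Prv T G χ}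
  have step : ∀ (G : St) (θ : Fm), ∃ G' : St, G.1 ⊆ G'.1 ∧ (θ.FV ⊆ S' →
      ¬ Prv T (insert θ G.1) χ → θ ∈ G'.1 ∧ ∀ ψ : Fm, θ = ψ.ex → ∃ c ∈ S', ψ.inst c ∈ G'.1) := by
    rintro ⟨G, ⟨F, hF, hFS, hGF⟩, hGχ⟩ θ
    by_cases hθ : θ.FV ⊆ S' ∧ ¬ Prv T (insert θ G) χ
    · obtain ⟨hθS, hθ⟩ := hθ
      have hGF' : ∀ φ ∈ insert θ G, φ.FV ⊆ S ∪ (F ∪ θ.FV) := by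
        rintro φ (rfl | hφ)
        · exact fun n hn => Or.inr (Or.inr hn)
        · exact (hGF φ hφ).trans (Set.union_subset_union_right _ Set.subset_union_left)
      by_cases hex : ∃ ψ : Fm, θ = ψ.ex
      · obtain ⟨ψ, rfl⟩ := hex
        obtain ⟨c, ⟨hcS', hcS⟩, hc⟩ := hfresh.exists_notMem_finite (hF.union (FV_finite ψ.ex))
        have hcn : c ∉ S ∪ (F ∪ ψ.ex.FV) := fun hh => hh.elim hcS hc
        refine ⟨⟨insert (ψ.inst c) (insert ψ.ex G),
          ⟨⟨F ∪ ψ.ex.FV ∪ {c}, (hF.union (FV_finite _)).union (Set.finite_singleton c), ?_, ?_⟩,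
          ?_⟩⟩, ?_, ?_⟩
        · exact Set.union_subset (Set.union_subset hFS hθS) (by simpa using hcS')
        · rintro φ (rfl | hφ)
          · refine FV_inst (fun n hn => ?_) (Or.inr (Or.inr rfl))
            exact Or.inr (Or.inl (Or.inr hn))
          · exact (hGF' φ hφ).trans (Set.union_subset_union_right _ Set.subset_union_left)
        · intro hp
          refine hθ (Prv.exE hT (c := c) ?_ ?_ ?_ hp (Prv.hyp (Set.mem_insert _ _)))
          · exact fun φ hφ hcφ => hcn (hGF' φ hφ hcφ)
          · exact fun hcφ => hcn (Or.inr (Or.inr hcφ))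
          · exact fun hcχ => hcS (hχ hcχ)
        · exact fun φ hφ => Or.inr (Or.inr hφ)
        · refine fun _ _ => ⟨Or.inr (Or.inl rfl), ?_⟩
          rintro ψ' e
          cases e
          exact ⟨c, hcS', Or.inl rfl⟩
      · exact ⟨⟨insert θ G, ⟨F ∪ θ.FV, hF.union (FV_finite _), Set.union_subset hFS hθS, hGF'⟩, hθ⟩,
          fun φ hφ => Or.inr hφ, fun _ _ => ⟨Or.inl rfl, fun ψ e => (hex ⟨ψ, e⟩).elim⟩⟩
    · exact ⟨⟨G, ⟨F, hF, hFS, hGF⟩, hGχ⟩, subset_rfl, fun h₁ h₂ => (hθ ⟨h₁, h₂⟩).elim⟩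
  choose next hnext hnext' using step
  have : Nonempty Fm := ⟨.falsum⟩
  obtain ⟨enum, henum⟩ := exists_surjective_nat Fm
  let seq : ℕ → St := fun n => Nat.rec
    ⟨G, ⟨∅, Set.finite_empty, Set.empty_subset _, by simpa using hG⟩, h⟩
    (fun n G => next G (enum n)) n
  have hmono : Monotone fun n => (seq n).1 := monotone_nat_of_le_succ fun n => hnext _ _
  let U : Set Fm := ⋃ n, (seq n).1
  have hUseq : ∀ n, (seq n).1 ⊆ U := fun n => Set.subset_iUnion (fun n => (seq n).1) n
  have hU : ¬ Prv T U χ := by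
    rintro ⟨L, hL, d⟩
    have : ∃ n, ∀ ψ ∈ L, ψ ∈ (seq n).1 := by
      clear d
      induction L with
      | nil => exact ⟨0, by simp⟩
      | cons a L ih =>
        obtain ⟨n, hn⟩ := ih fun ψ hψ => hL ψ (List.mem_cons_of_mem _ hψ)
        obtain ⟨m, hm⟩ := Set.mem_iUnion.1 (hL a List.mem_cons_self)
        refine ⟨max m n, ?_⟩
        rintro ψ hψ
        rcases List.mem_cons.1 hψ with rfl | hψ
        · exact hmono (le_max_left m n) hm
        · exact hmono (le_max_right m n) (hn ψ hψ)
    obtain ⟨n, hn⟩ := this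
    exact (seq n).2.2 ⟨L, hn, d⟩
  have hover : ∀ φ ∈ U, φ.FV ⊆ S' := by
    intro φ hφ
    obtain ⟨n, hn⟩ := Set.mem_iUnion.1 hφ
    obtain ⟨F, -, hFS, hF⟩ := (seq n).2.1
    exact (hF φ hn).trans (Set.union_subset hSS' hFS)
  -- If `θ` does not prove `χ` over the union, then neither did it over the smaller stage at which
  -- it was considered, so it was added there, along with a witness if it is existential.
  have hmax : ∀ θ : Fm, θ.FV ⊆ S' → ¬ Prv T (insert θ U) χ →
      θ ∈ U ∧ ∀ ψ : Fm, θ = ψ.ex → ∃ c ∈ S', ψ.inst c ∈ U := by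
    intro θ hθ hp
    obtain ⟨n, rfl⟩ := henum θ
    obtain ⟨h₁, h₂⟩ := hnext' (seq n) (enum n) hθ
      fun hq => hp (hq.mono (Set.insert_subset_insert (hUseq n)))
    refine ⟨hUseq (n + 1) h₁, fun ψ e => ?_⟩
    obtain ⟨c, hc, hcψ⟩ := h₂ ψ e
    exact ⟨c, hc, hUseq (n + 1) hcψ⟩
  have hclosed : ∀ φ : Fm, φ.FV ⊆ S' → Prv T U φ → φ ∈ U :=
    fun φ hφ hp => (hmax φ hφ fun hq => hU (hq.cut hp)).1
  refine ⟨⟨S', U, hne.mono hSS', hinf, hover, hclosed, ?_, ?_, ?_⟩, hSS', hUseq 0, ?_⟩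
  · exact fun hf => hU ((Prv.hyp hf).map₁ .falsumE)
  · intro φ ψ hor
    by_contra hn
    rw [not_or] at hn
    have hFV := hover _ hor
    have key : ∀ θ : Fm, θ.FV ⊆ S' → θ ∉ U → Prv T (insert θ U) χ := fun θ hθ hθU => by
      by_contra hp
      exact hθU (hmax θ hθ hp).1
    exact hU ((Prv.hyp hor).orE (key φ (fun n hn => hFV (Or.inl hn)) hn.1)
      (key ψ (fun n hn => hFV (Or.inr hn)) hn.2))
  · intro φ hex
    refine (hmax φ.ex (hover _ hex) fun hp => hU (hp.cut (Prv.hyp hex))).2 φ rfl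
  · exact fun hχU => hU (Prv.hyp hχU)

end CZFLogic

namespace CZFLogic
open Fm

/-! ## Kripke models -/

/-- Kripke models for the language of set theory, in which equality is interpreted by equality. -/
structure KModel where
  W : Type
  pre : Preorder W
  Q : W → Type
  nonempty : ∀ w, Nonempty (Q w)
  up : ∀ {w w' : W}, w ≤ w' → Q w → Q w'
  up_refl : ∀ {w : W} (h : w ≤ w) (x : Q w), up h x = x
  up_up : ∀ {w w' w'' : W} (h : w ≤ w') (h' : w' ≤ w'') (x : Q w),
    up h' (up h x) = up (h.trans h') x
  Mem : ∀ {w : W}, Q w → Q w → Prop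
  mem_up : ∀ {w w' : W} (h : w ≤ w') {x y : Q w}, Mem x y → Mem (up h x) (up h y)

namespace KModel

variable (M : KModel)

instance : Preorder M.W := M.pre

/-- The forcing relation. -/
def sat : Fm → ∀ {w : M.W}, (ℕ → M.Q w) → Prop
  | .falsum, _, _ => False
  | .mem x y, _, ρ => M.Mem (ρ x) (ρ y)
  | .eq x y, _, ρ => ρ x = ρ y
  | .and φ ψ, _, ρ => sat φ ρ ∧ sat ψ ρ
  | .or φ ψ, _, ρ => sat φ ρ ∨ sat ψ ρ
  | .imp φ ψ, w, ρ => ∀ w' (h : w ≤ w'),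
      sat φ (fun n => M.up h (ρ n)) → sat ψ (fun n => M.up h (ρ n))
  | .all φ, w, ρ => ∀ w' (h : w ≤ w') (x : M.Q w'), sat φ (scons x fun n => M.up h (ρ n))
  | .ex φ, _, ρ => ∃ x, sat φ (scons x ρ)

end KModel

/-! ## The canonical model -/

section Canonical

variable {T : Set Fm}

instance : Preorder (World T) where
  le w w' := w.S ⊆ w'.S ∧ w.G ⊆ w'.G
  le_refl _ := ⟨subset_rfl, subset_rfl⟩
  le_trans _ _ _ h h' := ⟨h.1.trans h'.1, h.2.trans h'.2⟩

namespace World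

theorem mem_of_subst (w : World T) (φ : Fm) {s t : ℕ} (h : Fm.eq s t ∈ w.G)
    (hφ : φ.all.FV ⊆ w.S) (h' : φ.inst s ∈ w.G) : φ.inst t ∈ w.G :=
  w.closed _ (FV_inst hφ (w.fv_subset _ h (by simp [FV])))
    ((Prv.hyp h).map₂ (Prv.hyp h') (Derivable.eqSubst s t))

theorem eq_symm (w : World T) {s t : ℕ} (h : Fm.eq s t ∈ w.G) : Fm.eq t s ∈ w.G := by
  have hs : s ∈ w.S := w.fv_subset _ h (by simp [FV])
  refine w.mem_of_subst (.eq 0 (s + 1)) h ?_ (w.closed _ ?_ ⟨[], by simp, .eqRefl s⟩)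
  · intro n hn
    simp only [FV, Set.mem_ofPred_eq, Set.mem_insert_iff, Set.mem_singleton_iff] at hn
    have : n = s := by omega
    exact this ▸ hs
  · intro n hn
    have hn : n ∈ (Fm.eq s s).FV := hn
    simp only [FV, Set.mem_insert_iff, Set.mem_singleton_iff, or_self] at hn
    exact hn ▸ hs

theorem eq_trans (w : World T) {r s t : ℕ} (h : Fm.eq r s ∈ w.G) (h' : Fm.eq s t ∈ w.G) :
    Fm.eq r t ∈ w.G := by
  have hr : r ∈ w.S := w.fv_subset _ h (by simp [FV])
  refine w.mem_of_subst (.eq (r + 1) 0) h' ?_ h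
  intro n hn
  simp only [FV, Set.mem_ofPred_eq, Set.mem_insert_iff, Set.mem_singleton_iff] at hn
  have : n = r := by omega
  exact this ▸ hr

theorem mem_congr (w : World T) {r s r' s' : ℕ} (h : Fm.eq r r' ∈ w.G) (h' : Fm.eq s s' ∈ w.G)
    (hm : Fm.mem r s ∈ w.G) : Fm.mem r' s' ∈ w.G := by
  have hr : r' ∈ w.S := w.fv_subset _ h (by simp [FV])
  have hs : s ∈ w.S := w.fv_subset _ h' (by simp [FV])
  refine w.mem_of_subst (.mem (r' + 1) 0) h' ?_ (w.mem_of_subst (.mem 0 (s + 1)) h ?_ hm)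
  · intro n hn
    simp only [FV, Set.mem_ofPred_eq, Set.mem_insert_iff, Set.mem_singleton_iff] at hn
    have : n = r' := by omega
    exact this ▸ hr
  · intro n hn
    simp only [FV, Set.mem_ofPred_eq, Set.mem_insert_iff, Set.mem_singleton_iff] at hn
    have : n = s := by omega
    exact this ▸ hs

/-- Provable equality. -/
def setoid (w : World T) : Setoid w.S where
  r x y := Fm.eq x y ∈ w.G
  iseqv :=
    { refl := fun x => w.closed _ (by simp [FV]) ⟨[], by simp, .eqRefl _⟩
      symm := w.eq_symm
      trans := w.eq_trans }

end World

/-- The model whose worlds are the saturated theories. -/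
def canonical (T : Set Fm) : KModel where
  W := World T
  pre := inferInstance
  Q w := Quotient w.setoid
  nonempty w := let ⟨x, hx⟩ := w.nonempty; ⟨Quotient.mk _ ⟨x, hx⟩⟩
  up h := Quotient.map (fun x => ⟨x.1, h.1 x.2⟩) fun _ _ hxy => h.2 hxy
  up_refl := by rintro w h ⟨x⟩; rfl
  up_up := by rintro w w' w'' h h' ⟨x⟩; rfl
  Mem {w} := Quotient.lift₂ (fun x y => Fm.mem x y ∈ w.G) fun _ _ _ _ h h' =>
    propext ⟨w.mem_congr h h', w.mem_congr (w.eq_symm h) (w.eq_symm h')⟩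
  mem_up := by rintro w w' h ⟨x⟩ ⟨y⟩ hxy; exact h.2 hxy

theorem FV_rename_subset {S : Set ℕ} (φ : Fm) (r : ℕ → S) :
    (φ.rename fun n => (r n : ℕ)).FV ⊆ S := by
  intro n hn
  obtain ⟨m, -, rfl⟩ := FV_rename _ _ n hn
  exact (r m).2

theorem scons_coe {S : Set ℕ} (c : S) (r : ℕ → S) :
    scons (c : ℕ) (fun n => (r n : ℕ)) = fun n => ((scons c r n : S) : ℕ) := by
  funext n; cases n <;> rfl

/-- The truth lemma. New worlds are needed for two connectives: an implication outside the theory is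
refuted at a world with the premise but without the conclusion, and a universal formula outside it
at a world whose domain has a fresh variable for which the instance is missing. -/
theorem sat_canonical (hT : ∀ φ ∈ T, ∀ σ, φ.rename σ ∈ T) (φ : Fm) (w : World T) (r : ℕ → w.S) :
    (canonical T).sat φ (w := w) (fun n => Quotient.mk _ (r n)) ↔
      φ.rename (fun n => (r n : ℕ)) ∈ w.G := by
  have cons_mk : ∀ (w : World T) (c : w.S) (r : ℕ → w.S),
      (scons (Quotient.mk w.setoid c) fun n => Quotient.mk w.setoid (r n)) =
        fun n => Quotient.mk w.setoid (scons c r n) := by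
    intro w c r
    funext n; cases n <;> rfl
  induction φ generalizing w with
  | falsum => exact iff_of_false id w.consistent
  | mem x y => exact Iff.rfl
  | eq x y => exact Quotient.eq (r := w.setoid)
  | and φ ψ h₁ h₂ =>
    refine (and_congr (h₁ w r) (h₂ w r)).trans ⟨fun h => ?_, fun h => ⟨?_, ?_⟩⟩
    · exact w.closed _ (FV_rename_subset (φ.and ψ) r) ((Prv.hyp h.1).map₂ (Prv.hyp h.2) .andI)
    · exact w.closed _ (FV_rename_subset φ r) ((Prv.hyp h).map₁ .andE₁)
    · exact w.closed _ (FV_rename_subset ψ r) ((Prv.hyp h).map₁ .andE₂)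
  | or φ ψ h₁ h₂ =>
    refine (or_congr (h₁ w r) (h₂ w r)).trans ⟨fun h => ?_, w.prime _ _⟩
    refine w.closed _ (FV_rename_subset (φ.or ψ) r) ?_
    exact h.elim (fun h => (Prv.hyp h).map₁ .orI₁) fun h => (Prv.hyp h).map₁ .orI₂
  | imp φ ψ h₁ h₂ =>
    constructor
    · intro h
      by_contra hn
      have hp : ¬ Prv T (insert (φ.rename fun n => (r n : ℕ)) w.G)
          (ψ.rename fun n => (r n : ℕ)) := fun hp =>
        hn (w.closed _ (FV_rename_subset (φ.imp ψ) r) hp.impI)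
      obtain ⟨w', hS, hG, hψ⟩ := exists_world hT w.nonempty w.infinite (by
        rintro θ (rfl | hθ)
        · exact FV_rename_subset φ r
        · exact w.fv_subset _ hθ) (FV_rename_subset ψ r) hp
      have hw : w ≤ w' := ⟨hS, fun θ hθ => hG (Or.inr hθ)⟩
      exact hψ ((h₂ w' fun n => ⟨r n, hS (r n).2⟩).1
        (h w' hw ((h₁ w' fun n => ⟨r n, hS (r n).2⟩).2 (hG (Or.inl rfl)))))
    · intro h w' hw hφ
      refine (h₂ w' fun n => ⟨r n, hw.1 (r n).2⟩).2 ?_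
      exact w'.closed _ (FV_rename_subset ψ fun n => ⟨r n, hw.1 (r n).2⟩)
        ((Prv.hyp (hw.2 h)).impE (Prv.hyp ((h₁ w' fun n => ⟨r n, hw.1 (r n).2⟩).1 hφ)))
  | all φ ih =>
    constructor
    · intro h
      by_contra hn
      obtain ⟨c, hc⟩ := w.infinite.nonempty
      have hFV := FV_rename_subset φ.all r
      have hp : ¬ Prv T w.G ((φ.rename (Fm.up fun n => (r n : ℕ))).inst c) := fun hp =>
        hn (w.closed _ hFV (hp.allI hT (fun ψ hψ hcψ => hc (w.fv_subset ψ hψ hcψ))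
          fun hcφ => hc (hFV hcφ)))
      have hinf : (insert c w.S)ᶜ.Infinite := by
        have : (insert c w.S)ᶜ = w.Sᶜ \ {c} := by ext; simp [and_comm]
        exact this ▸ w.infinite.sdiff (Set.finite_singleton c)
      obtain ⟨w', hS, hG, hψ⟩ := exists_world hT (Set.insert_nonempty c w.S) hinf
        (fun θ hθ => (w.fv_subset θ hθ).trans (Set.subset_insert _ _))
        (FV_inst (hFV.trans (Set.subset_insert _ _)) (Set.mem_insert _ _)) hp
      have hw : w ≤ w' := ⟨(Set.subset_insert _ _).trans hS, hG⟩
      have := h w' hw (Quotient.mk _ ⟨c, hS (Set.mem_insert _ _)⟩)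
      refine hψ ?_
      rw [inst_rename_up]
      have h' := (ih w' (scons ⟨c, hS (Set.mem_insert _ _)⟩ fun n => ⟨r n, hw.1 (r n).2⟩)).1
        ((cons_mk _ _ _) ▸ this)
      rwa [← scons_coe] at h'
    · rintro h w' hw ⟨c⟩
      have := (ih w' (scons c fun n => ⟨r n, hw.1 (r n).2⟩)).2 (by
        have h' := w'.closed _ (FV_inst (w'.fv_subset _ (hw.2 h)) c.2)
          ((Prv.hyp (hw.2 h)).map₁ (.allE (c : ℕ)))
        rw [inst_rename_up] at h'
        rwa [← scons_coe])
      exact (cons_mk _ _ _).symm ▸ this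
  | ex φ ih =>
    constructor
    · rintro ⟨⟨c⟩, h⟩
      have h' := (ih w (scons c r)).1 ((cons_mk _ _ _) ▸ h)
      rw [← scons_coe, ← inst_rename_up] at h'
      exact w.closed _ (FV_rename_subset φ.ex r) ((Prv.hyp h').map₁ (.exI (c : ℕ)))
    · intro h
      obtain ⟨c, hc, h'⟩ := w.witness _ h
      refine ⟨Quotient.mk _ ⟨c, hc⟩, ?_⟩
      have := (ih w (scons ⟨c, hc⟩ r)).2 (by rwa [← scons_coe, ← inst_rename_up])
      exact (cons_mk _ _ _).symm ▸ this

/-- Completeness of intuitionistic logic for Kripke models. -/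
theorem derivable_of_forall_model (hT : ∀ φ ∈ T, ∀ σ, φ.rename σ ∈ T) (χ : Fm)
    (h : ∀ M : KModel, (∀ φ ∈ T, ∀ (w : M.W) (ρ : ℕ → M.Q w), M.sat φ ρ) →
      ∀ (w : M.W) (ρ : ℕ → M.Q w), M.sat χ ρ) : Derivable T [] χ := by
  by_contra hn
  have hp : ¬ Prv T ∅ χ := by
    rintro ⟨L, hL, d⟩
    exact hn (d.weaken fun ψ hψ => (hL ψ hψ).elim)
  -- The variable `0` keeps the domain nonempty when `χ` is closed, and it is the default value of
  -- the assignment below.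
  have hfin : (insert 0 χ.FV).Finite := (FV_finite χ).insert 0
  obtain ⟨w, hS, -, hχ⟩ := exists_world hT (Set.insert_nonempty 0 χ.FV) hfin.infinite_compl
    (G := ∅) (by simp) (Set.subset_insert _ _) hp
  have h0 : 0 ∈ w.S := hS (Set.mem_insert _ _)
  classical
  let r : ℕ → w.S := fun n => if hn : n ∈ w.S then ⟨n, hn⟩ else ⟨0, h0⟩
  have key := (sat_canonical hT χ w r).1 (h (canonical T) (fun φ hφ w ρ => ?_) w _)
  · refine hχ ?_
    rw [← rename_id χ, rename_congr (τ := fun n => (r n : ℕ))]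
    · exact key
    · intro n hn
      have : n ∈ w.S := hS (Set.mem_insert_of_mem _ hn)
      simp [r, this]
  · have : ρ = fun n => Quotient.mk (World.setoid w) (ρ n).out := by
      funext n; exact (Quotient.out_eq _).symm
    rw [this]
    exact (sat_canonical hT φ w _).2
      (World.closed w _ (FV_rename_subset φ _) ⟨[], by simp, .ax (hT φ hφ _)⟩)

end Canonical

end CZFLogic

namespace CZFLogic
open Fm

/-! ## The axioms are closed under renaming -/

/-- A renaming under `d` quantifiers. -/
def upn (d : ℕ) (σ : ℕ → ℕ) (n : ℕ) : ℕ := if n < d then n else σ (n - d) + d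

theorem up_eq_upn (σ : ℕ → ℕ) : up σ = upn 1 σ := by
  funext n; cases n <;> simp [up, upn]

theorem up_upn (d : ℕ) (σ : ℕ → ℕ) : up (upn d σ) = upn (d + 1) σ := by
  funext n
  cases n with
  | zero => simp [up, upn]
  | succ n =>
    by_cases h : n < d
    · simp [up, upn, h]
    · simp [up, upn, h]
      omega

/-- The variables named in `xs` are bound by the `d` outer quantifiers, so a renaming reaches only
the parameters of `φ`. -/
theorem app_rename (φ : Fm) (xs : List Var) (d : ℕ) (σ : ℕ → ℕ) (h : ∀ x ∈ xs, x < d) :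
    (Form.app φ xs d).rename (upn d σ) = Form.app (φ.rename (upn xs.length σ)) xs d := by
  simp only [Form.app, rename_rename]
  congr 1
  funext i
  by_cases hi : i < xs.length
  · have key : ∀ x : ℕ, x < d → upn d σ (d - 1 - x) = d - 1 - x := fun x hx => by
      simp [upn, show d - 1 - x < d by omega]
    have e : upn xs.length σ i = i := by simp [upn, hi]
    simp [hi, e, key _ (h _ (List.getElem_mem hi))]
  · simp [upn, hi]

/-- The schemes have free parameters instead of universal closures. A renaming of the axiom is
therefore the instance for a renamed `φ`, and completeness requires this stability. -/
theorem CZFAxiom.rename {φ : Fm} (h : CZFAxiom φ) (σ : ℕ → ℕ) : CZFAxiom (φ.rename σ) := by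
  cases h with
  | extensionality => exact .extensionality
  | pairing => exact .pairing
  | union => exact .union
  | infinity => exact .infinity
  | boundedSeparation φ h =>
    convert CZFAxiom.boundedSeparation (φ.rename (upn 1 σ)) (h.rename _) using 1
    simp only [Form.separation, Form.all, Form.ex, Form.iff, Form.and, Form.imp, Fm.rename]
    rw [up_eq_upn σ]
    simp [up_upn, app_rename, Form.mem, Fm.rename, upn]
  | setInduction φ =>
    convert CZFAxiom.setInduction (φ.rename (upn 1 σ)) using 1
    simp only [Form.setInduction, Form.ball, Form.all, Form.imp, Fm.rename]
    rw [up_eq_upn σ]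
    simp [up_upn, app_rename, Form.mem, Fm.rename, upn]
  | strongCollection φ =>
    convert CZFAxiom.strongCollection (φ.rename (upn 2 σ)) using 1
    simp only [Form.strongCollection, Form.ball, Form.bex, Form.all, Form.ex, Form.and, Form.imp,
      Fm.rename]
    rw [up_eq_upn σ]
    simp [up_upn, app_rename, Form.mem, Fm.rename, upn]
  | subsetCollection φ =>
    convert CZFAxiom.subsetCollection (φ.rename (upn 3 σ)) using 1
    simp only [Form.subsetCollection, Form.ball, Form.bex, Form.all, Form.ex, Form.and, Form.imp,
      Fm.rename]
    rw [up_eq_upn σ]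
    simp [up_upn, app_rename, Form.mem, Fm.rename, upn]

/-! ### Forcing under renaming and along the order of worlds -/

namespace KModel

variable {M : KModel}

attribute [simp] up_refl up_up scons_zero scons_succ

theorem scons_comp_up {α : Type*} (x : α) (ρ : ℕ → α) (σ : ℕ → ℕ) :
    (fun n => scons x ρ (Fm.up σ n)) = scons x fun n => ρ (σ n) := by
  funext n; cases n <;> rfl

theorem up_scons {w w' : M.W} (h : w ≤ w') (x : M.Q w) (ρ : ℕ → M.Q w) :
    (fun n => M.up h (scons x ρ n)) = scons (M.up h x) fun n => M.up h (ρ n) := by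
  funext n; cases n <;> rfl

theorem sat_rename (φ : Fm) (σ : ℕ → ℕ) {w : M.W} (ρ : ℕ → M.Q w) :
    M.sat (φ.rename σ) ρ ↔ M.sat φ fun n => ρ (σ n) := by
  induction φ generalizing σ w with
  | falsum => exact Iff.rfl
  | mem x y => exact Iff.rfl
  | eq x y => exact Iff.rfl
  | and _ _ h₁ h₂ => exact and_congr (h₁ _ _) (h₂ _ _)
  | or _ _ h₁ h₂ => exact or_congr (h₁ _ _) (h₂ _ _)
  | imp _ _ h₁ h₂ => exact forall₂_congr fun w' h => imp_congr (h₁ _ _) (h₂ _ _)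
  | all _ ih =>
    refine forall₂_congr fun w' h => forall_congr' fun x => ?_
    rw [ih, scons_comp_up]
  | ex _ ih =>
    refine exists_congr fun x => ?_
    rw [ih, scons_comp_up]

theorem sat_up (φ : Fm) {w w' : M.W} (h : w ≤ w') {ρ : ℕ → M.Q w} (hφ : M.sat φ ρ) :
    M.sat φ fun n => M.up h (ρ n) := by
  induction φ generalizing w with
  | falsum => exact hφ
  | mem x y => exact M.mem_up h hφ
  | eq x y => exact congrArg (M.up h) hφ
  | and _ _ h₁ h₂ => exact ⟨h₁ h hφ.1, h₂ h hφ.2⟩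
  | or _ _ h₁ h₂ => exact hφ.imp (h₁ h) (h₂ h)
  | imp _ _ h₁ h₂ =>
    intro w'' h'
    simpa using hφ w'' (h.trans h')
  | all _ ih =>
    intro w'' h'
    simpa using hφ w'' (h.trans h')
  | ex _ ih =>
    obtain ⟨x, hx⟩ := hφ
    exact ⟨M.up h x, by simpa only [up_scons] using ih h hx⟩

instance {w : M.W} : Membership (M.Q w) (M.Q w) := ⟨fun y x => M.Mem x y⟩

theorem up_mem {w w' : M.W} (h : w ≤ w') {x y : M.Q w} (hxy : x ∈ y) : M.up h x ∈ M.up h y :=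
  M.mem_up h hxy

/-! ## Bounded quantifiers -/

@[simp] theorem sat_mem (x y : ℕ) {w : M.W} (ρ : ℕ → M.Q w) :
    M.sat (.mem x y) ρ ↔ ρ x ∈ ρ y := Iff.rfl

@[simp] theorem sat_eq (x y : ℕ) {w : M.W} (ρ : ℕ → M.Q w) :
    M.sat (.eq x y) ρ ↔ ρ x = ρ y := Iff.rfl

@[simp] theorem sat_and (φ ψ : Fm) {w : M.W} (ρ : ℕ → M.Q w) :
    M.sat (.and φ ψ) ρ ↔ M.sat φ ρ ∧ M.sat ψ ρ := Iff.rfl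

@[simp] theorem sat_or (φ ψ : Fm) {w : M.W} (ρ : ℕ → M.Q w) :
    M.sat (.or φ ψ) ρ ↔ M.sat φ ρ ∨ M.sat ψ ρ := Iff.rfl

@[simp] theorem sat_imp (φ ψ : Fm) {w : M.W} (ρ : ℕ → M.Q w) :
    M.sat (.imp φ ψ) ρ ↔ ∀ w' (h : w ≤ w'),
      M.sat φ (fun n => M.up h (ρ n)) → M.sat ψ (fun n => M.up h (ρ n)) := Iff.rfl

@[simp] theorem sat_all (φ : Fm) {w : M.W} (ρ : ℕ → M.Q w) :
    M.sat (.all φ) ρ ↔ ∀ w' (h : w ≤ w') (x : M.Q w'),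
      M.sat φ (scons x fun n => M.up h (ρ n)) := Iff.rfl

@[simp] theorem sat_ex (φ : Fm) {w : M.W} (ρ : ℕ → M.Q w) :
    M.sat (.ex φ) ρ ↔ ∃ x, M.sat φ (scons x ρ) := Iff.rfl

end KModel

namespace Fm

/-- `∀ x ∈ y, φ` -/
def ball (y : ℕ) (φ : Fm) : Fm := all (imp (mem 0 (y + 1)) φ)

/-- `∃ x ∈ y, φ` -/
def bex (y : ℕ) (φ : Fm) : Fm := ex (and (mem 0 (y + 1)) φ)

/-- `∀ x, φ → ψ` -/
def allImp (φ ψ : Fm) : Fm := all (imp φ ψ)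

/-- `∀ x, φ ↔ ψ` -/
def allIff (φ ψ : Fm) : Fm := all (and (imp φ ψ) (imp ψ φ))

end Fm

namespace KModel

variable {M : KModel}

-- The quantifier and the implication each pass to a later world; by functoriality of `up` the two
-- passages merge into one. Formulas built from such combinations are read without chains of worlds.
@[simp] theorem sat_allImp (φ ψ : Fm) {w : M.W} (ρ : ℕ → M.Q w) :
    M.sat (allImp φ ψ) ρ ↔ ∀ w' (h : w ≤ w') (x : M.Q w'),
      M.sat φ (scons x fun n => M.up h (ρ n)) → M.sat ψ (scons x fun n => M.up h (ρ n)) := by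
  constructor
  · intro H w' h x hx
    simpa using H w' h x w' le_rfl (by simpa using hx)
  · intro H w' h x w'' h' hx
    rw [up_scons] at hx ⊢
    simp only [up_up] at hx ⊢
    exact H _ _ _ hx

@[simp] theorem sat_allIff (φ ψ : Fm) {w : M.W} (ρ : ℕ → M.Q w) :
    M.sat (allIff φ ψ) ρ ↔ ∀ w' (h : w ≤ w') (x : M.Q w'),
      (M.sat φ (scons x fun n => M.up h (ρ n)) ↔ M.sat ψ (scons x fun n => M.up h (ρ n))) := by
  have : M.sat (allIff φ ψ) ρ ↔ M.sat (allImp φ ψ) ρ ∧ M.sat (allImp ψ φ) ρ :=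
    ⟨fun H => ⟨fun w' h x => (H w' h x).1, fun w' h x => (H w' h x).2⟩,
      fun H w' h x => ⟨H.1 w' h x, H.2 w' h x⟩⟩
  rw [this, sat_allImp, sat_allImp]
  exact ⟨fun H w' h x => ⟨H.1 w' h x, H.2 w' h x⟩,
    fun H => ⟨fun w' h x => (H w' h x).1, fun w' h x => (H w' h x).2⟩⟩

@[simp] theorem sat_ball (y : ℕ) (φ : Fm) {w : M.W} (ρ : ℕ → M.Q w) :
    M.sat (ball y φ) ρ ↔ ∀ w' (h : w ≤ w') (x : M.Q w'), x ∈ M.up h (ρ y) →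
      M.sat φ (scons x fun n => M.up h (ρ n)) := sat_allImp _ _ _

@[simp] theorem sat_bex (y : ℕ) (φ : Fm) {w : M.W} (ρ : ℕ → M.Q w) :
    M.sat (bex y φ) ρ ↔ ∃ x ∈ ρ y, M.sat φ (scons x ρ) := Iff.rfl

/-- A model of `CZF`. -/
class IsCZF (M : KModel) : Prop where
  sat_axiom : ∀ φ, CZFAxiom φ → ∀ (w : M.W) (ρ : ℕ → M.Q w), M.sat φ ρ

/-! ## The axioms in a model -/

section Axioms

variable [IsCZF M] {w : M.W}

/-- The premise of extensionality is forced only if it also holds for elements that appear at later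
worlds, so members have to be compared there too. -/
theorem ext {x y : M.Q w} (h : ∀ w' (h : w ≤ w') (z : M.Q w'), z ∈ M.up h x ↔ z ∈ M.up h y) :
    x = y := by
  have := IsCZF.sat_axiom _ .extensionality w (fun _ => x) w le_rfl x w le_rfl y w le_rfl
  simp only [up_refl] at this
  refine this ((sat_allIff (.mem 0 2) (.mem 0 1) _).2 ?_)
  simpa using h

/-- The set `c` consists of the `z` with `P z`. -/
def Compr (c : M.Q w) (P : ∀ w', w ≤ w' → M.Q w' → Prop) : Prop :=
  ∀ w' (h : w ≤ w') (z : M.Q w'), z ∈ M.up h c ↔ P w' h z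

theorem exists_upair (x y : M.Q w) :
    ∃ c : M.Q w, Compr c fun _ h z => z = M.up h x ∨ z = M.up h y := by
  obtain ⟨c, hc⟩ := IsCZF.sat_axiom _ .pairing w (fun _ => x) w le_rfl x w le_rfl y
  have := (sat_allIff (.mem 0 1) (.or (.eq 0 3) (.eq 0 2)) _).1 hc
  refine ⟨c, fun w' h z => ?_⟩
  simpa using this w' h z

theorem exists_sUnion (x : M.Q w) :
    ∃ c : M.Q w, Compr c fun _ h z => ∃ y ∈ M.up h x, z ∈ y := by
  obtain ⟨c, hc⟩ := IsCZF.sat_axiom _ .union w (fun _ => x) w le_rfl x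
  have := (sat_allIff (.mem 0 1) (bex 2 (.mem 1 0)) _).1 hc
  refine ⟨c, fun w' h z => ?_⟩
  simpa using this w' h z

theorem exists_sep (φ : Fm) (hφ : φ.IsBounded) (ρ : ℕ → M.Q w) (a : M.Q w) :
    ∃ c : M.Q w, Compr c fun _ h z => z ∈ M.up h a ∧ M.sat φ (scons z fun n => M.up h (ρ n)) := by
  obtain ⟨c, hc⟩ := IsCZF.sat_axiom _ (.boundedSeparation φ hφ) w ρ w le_rfl a
  -- The element is the third variable to be bound: its name is `2`, and below three quantifiers its
  -- index is `0`.
  have := (sat_allIff (.mem 0 1) (.and (.mem 0 2) (Form.app φ [2] 3)) _).1 hc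
  refine ⟨c, fun w' h z => ?_⟩
  rw [show (z ∈ M.up h c) ↔ _ from this w' h z]
  simp only [sat_and, sat_mem, Form.app, sat_rename]
  refine and_congr (by simp) (iff_of_eq (congrArg _ ?_))
  funext n
  cases n <;> simp

theorem set_induction (φ : Fm) (ρ : ℕ → M.Q w)
    (H : ∀ w' (h : w ≤ w') (a : M.Q w'),
      (∀ w'' (h' : w' ≤ w'') (x : M.Q w''), x ∈ M.up h' a →
        M.sat φ (scons x fun n => M.up (h.trans h') (ρ n))) →
      M.sat φ (scons a fun n => M.up h (ρ n))) (a : M.Q w) : M.sat φ (scons a ρ) := by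
  have hax := IsCZF.sat_axiom _ (.setInduction φ) w ρ w le_rfl
  have := hax ((sat_allImp (ball 0 (Form.app φ [1] 2)) (Form.app φ [0] 1) _).2 ?_) w le_rfl a
  · simp only [up_refl, Form.app, sat_rename] at this
    convert this using 2
    rename_i n
    cases n <;> simp
  · intro w' h x hx
    simp only [sat_ball, Form.app, sat_rename] at hx ⊢
    convert H w' h x ?_ using 2
    · rename_i n
      cases n <;> simp
    · intro w'' h' y hy
      convert hx w'' h' y (by simpa using hy) using 2
      rename_i n
      cases n <;> simp

theorem strong_collection (φ : Fm) (ρ : ℕ → M.Q w) (a : M.Q w)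
    (H : ∀ w' (h : w ≤ w') (x : M.Q w'), x ∈ M.up h a →
      ∃ y, M.sat φ (scons x (scons y fun n => M.up h (ρ n)))) :
    ∃ b : M.Q w,
      (∀ w' (h : w ≤ w') (x : M.Q w'), x ∈ M.up h a →
        ∃ y ∈ M.up h b, M.sat φ (scons x (scons y fun n => M.up h (ρ n)))) ∧
      ∀ w' (h : w ≤ w') (y : M.Q w'), y ∈ M.up h b →
        ∃ x ∈ M.up h a, M.sat φ (scons x (scons y fun n => M.up h (ρ n))) := by
  have hax := IsCZF.sat_axiom _ (.strongCollection φ) w ρ w le_rfl a w le_rfl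
  obtain ⟨b, hb₁, hb₂⟩ := hax ((sat_ball 0 (.ex (Form.app φ [1, 2] 3)) _).2 fun w' h x hx => by
    obtain ⟨y, hy⟩ := H w' h x (by simpa using hx)
    refine ⟨y, ?_⟩
    simp only [Form.app, sat_rename]
    convert hy using 2
    rename_i n
    rcases n with _ | _ | n <;> simp)
  have h₁ := (sat_ball 1 (bex 1 (Form.app φ [2, 3] 4)) _).1 hb₁
  have h₂ := (sat_ball 0 (bex 2 (Form.app φ [3, 2] 4)) _).1 hb₂
  refine ⟨b, fun w' h x hx => ?_, fun w' h y hy => ?_⟩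
  · obtain ⟨y, hy, hxy⟩ := h₁ w' h x (by simpa using hx)
    refine ⟨y, hy, ?_⟩
    simp only [Form.app, sat_rename] at hxy
    convert hxy using 2
    rename_i n
    rcases n with _ | _ | n <;> simp
  · obtain ⟨x, hx, hxy⟩ := h₂ w' h y (by simpa using hy)
    refine ⟨x, by simpa using hx, ?_⟩
    simp only [Form.app, sat_rename] at hxy
    convert hxy using 2
    rename_i n
    rcases n with _ | _ | n <;> simp

end Axioms

end KModel

end CZFLogic

namespace CZFLogic
open Fm

namespace KModel

theorem mem_of_compr {M : KModel} {w : M.W} {c : M.Q w} {P : ∀ w', w ≤ w' → M.Q w' → Prop}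
    (h : Compr c P) (z : M.Q w) : z ∈ c ↔ P w le_rfl z := by
  simpa using h w le_rfl z

variable {M : KModel} [IsCZF M] {w w' : M.W}

/-! ## Set-theoretic operations in a model -/

/-- The unordered pair. -/
noncomputable def upair (x y : M.Q w) : M.Q w := (exists_upair x y).choose

theorem mem_upair' {x y : M.Q w} (h : w ≤ w') (z : M.Q w') :
    z ∈ M.up h (upair x y) ↔ z = M.up h x ∨ z = M.up h y := (exists_upair x y).choose_spec _ h z

@[simp] theorem mem_upair {x y z : M.Q w} : z ∈ upair x y ↔ z = x ∨ z = y := by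
  simpa using mem_upair' (x := x) (y := y) le_rfl z

-- The pair is chosen separately at each world; extensionality makes these choices compatible.
@[simp] theorem up_upair (h : w ≤ w') (x y : M.Q w) :
    M.up h (upair x y) = upair (M.up h x) (M.up h y) :=
  ext fun w'' h' z => by simp [mem_upair']

/-- The ordered pair. -/
noncomputable def pair (x y : M.Q w) : M.Q w := upair (upair x x) (upair x y)

@[simp] theorem up_pair (h : w ≤ w') (x y : M.Q w) :
    M.up h (pair x y) = pair (M.up h x) (M.up h y) := by
  simp [pair]

theorem upair_left_inj {x y z : M.Q w} (h : upair x y = upair x z) : y = z := by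
  have hy : y ∈ upair x z := h ▸ mem_upair.2 (Or.inr rfl)
  have hz : z ∈ upair x y := h ▸ mem_upair.2 (Or.inr rfl)
  rw [mem_upair] at hy hz
  rcases hy with rfl | rfl
  · rcases hz with rfl | rfl <;> rfl
  · rfl

theorem upair_self_eq {x y z : M.Q w} (h : upair x x = upair y z) : x = y ∧ x = z := by
  have hy : y ∈ upair x x := h ▸ mem_upair.2 (Or.inl rfl)
  have hz : z ∈ upair x x := h ▸ mem_upair.2 (Or.inr rfl)
  rw [mem_upair, or_self] at hy hz
  exact ⟨hy.symm, hz.symm⟩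

@[simp] theorem pair_inj {x y x' y' : M.Q w} : pair x y = pair x' y' ↔ x = x' ∧ y = y' := by
  refine ⟨fun h => ?_, by rintro ⟨rfl, rfl⟩; rfl⟩
  have hx : upair x x ∈ pair x' y' := h ▸ mem_upair.2 (Or.inl rfl)
  have e : x = x' := (mem_upair.1 hx).elim (fun h => (upair_self_eq h).1) fun h => (upair_self_eq h).1
  subst e
  exact ⟨rfl, upair_left_inj (upair_left_inj h)⟩

/-- The union of a set of sets. -/
noncomputable def sUnion (x : M.Q w) : M.Q w := (exists_sUnion x).choose

theorem mem_sUnion' {x : M.Q w} (h : w ≤ w') (z : M.Q w') :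
    z ∈ M.up h (sUnion x) ↔ ∃ y ∈ M.up h x, z ∈ y := (exists_sUnion x).choose_spec _ h z

@[simp] theorem mem_sUnion {x z : M.Q w} : z ∈ sUnion x ↔ ∃ y ∈ x, z ∈ y := by
  simpa using mem_sUnion' (x := x) le_rfl z

@[simp] theorem up_sUnion (h : w ≤ w') (x : M.Q w) : M.up h (sUnion x) = sUnion (M.up h x) :=
  ext fun w'' h' z => by simp [mem_sUnion']

/-- The union of two sets. -/
noncomputable def union (x y : M.Q w) : M.Q w := sUnion (upair x y)

@[simp] theorem mem_union {x y z : M.Q w} : z ∈ union x y ↔ z ∈ x ∨ z ∈ y := by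
  simp [union]

@[simp] theorem up_union (h : w ≤ w') (x y : M.Q w) :
    M.up h (union x y) = union (M.up h x) (M.up h y) := by
  simp [union]

theorem exists_empty (w : M.W) : ∃ c : M.Q w, Compr c fun _ _ _ => False := by
  obtain ⟨x⟩ := M.nonempty w
  obtain ⟨c, hc⟩ := exists_sep .falsum .falsum (fun _ => x) x
  exact ⟨c, fun w' h z => (hc w' h z).trans (iff_of_eq (and_false _))⟩

/-- The empty set. -/
noncomputable def empty : M.Q w := (exists_empty w).choose

theorem not_mem_empty {x : M.Q w} : x ∉ (empty : M.Q w) := by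
  have := (exists_empty w).choose_spec w le_rfl x
  rw [up_refl] at this
  exact this.1

@[simp] theorem up_empty (h : w ≤ w') : M.up h empty = empty :=
  ext fun w'' h' z => by
    refine iff_of_false ?_ ?_
    · rw [up_up]
      exact ((exists_empty w).choose_spec w'' _ z).1
    · exact ((exists_empty w').choose_spec w'' _ z).1

theorem eq_empty {x : M.Q w} (h : ∀ w' (h : w ≤ w') (z : M.Q w'), z ∉ M.up h x) : x = empty :=
  ext fun w' hw z => iff_of_false (h w' hw z) (by simpa using not_mem_empty)

/-! ## Formulas for the operations -/

theorem sat_isSingleton (z x : ℕ) (ρ : ℕ → M.Q w) :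
    M.sat (.and (.mem x z) (ball z (.eq 0 (x + 1)))) ρ ↔ ρ z = upair (ρ x) (ρ x) := by
  constructor
  · intro h
    simp only [sat_and, sat_mem, sat_ball, sat_eq, scons_zero, scons_succ] at h
    refine ext fun w' hw y => ⟨fun hy => ?_, fun hy => ?_⟩
    · simpa using h.2 w' hw y hy
    · have : y = M.up hw (ρ x) := by simpa using hy
      exact this ▸ up_mem hw h.1
  · intro h
    simp [h]

theorem sat_isUnorderedPair (z x y : ℕ) (ρ : ℕ → M.Q w) :
    M.sat (.and (.mem x z) (.and (.mem y z) (ball z (.or (.eq 0 (x + 1)) (.eq 0 (y + 1)))))) ρ ↔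
      ρ z = upair (ρ x) (ρ y) := by
  constructor
  · intro h
    simp only [sat_and, sat_or, sat_mem, sat_ball, sat_eq, scons_zero, scons_succ] at h
    refine ext fun w' hw u => ⟨fun hu => ?_, fun hu => ?_⟩
    · simpa using h.2.2 w' hw u hu
    · have : u = M.up hw (ρ x) ∨ u = M.up hw (ρ y) := by simpa using hu
      rcases this with rfl | rfl
      · exact up_mem hw h.1
      · exact up_mem hw h.2.1
  · intro h
    simp [h]

end KModel

namespace Fm

/-- `z = {x}` -/
def isSing (z x : ℕ) : Fm := .and (.mem x z) (ball z (.eq 0 (x + 1)))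

/-- `z = {x, y}` -/
def isUPair (z x y : ℕ) : Fm :=
  .and (.mem x z) (.and (.mem y z) (ball z (.or (.eq 0 (x + 1)) (.eq 0 (y + 1)))))

/-- `p = (x, y)` -/
def isPair (p x y : ℕ) : Fm :=
  .and (bex p (isSing 0 (x + 1)))
    (.and (bex p (isUPair 0 (x + 1) (y + 1)))
      (ball p (.or (isSing 0 (x + 1)) (isUPair 0 (x + 1) (y + 1)))))

/-- `(x, y) ∈ r` -/
def pairMem (x y r : ℕ) : Fm := bex r (isPair 0 (x + 1) (y + 1))

theorem isBounded_isPair (p x y : ℕ) : (isPair p x y).IsBounded := by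
  repeat constructor

theorem isBounded_pairMem (x y r : ℕ) : (pairMem x y r).IsBounded :=
  .bex _ (isBounded_isPair _ _ _)

end Fm

namespace KModel

variable {M : KModel} [IsCZF M] {w w' : M.W}

@[simp] theorem sat_isSing (z x : ℕ) (ρ : ℕ → M.Q w) :
    M.sat (isSing z x) ρ ↔ ρ z = upair (ρ x) (ρ x) := sat_isSingleton _ _ _

@[simp] theorem sat_isUPair (z x y : ℕ) (ρ : ℕ → M.Q w) :
    M.sat (isUPair z x y) ρ ↔ ρ z = upair (ρ x) (ρ y) := sat_isUnorderedPair _ _ _ _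

@[simp] theorem sat_isPair (p x y : ℕ) (ρ : ℕ → M.Q w) :
    M.sat (isPair p x y) ρ ↔ ρ p = pair (ρ x) (ρ y) := by
  constructor
  · intro h
    simp only [isPair, sat_and, sat_or, sat_bex, sat_ball, sat_isSing, sat_isUPair, scons_zero,
      scons_succ] at h
    obtain ⟨⟨_, h₁, rfl⟩, ⟨_, h₂, rfl⟩, h₃⟩ := h
    refine ext fun w' hw u => ⟨fun hu => ?_, fun hu => ?_⟩
    · simpa [pair] using h₃ w' hw u hu
    · have : u = M.up hw (upair (ρ x) (ρ x)) ∨ u = M.up hw (upair (ρ x) (ρ y)) := by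
        simpa [pair] using hu
      rcases this with rfl | rfl
      · exact up_mem hw h₁
      · exact up_mem hw h₂
  · intro h
    simp [isPair, h, pair]

@[simp] theorem sat_pairMem (x y r : ℕ) (ρ : ℕ → M.Q w) :
    M.sat (pairMem x y r) ρ ↔ pair (ρ x) (ρ y) ∈ ρ r := by
  simp [pairMem]

/-! ### Unions of families, replacement, products and infinity in a model -/

/-- Families of sets have unions. -/
theorem exists_iUnion (φ : Fm) (ρ : ℕ → M.Q w) (a : M.Q w)
    (H : ∀ w' (h : w ≤ w') (x : M.Q w'), x ∈ M.up h a → ∃ s : M.Q w', Compr s fun _ h' z =>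
      M.sat φ (scons (M.up h' x) (scons z fun n => M.up (h.trans h') (ρ n)))) :
    ∃ c : M.Q w, Compr c fun _ h z => ∃ x ∈ M.up h a,
      M.sat φ (scons x (scons z fun n => M.up h (ρ n))) := by
  -- `ψ` says that `s` is the set of the `z` with `φ(x, z)`. In `φ` the variable `x` precedes `z`,
  -- whereas under the new quantifier the order is `z`, `x`, `s`.
  let ψ : Fm := allIff (.mem 0 2) (φ.rename fun n => n.casesOn 1 fun n => n.casesOn 0 fun n => n + 3)
  have hψ : ∀ w' (h : w ≤ w') (x s : M.Q w'),
      M.sat ψ (scons x (scons s fun n => M.up h (ρ n))) ↔ Compr s fun _ h' z =>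
        M.sat φ (scons (M.up h' x) (scons z fun n => M.up (h.trans h') (ρ n))) := by
    intro w' h x s
    simp only [ψ, sat_allIff, sat_rename]
    refine forall₂_congr fun w'' h' => forall_congr' fun z => iff_congr Iff.rfl ?_
    refine iff_of_eq (congrArg _ ?_)
    funext n
    rcases n with _ | _ | n <;> simp
  -- The second half of strong collection is essential: every member of `b` comes from some `x ∈ a`,
  -- so the union of `b` is not too large.
  obtain ⟨b, hb₁, hb₂⟩ := strong_collection ψ ρ a fun w' h x hx => by
    obtain ⟨s, hs⟩ := H w' h x hx
    exact ⟨s, (hψ w' h x s).2 hs⟩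
  refine ⟨sUnion b, fun w' h z => ?_⟩
  rw [mem_sUnion']
  constructor
  · rintro ⟨s, hs, hz⟩
    obtain ⟨x, hx, hxs⟩ := hb₂ w' h s hs
    refine ⟨x, hx, ?_⟩
    simpa using (mem_of_compr ((hψ w' h x s).1 hxs) z).1 hz
  · rintro ⟨x, hx, hxz⟩
    obtain ⟨s, hs, hxs⟩ := hb₁ w' h x hx
    exact ⟨s, hs, (mem_of_compr ((hψ w' h x s).1 hxs) z).2 (by simpa using hxz)⟩

/-- The replacement axiom. -/
theorem exists_image (φ : Fm) (ρ : ℕ → M.Q w) (a : M.Q w)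
    (H : ∀ w' (h : w ≤ w') (x : M.Q w'), x ∈ M.up h a → ∃ y : M.Q w', ∀ w'' (h' : w' ≤ w'')
      (z : M.Q w''), M.sat φ (scons (M.up h' x) (scons z fun n => M.up (h.trans h') (ρ n))) ↔
        z = M.up h' y) :
    ∃ c : M.Q w, Compr c fun _ h z => ∃ x ∈ M.up h a,
      M.sat φ (scons x (scons z fun n => M.up h (ρ n))) :=
  exists_iUnion φ ρ a fun w' h x hx => by
    obtain ⟨y, hy⟩ := H w' h x hx
    exact ⟨upair y y, fun w'' h' z => by simp [hy w'' h' z]⟩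

theorem exists_prod (X Y : M.Q w) :
    ∃ c : M.Q w, Compr c fun _ h z => ∃ x ∈ M.up h X, ∃ y ∈ M.up h Y, z = pair x y := by
  obtain ⟨c, hc⟩ := exists_iUnion (bex 2 (isPair 2 1 0)) (fun _ => Y) X fun w' h x _ => by
    obtain ⟨s, hs⟩ := exists_image (isPair 1 2 0) (fun _ => x) (M.up h Y)
      fun w'' h' y _ => ⟨pair (M.up h' x) y, fun w₃ h'' z => by simp⟩
    exact ⟨s, fun w'' h' z => (hs w'' h' z).trans (by simp)⟩
  exact ⟨c, fun w' h z => (hc w' h z).trans (by simp)⟩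

/-- The cartesian product. -/
noncomputable def prod (X Y : M.Q w) : M.Q w := (exists_prod X Y).choose

theorem mem_prod' {X Y : M.Q w} (h : w ≤ w') (z : M.Q w') :
    z ∈ M.up h (prod X Y) ↔ ∃ x ∈ M.up h X, ∃ y ∈ M.up h Y, z = pair x y :=
  (exists_prod X Y).choose_spec _ h z

theorem mem_prod {X Y z : M.Q w} : z ∈ prod X Y ↔ ∃ x ∈ X, ∃ y ∈ Y, z = pair x y := by
  simpa using mem_prod' (X := X) (Y := Y) le_rfl z

@[simp] theorem pair_mem_prod {X Y x y : M.Q w} : pair x y ∈ prod X Y ↔ x ∈ X ∧ y ∈ Y := by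
  rw [mem_prod]
  constructor
  · rintro ⟨x', hx, y', hy, e⟩
    obtain ⟨rfl, rfl⟩ := pair_inj.1 e
    exact ⟨hx, hy⟩
  · rintro ⟨hx, hy⟩
    exact ⟨x, hx, y, hy, rfl⟩

@[simp] theorem up_prod (h : w ≤ w') (X Y : M.Q w) :
    M.up h (prod X Y) = prod (M.up h X) (M.up h Y) :=
  ext fun w'' h' z => by simp [mem_prod']

/-- There is a set that contains the empty set and is closed under successors. -/
theorem exists_inductive (w : M.W) : ∃ a : M.Q w, empty ∈ a ∧
    ∀ w' (h : w ≤ w') (x : M.Q w'), x ∈ M.up h a → union x (upair x x) ∈ M.up h a := by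
  obtain ⟨x₀⟩ := M.nonempty w
  obtain ⟨a, ⟨h₁, h₂⟩, -⟩ := IsCZF.sat_axiom _ .infinity w fun _ => x₀
  obtain ⟨z, hz, hz'⟩ := h₁
  have h₂' := (sat_ball 0 (bex 1 (allIff (.mem 0 1) (.or (.mem 0 2) (.eq 0 2)))) _).1 h₂
  refine ⟨a, ?_, fun w' h x hx => ?_⟩
  · have : z = empty := eq_empty fun w' h u hu => by
      have := hz' w' h u w' le_rfl
      exact this (show M.up le_rfl u ∈ M.up le_rfl (M.up h z) by simpa using hu)
    exact this ▸ hz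
  · obtain ⟨y, hy, hxy⟩ := h₂' w' h x hx
    rw [sat_allIff] at hxy
    have : y = union x (upair x x) := ext fun w'' h' z => by simpa using hxy w'' h' z
    exact this ▸ hy

end KModel

end CZFLogic

namespace CZFLogic
open Fm

namespace KModel

variable {M : KModel} [IsCZF M] {w w' : M.W}

/-! ## The set of lists over a set

Lists are iterated pairs: the empty list is the empty set, and `σ` followed by `b` is `(σ, b)`. -/

/-- The set `c` of pairs witnesses that `σ` is a list over `B` of rank at most `x`. -/
def ListRank (B σ x : M.Q w) : Prop :=
  ∃ c : M.Q w, pair σ x ∈ c ∧ ∀ w' (h : w ≤ w') (p : M.Q w'), p ∈ M.up h c →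
    ∃ τ y, p = pair τ y ∧ (τ = empty ∨ ∃ τ' y' b, pair τ' y' ∈ M.up h c ∧ y' ∈ y ∧
      b ∈ M.up h B ∧ τ = pair τ' b)

end KModel

namespace Fm

/-- The formula for `ListRank`; the value of `e` is the empty set. -/
def listRank (B σ x e : ℕ) : Fm :=
  ex (and (pairMem (σ + 1) (x + 1) 0) (ball 0 (ex (ex (and (isPair 2 1 0) (or (eq 1 (e + 4))
    (ex (ex (ex (and (pairMem 2 1 6) (and (mem 1 3) (and (mem 0 (B + 7)) (isPair 4 2 0)))))))))))))

end Fm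

namespace KModel

variable {M : KModel} [IsCZF M] {w w' : M.W}

theorem sat_listRank (B σ x e : ℕ) (ρ : ℕ → M.Q w) (he : ρ e = empty) :
    M.sat (listRank B σ x e) ρ ↔ ListRank (ρ B) (ρ σ) (ρ x) := by
  simp [listRank, ListRank, he]

/-- One unfolding of the recursion: a witness for a list also serves its initial part, and adding
one pair to a witness for the initial part gives one for the whole list. -/
theorem listRank_iff {B σ x : M.Q w} : ListRank B σ x ↔
    σ = empty ∨ ∃ y ∈ x, ∃ τ, ∃ b ∈ B, ListRank B τ y ∧ σ = pair τ b := by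
  constructor
  · rintro ⟨c, hσ, hc⟩
    obtain ⟨τ, y, e, h⟩ := hc w le_rfl (pair σ x) (by simpa using hσ)
    obtain ⟨rfl, rfl⟩ := pair_inj.1 e
    refine h.imp_right ?_
    rintro ⟨τ', y', b, hm, hy, hb, rfl⟩
    exact ⟨y', hy, τ', b, by simpa using hb, ⟨c, by simpa using hm, hc⟩, rfl⟩
  · rintro (rfl | ⟨y, hy, τ, b, hb, ⟨c, hτ, hc⟩, rfl⟩)
    · refine ⟨upair (pair empty x) (pair empty x), by simp, fun w' h p hp => ?_⟩
      refine ⟨empty, M.up h x, by simpa using hp, Or.inl rfl⟩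
    · refine ⟨union c (upair (pair (pair τ b) x) (pair (pair τ b) x)), by simp, fun w' h p hp => ?_⟩
      rw [up_union, mem_union] at hp
      rcases hp with hp | hp
      · obtain ⟨τ', y', e, h'⟩ := hc w' h p hp
        refine ⟨τ', y', e, h'.imp_right ?_⟩
        rintro ⟨τ'', y'', b', h₁, h₂⟩
        exact ⟨τ'', y'', b', by simp [h₁], h₂⟩
      · refine ⟨M.up h (pair τ b), M.up h x, by simpa using hp, Or.inr ?_⟩
        refine ⟨M.up h τ, M.up h y, M.up h b, ?_, up_mem h hy, up_mem h hb, by simp⟩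
        have := up_mem h hτ
        simp only [up_pair] at this
        simp [this]

/-- Set induction on `x`: by `listRank_iff` the lists of rank at most `x` are the empty list and the
members of `s_y × B` for `y ∈ x`, where `s_y` is the set obtained for `y`. Ranks are arbitrary sets
ordered by membership, so no arithmetic of natural numbers is needed. -/
theorem exists_listRank_set (B x : M.Q w) :
    ∃ s : M.Q w, Compr s fun _ h σ => ListRank (M.up h B) σ (M.up h x) := by
  have key : ∀ {w : M.W} (B x : M.Q w),
      M.sat (ex (allIff (.mem 0 1) (listRank 3 0 2 4))) (scons x (scons B fun _ => empty)) ↔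
        ∃ s : M.Q w, Compr s fun _ h σ => ListRank (M.up h B) σ (M.up h x) := by
    intro w B x
    simp only [sat_ex, sat_allIff]
    refine exists_congr fun s => forall₂_congr fun w' h => forall_congr' fun z => ?_
    rw [sat_listRank _ _ _ _ _ (by simp)]
    simp
  have hρ : ∀ {w' : M.W} (h : w ≤ w'), (fun n => M.up h (scons B (fun _ => empty) n)) =
      scons (M.up h B) fun _ => empty := fun h => by simp [up_scons]
  rw [← key]
  refine set_induction _ _ (fun w' h x ih => ?_) x
  rw [hρ, key]
  obtain ⟨c, hc⟩ := exists_iUnion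
    (ex (bex 3 (and (listRank 4 1 2 5) (isPair 3 1 0)))) (scons (M.up h B) fun _ => empty) x
    fun w₁ h₁ y hy => by
      have := ih w₁ h₁ y hy
      rw [hρ, key] at this
      obtain ⟨s, hs⟩ := this
      refine ⟨prod s (M.up (h.trans h₁) B), fun w₂ h₂ z => ?_⟩
      rw [up_prod, mem_prod]
      simp only [sat_ex, sat_bex, sat_and, sat_isPair]
      refine ⟨?_, ?_⟩
      · rintro ⟨τ, hτ, b, hb, rfl⟩
        refine ⟨τ, b, by simpa using hb, ?_, by simp⟩
        rw [sat_listRank _ _ _ _ _ (by simp)]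
        simpa using (hs w₂ h₂ τ).1 hτ
      · rintro ⟨τ, b, hb, hτ, hz⟩
        rw [sat_listRank _ _ _ _ _ (by simp)] at hτ
        exact ⟨τ, (hs w₂ h₂ τ).2 (by simpa using hτ), b, by simpa using hb, hz⟩
  refine ⟨union (upair empty empty) c, fun w₁ h₁ σ => ?_⟩
  beta_reduce
  rw [listRank_iff, up_union, mem_union, hc]
  refine or_congr (by simp) ?_
  simp only [sat_ex, sat_bex, sat_and, sat_isPair]
  refine exists_congr fun y => and_congr Iff.rfl (exists_congr fun τ => exists_congr fun b => ?_)
  rw [sat_listRank _ _ _ _ _ (by simp)]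
  simp

/-- Set induction on the rank. As that scheme covers all formulas, `φ` need not be bounded. -/
theorem listRank_induction (φ : Fm) (ρ : ℕ → M.Q w) (B : M.Q w) (hnil : M.sat φ (scons empty ρ))
    (hsnoc : ∀ w' (h : w ≤ w') (σ b : M.Q w'), b ∈ M.up h B →
      M.sat φ (scons σ fun n => M.up h (ρ n)) → M.sat φ (scons (pair σ b) fun n => M.up h (ρ n)))
    (x σ : M.Q w) (hσ : ListRank B σ x) : M.sat φ (scons σ ρ) := by
  have key : ∀ {w : M.W} (B x : M.Q w) (ρ : ℕ → M.Q w),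
      M.sat (allImp (listRank 2 0 1 3) (φ.rename fun n => n.casesOn 0 fun n => n + 4))
        (scons x (scons B (scons empty ρ))) ↔
        ∀ w' (h : w ≤ w') (σ : M.Q w'), ListRank (M.up h B) σ (M.up h x) →
          M.sat φ (scons σ fun n => M.up h (ρ n)) := by
    intro w B x ρ
    rw [sat_allImp]
    refine forall₂_congr fun w' h => forall_congr' fun σ => ?_
    rw [sat_listRank _ _ _ _ _ (by simp), sat_rename]
    refine imp_congr (by simp) (iff_of_eq (congrArg _ ?_))
    funext n
    rcases n with _ | n <;> simp
  have hρ : ∀ {w' : M.W} (h : w ≤ w'), (fun n => M.up h (scons B (scons empty ρ) n)) =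
      scons (M.up h B) (scons empty fun n => M.up h (ρ n)) := fun h => by simp [up_scons]
  have := set_induction
    (allImp (listRank 2 0 1 3) (φ.rename fun n => n.casesOn 0 fun n => n + 4))
    (scons B (scons empty ρ)) (fun w' h x ih => ?_) x
  · rw [key] at this
    simpa using this w le_rfl σ (by simpa using hσ)
  rw [hρ, key]
  intro w₁ h₁ σ hσ
  rw [listRank_iff] at hσ
  simp only [up_up] at hσ ⊢
  rcases hσ with rfl | ⟨y, hy, τ, b, hb, hτ, rfl⟩
  · simpa only [up_scons, up_empty] using sat_up φ (h.trans h₁) hnil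
  · have := ih w₁ h₁ y hy
    rw [hρ, key] at this
    exact hsnoc w₁ _ τ b hb (by simpa using this w₁ le_rfl τ (by simpa using hτ))

/-- `L` is the set of lists over `B`. -/
structure IsListSet (B L : M.Q w) : Prop where
  nil_mem : empty ∈ L
  snoc_mem' : ∀ w' (h : w ≤ w') (σ b : M.Q w'), σ ∈ M.up h L → b ∈ M.up h B →
    pair σ b ∈ M.up h L
  induction' : ∀ w' (h : w ≤ w') (φ : Fm) (ρ : ℕ → M.Q w'), M.sat φ (scons empty ρ) →
    (∀ w'' (h' : w' ≤ w'') (σ b : M.Q w''), σ ∈ M.up (h.trans h') L → b ∈ M.up (h.trans h') B →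
      M.sat φ (scons σ fun n => M.up h' (ρ n)) →
      M.sat φ (scons (pair σ b) fun n => M.up h' (ρ n))) →
    ∀ σ ∈ M.up h L, M.sat φ (scons σ ρ)

theorem IsListSet.up {B L : M.Q w} (H : IsListSet B L) (h : w ≤ w') :
    IsListSet (M.up h B) (M.up h L) where
  nil_mem := by simpa using up_mem h H.nil_mem
  snoc_mem' := by simpa using fun w'' (h' : w' ≤ w'') => H.snoc_mem' w'' (h.trans h')
  induction' := by simpa using fun w'' (h' : w' ≤ w'') => H.induction' w'' (h.trans h')

theorem IsListSet.induction {B L : M.Q w} (H : IsListSet B L) (φ : Fm) (ρ : ℕ → M.Q w)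
    (hnil : M.sat φ (scons empty ρ))
    (hsnoc : ∀ w' (h : w ≤ w') (σ b : M.Q w'), σ ∈ M.up h L → b ∈ M.up h B →
      M.sat φ (scons σ fun n => M.up h (ρ n)) →
      M.sat φ (scons (pair σ b) fun n => M.up h (ρ n))) :
    ∀ σ ∈ L, M.sat φ (scons σ ρ) := by
  simpa using H.induction' w le_rfl φ ρ hnil hsnoc

/-- Ranks in an inductive set suffice: appending an element raises the rank `x` to `x ∪ {x}`. -/
theorem exists_isListSet (B : M.Q w) : ∃ L : M.Q w, IsListSet B L := by
  obtain ⟨a, ha, hs⟩ := exists_inductive w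
  obtain ⟨L, hL'⟩ := exists_iUnion (listRank 2 1 0 3) (scons B fun _ => empty) a fun w' h x _ => by
    obtain ⟨s, hs⟩ := exists_listRank_set (M.up h B) x
    refine ⟨s, fun w'' h' z => (hs w'' h' z).trans ?_⟩
    beta_reduce
    rw [sat_listRank _ _ _ _ _ (by simp)]
    simp
  have hL : ∀ w' (h : w ≤ w') (z : M.Q w'), z ∈ M.up h L ↔ ∃ x ∈ M.up h a,
      ListRank (M.up h B) z x := by
    intro w' h z
    rw [hL']
    refine exists_congr fun x => and_congr Iff.rfl ?_
    rw [sat_listRank _ _ _ _ _ (by simp)]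
    simp
  have hnil : empty ∈ L := by
    simpa using (hL w le_rfl empty).2 ⟨empty, by simpa using ha, listRank_iff.2 (Or.inl rfl)⟩
  have hsnoc : ∀ w' (h : w ≤ w') (σ b : M.Q w'), σ ∈ M.up h L → b ∈ M.up h B →
      pair σ b ∈ M.up h L := by
    intro w' h σ b hσ hb
    obtain ⟨x, hx, hσ⟩ := (hL w' h σ).1 hσ
    exact (hL w' h _).2 ⟨_, hs w' h x hx, listRank_iff.2
      (Or.inr ⟨x, by simp, σ, b, hb, hσ, rfl⟩)⟩
  refine ⟨L, hnil, hsnoc, fun w' h φ ρ hφ₀ hφ₁ σ hσ => ?_⟩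
  obtain ⟨x, hx, hσ⟩ := (hL w' h σ).1 hσ
  -- Membership in `L` is carried along in the induction, because the inductive step for `φ`
  -- presupposes it.
  have hρ : ∀ {w'' : M.W} (h' : w' ≤ w'') (σ : M.Q w''),
      M.sat (and (.mem 0 1) (φ.rename fun n => n.casesOn 0 fun n => n + 2))
        (scons σ fun n => M.up h' (scons (M.up h L) ρ n)) ↔
      σ ∈ M.up (h.trans h') L ∧ M.sat φ (scons σ fun n => M.up h' (ρ n)) := by
    intro w'' h' σ
    rw [sat_and, sat_rename]
    refine and_congr (by simp) (iff_of_eq (congrArg _ ?_))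
    funext n
    rcases n with _ | n <;> simp
  have := listRank_induction (and (.mem 0 1) (φ.rename fun n => n.casesOn 0 fun n => n + 2))
    (scons (M.up h L) ρ) (M.up h B) ?_ ?_ x σ hσ
  · simpa using ((hρ le_rfl σ).1 (by simpa using this)).2
  · have := (hρ le_rfl empty).2 ⟨by simpa using up_mem h hnil, by simpa using hφ₀⟩
    simpa using this
  · intro w'' h' τ b hb hτ
    rw [hρ] at hτ ⊢
    rw [up_up] at hb
    exact ⟨hsnoc _ _ _ _ hτ.1 hb, hφ₁ w'' h' τ b hτ.1 hb hτ.2⟩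

end KModel

end CZFLogic

namespace CZFLogic
open Fm

namespace KModel

variable {M : KModel} {w w' : M.W}

/-! ## Consequences of elementary NID -/

/-- `x ⊆ y` -/
def Subset (x y : M.Q w) : Prop := ∀ w' (h : w ≤ w') (z : M.Q w'), z ∈ M.up h x → z ∈ M.up h y

theorem Subset.up {x y : M.Q w} (H : Subset x y) (h : w ≤ w') : Subset (M.up h x) (M.up h y) := by
  intro w'' h' z
  simpa using H w'' (h.trans h') z

theorem Subset.mem {x y z : M.Q w} (H : Subset x y) (hz : z ∈ x) : z ∈ y := by
  simpa using H w le_rfl z (by simpa using hz)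

theorem Subset.antisymm [IsCZF M] {x y : M.Q w} (h : Subset x y) (h' : Subset y x) : x = y :=
  ext fun w' hw z => ⟨h w' hw z, h' w' hw z⟩

variable [IsCZF M]

/-- `R` is a set of elementary rules on `X`. -/
def IsRuleSet (R X : M.Q w) : Prop :=
  ∀ w' (h : w ≤ w') (r : M.Q w'), r ∈ M.up h R → ∃ a b, r = pair a b ∧
    Subset a (M.up h X) ∧ Subset b (M.up h X) ∧ ∃ x, a = upair x x

/-- `Y` is an `R`-closed subset of `X`. -/
def IsClosedUnder (R X Y : M.Q w) : Prop :=
  Subset Y X ∧ ∀ w' (h : w ≤ w') (a b : M.Q w'), pair a b ∈ M.up h R →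
    Subset a (M.up h Y) → ∃ x ∈ b, x ∈ M.up h Y

/-- `G` generates the class of `R`-closed subsets of `X`. -/
def Generates (R X G : M.Q w) : Prop :=
  (∀ w' (h : w ≤ w') (β : M.Q w'), β ∈ M.up h G → IsClosedUnder (M.up h R) (M.up h X) β) ∧
  ∀ w' (h : w ≤ w') (α : M.Q w'), IsClosedUnder (M.up h R) (M.up h X) α →
    ∀ a ∈ α, ∃ β ∈ M.up h G, a ∈ β ∧ Subset β α

/-- Elementary NID holds from the world `w` on. -/
def NID (w : M.W) : Prop :=
  ∀ w' (_ : w ≤ w') (X R : M.Q w'), IsRuleSet R X → ∃ G, Generates R X G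

theorem NID.up (H : M.NID w) (h : w ≤ w') : M.NID w' := fun w'' h' => H w'' (h.trans h')

theorem exists_generates (H : M.NID w) {X R : M.Q w} (h : IsRuleSet R X) : ∃ G, Generates R X G :=
  H w le_rfl X R h

/-- The rules `({z}, {z'})` for `(z, z') ∈ E`. -/
theorem exists_rules {E Z : M.Q w} (hE : Subset E (prod Z Z)) : ∃ R : M.Q w, Compr R fun _ h r =>
    ∃ z z', pair z z' ∈ M.up h E ∧ r = pair (upair z z) (upair z' z') := by
  obtain ⟨R, hR⟩ := exists_image (ex (ex (ex (ex (and (isPair 4 3 2) (and (isSing 1 3)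
    (and (isSing 0 2) (isPair 5 1 0)))))))) (fun _ => E) E fun w' h p hp => by
      have := hE w' h p hp
      rw [up_prod, mem_prod] at this
      obtain ⟨z, -, z', -, rfl⟩ := this
      refine ⟨pair (upair z z) (upair z' z'), fun w'' h' r => ?_⟩
      simp only [sat_ex, sat_and, sat_isPair, sat_isSing, scons_zero, scons_succ, up_pair, pair_inj,
        up_upair]
      constructor
      · rintro ⟨y, y', s, s', ⟨rfl, rfl⟩, rfl, rfl, rfl⟩
        rfl
      · rintro rfl
        exact ⟨_, _, _, _, ⟨rfl, rfl⟩, rfl, rfl, rfl⟩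
  refine ⟨R, fun w' h r => ?_⟩
  rw [hR w' h]
  simp only [sat_ex, sat_and, sat_isPair, sat_isSing, scons_zero, scons_succ]
  constructor
  · rintro ⟨_, hp, z, z', s, s', rfl, rfl, rfl, rfl⟩
    exact ⟨z, z', hp, rfl⟩
  · rintro ⟨z, z', hp, rfl⟩
    exact ⟨_, hp, z, z', _, _, rfl, rfl, rfl, rfl⟩

theorem subset_upair {x z : M.Q w} (h : z ∈ x) : Subset (upair z z) x := by
  intro w' hw u hu
  have : u = M.up hw z := by simpa using hu
  exact this ▸ up_mem hw h

/-- A set has a closure under a relation. -/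
theorem exists_closure (H : M.NID w) {Z I E : M.Q w} (hI : Subset I Z)
    (hE : Subset E (prod Z Z)) : ∃ R : M.Q w, Subset R Z ∧
      Compr R fun _ h z => z ∈ M.up h I ∨ ∃ z' ∈ M.up h R, pair z' z ∈ M.up h E := by
  obtain ⟨S, hS⟩ := exists_rules hE
  have hS' : IsRuleSet S Z := by
    intro w' h r hr
    obtain ⟨z, z', hz, rfl⟩ := (hS w' h r).1 hr
    have := hE w' h _ hz
    rw [up_prod, pair_mem_prod] at this
    exact ⟨_, _, rfl, subset_upair this.1, subset_upair this.2, _, rfl⟩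
  -- As premises and conclusions are singletons, closure under the rules is closure under the
  -- relation `E`.
  have hcl : ∀ w' (h : w ≤ w') (Y : M.Q w'), IsClosedUnder (M.up h S) (M.up h Z) Y ↔
      Subset Y (M.up h Z) ∧ ∀ w'' (h' : w' ≤ w'') (z z' : M.Q w''),
        pair z z' ∈ M.up (h.trans h') E → z ∈ M.up h' Y → z' ∈ M.up h' Y := by
    intro w' h Y
    refine and_congr Iff.rfl ⟨fun hY w'' h' z z' hz hzY => ?_, fun hY w'' h' a b hab haY => ?_⟩
    · obtain ⟨u, hu, hu'⟩ := hY w'' h' (upair z z) (upair z' z')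
        (by rw [up_up]; exact (hS _ _ _).2 ⟨z, z', hz, rfl⟩) (subset_upair hzY)
      rw [mem_upair, or_self] at hu
      exact hu ▸ hu'
    · rw [up_up] at hab
      obtain ⟨z, z', hz, e⟩ := (hS _ _ _).1 hab
      obtain ⟨rfl, rfl⟩ := pair_inj.1 e
      exact ⟨z', by simp, hY w'' h' z z' hz (haY.mem (by simp))⟩
  obtain ⟨G, hG, hG'⟩ := exists_generates H hS'
  -- `R` consists of the `z` for which some `z₀ ∈ I` has the property that every generator
  -- containing `z₀` contains `z`. Quantifying over the set `G` instead of over all closed sets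
  -- keeps the formula bounded.
  obtain ⟨R, hR⟩ := exists_sep (bex 1 (ball 3 (imp (.mem 1 0) (.mem 2 0))))
    (by repeat constructor) (scons I (fun _ => G)) Z
  have hR' : ∀ w' (h : w ≤ w') (z : M.Q w'), z ∈ M.up h R ↔ z ∈ M.up h Z ∧ ∃ z₀ ∈ M.up h I,
      ∀ w'' (h' : w' ≤ w'') (β : M.Q w''), β ∈ M.up (h.trans h') G →
        ∀ w₃ (h₃ : w'' ≤ w₃), M.up (h'.trans h₃) z₀ ∈ M.up h₃ β →
          M.up (h'.trans h₃) z ∈ M.up h₃ β := by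
    intro w' h z
    rw [hR w' h z]
    simp
  clear hR
  have hRZ : Subset R Z := fun w' h z hz => ((hR' w' h z).1 hz).1
  have hIR : Subset I R := fun w' h z hz =>
    (hR' w' h z).2 ⟨hI w' h z hz, z, hz, fun _ _ _ _ _ _ h => h⟩
  have hcR : ∀ w' (h : w ≤ w') (z z' : M.Q w'), z ∈ M.up h R → pair z z' ∈ M.up h E →
      z' ∈ M.up h R := by
    intro w' h z z' hz hzz
    obtain ⟨-, z₀, hz₀, hβ⟩ := (hR' w' h z).1 hz
    have := hE w' h _ hzz
    rw [up_prod, pair_mem_prod] at this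
    refine (hR' w' h z').2 ⟨this.2, z₀, hz₀, fun w'' h' β hβG w₃ h₃ hz₀β => ?_⟩
    have h1 := ((hcl w₃ _ (M.up h₃ β)).1 (hG w₃ (h.trans (h'.trans h₃)) _
      (by simpa using up_mem h₃ hβG))).2 w₃ le_rfl (M.up (h'.trans h₃) z) (M.up (h'.trans h₃) z')
    simp only [up_up] at h1
    refine h1 ?_ (hβ w'' h' β hβG w₃ h₃ hz₀β)
    simpa using up_mem (h'.trans h₃) hzz
  -- `Y` is the part of `R` on which the desired equation holds. It is closed and contains `I`;
  -- hence some generator `β` lies between `z₀` and `Y`, and the definition of `R` puts `z` into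
  -- `β`.
  obtain ⟨Y, hY⟩ := exists_sep (or (.mem 0 1) (bex 2 (pairMem 0 1 4)))
    (.or (.mem _ _) (.bex _ (isBounded_pairMem _ _ _))) (scons I (scons R fun _ => E)) R
  have hY' : ∀ w' (h : w ≤ w') (z : M.Q w'), z ∈ M.up h Y ↔ z ∈ M.up h R ∧
      (z ∈ M.up h I ∨ ∃ z' ∈ M.up h R, pair z' z ∈ M.up h E) := by
    intro w' h z
    rw [hY w' h z]
    simp
  clear hY
  have hYcl : IsClosedUnder S Z Y := by
    simpa using (hcl w le_rfl Y).2 ⟨fun w' h z hz => by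
      simpa using hRZ w' h z ((hY' w' h z).1 hz).1, fun w'' h' z z' hzz hz =>
        have hzR := ((hY' _ _ _).1 hz).1
        (hY' _ _ _).2 ⟨hcR _ _ z z' hzR hzz, Or.inr ⟨z, hzR, hzz⟩⟩⟩
  refine ⟨R, hRZ, fun w' h z => ⟨fun hz => ?_, ?_⟩⟩
  · obtain ⟨-, z₀, hz₀, hβ⟩ := (hR' w' h z).1 hz
    have hYcl' : IsClosedUnder (M.up h S) (M.up h Z) (M.up h Y) := by
      rw [hcl]
      have := (hcl w le_rfl Y).1 (by simpa using hYcl)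
      refine ⟨by simpa using this.1.up h, fun w'' h' => ?_⟩
      simpa using this.2 w'' (h.trans h')
    obtain ⟨β, hβG, hz₀β, hβY⟩ := hG' w' h _ hYcl' z₀
      ((hY' w' h z₀).2 ⟨hIR w' h _ hz₀, Or.inl hz₀⟩)
    have := hβ w' le_rfl β hβG w' le_rfl (by simpa using hz₀β)
    simp only [up_refl] at this
    exact ((hY' w' h z).1 (hβY.mem this)).2
  · rintro (hz | ⟨z', hz', hzz⟩)
    · exact hIR w' h z hz
    · exact hcR w' h z' z hz' hzz

/-! ## Runs of transition systems -/

/-- `R` consists of the `(p, (σ, y))` such that, for the transitions `S ⊆ (X × B) × X`, there is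
a path with labels `σ` to `y` from some `y₀` with `(p, y₀) ∈ I`. -/
structure IsRuns (L X P I S R : M.Q w) : Prop where
  subset : Subset R (prod P (prod L X))
  nil' : ∀ w' (h : w ≤ w') (p y : M.Q w'),
    pair p (pair empty y) ∈ M.up h R ↔ pair p y ∈ M.up h I
  snoc' : ∀ w' (h : w ≤ w') (p σ b y' : M.Q w'), pair p (pair (pair σ b) y') ∈ M.up h R ↔
    ∃ y, pair p (pair σ y) ∈ M.up h R ∧ pair (pair y b) y' ∈ M.up h S

theorem pair_ne_empty {x y : M.Q w} : pair x y ≠ empty := fun h =>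
  not_mem_empty (x := upair x x) (h ▸ by simp [pair])

/-- The triples are the closure of the initial ones under appending a transition. Initial triples
carry the empty list and all later ones a pair, so the single equation of `exists_closure` splits
into the two clauses for runs. -/
theorem exists_isRuns (H : M.NID w) {B L : M.Q w} (hL : IsListSet B L) {X P I S : M.Q w}
    (hI : Subset I (prod P X)) (hS : Subset S (prod (prod X B) X)) :
    ∃ R, IsRuns L X P I S R := by
  obtain ⟨J, hJ⟩ := exists_sep (bex 1 (bex 3 (bex 5 (and (isPair 3 2 0) (and (isPair 0 8 1)
      (pairMem 2 1 7))))))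
    (.bex _ (.bex _ (.bex _ (.and (isBounded_isPair _ _ _) (.and (isBounded_isPair _ _ _)
      (isBounded_pairMem _ _ _))))))
    (scons P (scons X (scons (prod L X) (scons I fun _ => empty)))) (prod P (prod L X))
  have hJ' : ∀ w' (h : w ≤ w') (z : M.Q w'), z ∈ M.up h J ↔
      ∃ p y, pair p y ∈ M.up h I ∧ z = pair p (pair empty y) := by
    intro w' h z
    rw [hJ w' h z]
    simp only [sat_bex, sat_and, sat_isPair, sat_pairMem, scons_zero, scons_succ, up_prod, up_empty]
    constructor
    · rintro ⟨-, p, hp, y, hy, _, -, rfl, rfl, hpy⟩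
      exact ⟨p, y, hpy, rfl⟩
    · rintro ⟨p, y, hpy, rfl⟩
      have h1 := hI w' h _ hpy
      rw [up_prod, pair_mem_prod] at h1
      have h2 : empty ∈ M.up h L := by simpa using up_mem h hL.nil_mem
      have h3 : pair empty y ∈ prod (M.up h L) (M.up h X) := by simp [h1, h2]
      exact ⟨by simp [h1, h2], p, h1.1, y, h1.2, _, h3, rfl, rfl, hpy⟩
  clear hJ
  -- The eleven bounded quantifiers name the two triples and all of their parts, so that only
  -- bounded separation is needed.
  obtain ⟨E, hE⟩ := exists_sep
    (bex 1 (bex 2 (bex 4 (bex 6 (bex 7 (bex 9 (bex 10 (bex 12 (bex 13 (bex 15 (bex 17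
      (and (isPair 11 10 9) (and (isPair 10 8 7) (and (isPair 7 5 3) (and (isPair 9 8 6)
      (and (isPair 6 4 2) (and (isPair 4 5 1) (and (isPair 0 3 1) (pairMem 0 2 19)))))))))))))))))))
    (by repeat constructor)
    (scons (prod P (prod L X)) (scons P (scons (prod L X) (scons L (scons X (scons B
      (scons (prod X B) fun _ => S)))))))
    (prod (prod P (prod L X)) (prod P (prod L X)))
  have hE' : ∀ w' (h : w ≤ w') (z : M.Q w'), z ∈ M.up h E ↔ ∃ p σ y b y',
      (p ∈ M.up h P ∧ σ ∈ M.up h L ∧ pair (pair y b) y' ∈ M.up h S) ∧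
      z = pair (pair p (pair σ y)) (pair p (pair (pair σ b) y')) := by
    intro w' h z
    rw [hE w' h z]
    simp only [sat_bex, sat_and, sat_isPair, sat_pairMem, scons_zero, scons_succ, up_prod]
    constructor
    · rintro ⟨-, t, -, t', -, p, hp, q, -, q', -, σ, hσ, τ, -, y, -, y', -, b, -, k, -,
        rfl, rfl, rfl, rfl, rfl, rfl, rfl, hS⟩
      exact ⟨p, σ, y, b, y', ⟨hp, hσ, hS⟩, rfl⟩
    · rintro ⟨p, σ, y, b, y', ⟨hp, hσ, hyS⟩, rfl⟩
      have h1 := hS w' h _ hyS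
      simp only [up_prod, pair_mem_prod] at h1
      obtain ⟨⟨hy, hb⟩, hy'⟩ := h1
      have hτ := hL.snoc_mem' w' h σ b hσ hb
      have hq : pair σ y ∈ prod (M.up h L) (M.up h X) := pair_mem_prod.2 ⟨hσ, hy⟩
      have hq' : pair (pair σ b) y' ∈ prod (M.up h L) (M.up h X) := pair_mem_prod.2 ⟨hτ, hy'⟩
      have ht := pair_mem_prod.2 ⟨hp, hq⟩
      have ht' := pair_mem_prod.2 ⟨hp, hq'⟩
      exact ⟨pair_mem_prod.2 ⟨ht, ht'⟩, _, ht, _, ht', p, hp, _, hq, _, hq', σ, hσ, _, hτ, y, hy,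
        y', hy', b, hb, _, pair_mem_prod.2 ⟨hy, hb⟩, rfl, rfl, rfl, rfl, rfl, rfl, rfl, hyS⟩
  clear hE
  have hJZ : Subset J (prod P (prod L X)) := by
    intro w' h z hz
    obtain ⟨p, y, hpy, rfl⟩ := (hJ' w' h z).1 hz
    have h1 := hI w' h _ hpy
    simp only [up_prod, pair_mem_prod] at h1 ⊢
    exact ⟨h1.1, by simpa using up_mem h hL.nil_mem, h1.2⟩
  have hEZ : Subset E (prod (prod P (prod L X)) (prod P (prod L X))) := by
    intro w' h z hz
    obtain ⟨p, σ, y, b, y', ⟨hp, hσ, hyS⟩, rfl⟩ := (hE' w' h z).1 hz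
    have h1 := hS w' h _ hyS
    simp only [up_prod, pair_mem_prod] at h1 ⊢
    exact ⟨⟨hp, hσ, h1.1.1⟩, hp, hL.snoc_mem' w' h σ b hσ h1.1.2, h1.2⟩
  obtain ⟨R, hRZ, hR⟩ := exists_closure H hJZ hEZ
  refine ⟨R, hRZ, fun w' h p y => ?_, fun w' h p σ b y' => ?_⟩
  · rw [hR w' h]
    constructor
    · rintro (hz | ⟨z', -, hz⟩)
      · obtain ⟨p', y', hpy, e⟩ := (hJ' w' h _).1 hz
        simp only [pair_inj, true_and] at e
        obtain ⟨rfl, rfl⟩ := e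
        exact hpy
      · obtain ⟨p', σ, y, b, y', -, e⟩ := (hE' w' h _).1 hz
        simp only [pair_inj] at e
        exact (pair_ne_empty e.2.2.1.symm).elim
    · exact fun hz => Or.inl ((hJ' w' h _).2 ⟨p, y, hz, rfl⟩)
  · rw [hR w' h]
    constructor
    · rintro (hz | ⟨z', hz', hz⟩)
      · obtain ⟨p', y', hpy, e⟩ := (hJ' w' h _).1 hz
        simp only [pair_inj] at e
        exact (pair_ne_empty e.2.1).elim
      · obtain ⟨p', σ', y, b', y'', h1, e⟩ := (hE' w' h _).1 hz
        simp only [pair_inj] at e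
        obtain ⟨rfl, rfl, ⟨rfl, rfl⟩, rfl⟩ := e
        exact ⟨y, hz', h1.2.2⟩
    · rintro ⟨y, hy, hyS⟩
      refine Or.inr ⟨_, hy, (hE' w' h _).2 ⟨p, σ, y, b, y', ⟨?_, ?_, hyS⟩, rfl⟩⟩
      · have := hRZ w' h _ hy
        simp only [up_prod, pair_mem_prod] at this
        exact this.1
      · have := hRZ w' h _ hy
        simp only [up_prod, pair_mem_prod] at this
        exact this.2.1

end KModel

end CZFLogic

namespace CZFLogic
open Fm

/-! ### Trees read off from runs and labels -/

namespace Fm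

/-- `(x, (y, z)) ∈ r` -/
def tripleMem (x y z r : ℕ) : Fm :=
  bex r (bex 0 (bex 0 (and (isPair 0 (y + 3) (z + 3)) (isPair 2 (x + 3) 0))))

theorem isBounded_tripleMem (x y z r : ℕ) : (tripleMem x y z r).IsBounded :=
  .bex _ (.bex _ (.bex _ (.and (isBounded_isPair _ _ _) (isBounded_isPair _ _ _))))

/-- `T` consists, as far as pairs are concerned, of the `(σ, a)` such that `(x, (σ, y)) ∈ C` and
`(y, a) ∈ D` for some `y`. -/
def pull (C D x T : ℕ) : Fm :=
  all (allIff (pairMem 1 0 (T + 2)) (ex (and (tripleMem (x + 3) 2 0 (C + 3))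
    (pairMem 0 1 (D + 3)))))

end Fm

namespace KModel

variable {M : KModel} {w w' : M.W} [IsCZF M]

@[simp] theorem sat_tripleMem (x y z r : ℕ) (ρ : ℕ → M.Q w) :
    M.sat (tripleMem x y z r) ρ ↔ pair (ρ x) (pair (ρ y) (ρ z)) ∈ ρ r := by
  simp only [tripleMem, sat_bex, sat_and, sat_isPair, scons_zero, scons_succ]
  constructor
  · rintro ⟨p, hp, u, -, q, -, rfl, rfl⟩
    exact hp
  · intro h
    -- The Kuratowski pair has the member `{x, (y, z)}`, which bounds the quantifier over the inner
    -- pair.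
    exact ⟨_, h, upair (ρ x) (pair (ρ y) (ρ z)), by simp [pair], _, by simp, rfl, rfl⟩

/-- `T` consists, as far as pairs are concerned, of the `(σ, a)` such that `(x, (σ, y)) ∈ C` and
`(y, a) ∈ D` for some `y`. -/
def Pull (C D x T : M.Q w) : Prop :=
  ∀ w' (h : w ≤ w') (σ a : M.Q w'), pair σ a ∈ M.up h T ↔
    ∃ y, pair (M.up h x) (pair σ y) ∈ M.up h C ∧ pair y a ∈ M.up h D

@[simp] theorem sat_pull (C D x T : ℕ) (ρ : ℕ → M.Q w) :
    M.sat (pull C D x T) ρ ↔ Pull (ρ C) (ρ D) (ρ x) (ρ T) := by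
  simp only [pull, sat_all, sat_allIff, sat_pairMem, sat_ex, sat_and, sat_tripleMem, scons_zero,
    scons_succ, up_up]
  constructor
  · intro h w' hw σ a
    simpa using h w' hw σ w' le_rfl a
  · intro h w' hw σ w'' hw' a
    exact h w'' _ _ a

theorem Pull.iff {C D x T : M.Q w} (H : Pull C D x T) {σ a : M.Q w} :
    pair σ a ∈ T ↔ ∃ y, pair x (pair σ y) ∈ C ∧ pair y a ∈ D := by
  simpa using H w le_rfl σ a

theorem Pull.up {C D x T : M.Q w} (H : Pull C D x T) (h : w ≤ w') :
    Pull (M.up h C) (M.up h D) (M.up h x) (M.up h T) := by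
  intro w'' h' σ a
  simpa using H w'' (h.trans h') σ a

theorem subset_of_pairs {T T' L A : M.Q w} (hT : Subset T (prod L A))
    (h : ∀ w' (h : w ≤ w') (σ a : M.Q w'), pair σ a ∈ M.up h T → pair σ a ∈ M.up h T') :
    Subset T T' := by
  intro w' hw z hz
  have := hT w' hw z hz
  rw [up_prod, mem_prod] at this
  obtain ⟨σ, -, a, -, rfl⟩ := this
  exact h w' hw σ a hz

theorem Pull.unique {C D x T T' L A : M.Q w} (hT : Subset T (prod L A)) (hT' : Subset T' (prod L A))
    (H : Pull C D x T) (H' : Pull C D x T') : T = T' :=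
  (subset_of_pairs hT fun w' h σ a => by rw [H w' h, H' w' h]; exact id).antisymm
    (subset_of_pairs hT' fun w' h σ a => by rw [H w' h, H' w' h]; exact id)

/-- This serves twice. If `C` puts elements in front of lists and `D` is a tree, the result is the
subtree at `x`; if `C` consists of the runs of a coalgebra and `D` of its labels, the result is the
tree of the state `x`. -/
theorem exists_pull {L A X C D x : M.Q w}
    (hC : ∀ w' (h : w ≤ w') (σ y : M.Q w'), pair (M.up h x) (pair σ y) ∈ M.up h C →
      σ ∈ M.up h L ∧ y ∈ M.up h X)
    (hD : ∀ w' (h : w ≤ w') (y a : M.Q w'), pair y a ∈ M.up h D → a ∈ M.up h A) :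
    ∃ T, Subset T (prod L A) ∧ Pull C D x T := by
  obtain ⟨T, hT⟩ := exists_sep (bex 1 (bex 3 (and (isPair 2 1 0) (bex 5
      (and (tripleMem 9 2 0 7) (pairMem 0 1 8))))))
    (.bex _ (.bex _ (.and (isBounded_isPair _ _ _) (.bex _ (.and (isBounded_tripleMem _ _ _ _)
      (isBounded_pairMem _ _ _))))))
    (scons L (scons A (scons X (scons C (scons D fun _ => x))))) (prod L A)
  refine ⟨T, fun w' h z hz => ((hT w' h z).1 hz).1, fun w' h σ a => ?_⟩
  rw [hT w' h]
  simp only [sat_bex, sat_and, sat_isPair, sat_tripleMem, sat_pairMem, scons_zero, scons_succ,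
    up_prod, pair_mem_prod, pair_inj]
  constructor
  · rintro ⟨-, _, -, _, -, ⟨rfl, rfl⟩, y, -, h1, h2⟩
    exact ⟨y, h1, h2⟩
  · rintro ⟨y, h1, h2⟩
    obtain ⟨hσ, hy⟩ := hC w' h σ y h1
    have ha := hD w' h y a h2
    exact ⟨⟨hσ, ha⟩, σ, hσ, a, ha, ⟨rfl, rfl⟩, y, hy, h1, h2⟩

/-! ## Functions -/

/-- The set `g` is a function from the class `D` to the class `C`. -/
structure IsFn (g : M.Q w) (D C : ∀ w', w ≤ w' → M.Q w' → Prop) : Prop where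
  rel' : ∀ w' (h : w ≤ w') (p : M.Q w'), p ∈ M.up h g → ∃ x y, p = pair x y ∧ D w' h x ∧ C w' h y
  total' : ∀ w' (h : w ≤ w') (x : M.Q w'), D w' h x → ∃ y, pair x y ∈ M.up h g
  unique' : ∀ w' (h : w ≤ w') (x y y' : M.Q w'), pair x y ∈ M.up h g → pair x y' ∈ M.up h g → y = y'

namespace IsFn

variable {g : M.Q w} {D C : ∀ w', w ≤ w' → M.Q w' → Prop}

theorem up (H : IsFn g D C) (h : w ≤ w') :
    IsFn (M.up h g) (fun w'' h' => D w'' (h.trans h')) (fun w'' h' => C w'' (h.trans h')) where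
  rel' w'' h' := by simpa using H.rel' w'' (h.trans h')
  total' w'' h' := by simpa using H.total' w'' (h.trans h')
  unique' w'' h' := by simpa using H.unique' w'' (h.trans h')

theorem dom (H : IsFn g D C) {x y : M.Q w} (h : pair x y ∈ g) : D w le_rfl x ∧ C w le_rfl y := by
  obtain ⟨x', y', e, h'⟩ := H.rel' w le_rfl _ (by simpa using h)
  obtain ⟨rfl, rfl⟩ := pair_inj.1 e
  exact h'

theorem total (H : IsFn g D C) {x : M.Q w} (h : D w le_rfl x) : ∃ y, pair x y ∈ g := by
  simpa using H.total' w le_rfl x h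

theorem unique (H : IsFn g D C) {x y y' : M.Q w} (h : pair x y ∈ g) (h' : pair x y' ∈ g) :
    y = y' :=
  H.unique' w le_rfl x y y' (by simpa using h) (by simpa using h')

end IsFn

/-- The set `g` is a function from the set `X` to the set `Y`. -/
abbrev IsFnSet (g X Y : M.Q w) : Prop :=
  IsFn g (fun _ h x => x ∈ M.up h X) fun _ h y => y ∈ M.up h Y

theorem IsFnSet.up {g X Y : M.Q w} (H : IsFnSet g X Y) (h : w ≤ w') :
    IsFnSet (M.up h g) (M.up h X) (M.up h Y) := by
  simpa [IsFnSet] using IsFn.up H h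

theorem IsFnSet.dom {g X Y x y : M.Q w} (H : IsFnSet g X Y) (h : pair x y ∈ g) :
    x ∈ X ∧ y ∈ Y := by
  simpa using IsFn.dom H h

/-! ## Trees -/

/-- A function `f : B → A` with the set of lists over `B` and the operation `C` that puts an
element of `B` in front of a list. -/
structure Signature (w : M.W) where
  A : M.Q w
  B : M.Q w
  f : M.Q w
  L : M.Q w
  C : M.Q w
  isFn : IsFnSet f B A
  isListSet : IsListSet B L
  cons_mem' : ∀ w' (h : w ≤ w') (b σ τ : M.Q w'), pair b (pair σ τ) ∈ M.up h C →
    b ∈ M.up h B ∧ σ ∈ M.up h L ∧ τ ∈ M.up h L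
  cons_nil' : ∀ w' (h : w ≤ w') (b τ : M.Q w'), pair b (pair empty τ) ∈ M.up h C ↔
    b ∈ M.up h B ∧ τ = pair empty b
  cons_snoc' : ∀ w' (h : w ≤ w') (b σ c τ : M.Q w'), pair b (pair (pair σ c) τ) ∈ M.up h C ↔
    ∃ τ', pair b (pair σ τ') ∈ M.up h C ∧ c ∈ M.up h B ∧ τ = pair τ' c

namespace Signature

/-- The signature at a later world. -/
def up (S : Signature (M := M) w) (h : w ≤ w') : Signature (M := M) w' where
  A := M.up h S.A
  B := M.up h S.B
  f := M.up h S.f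
  L := M.up h S.L
  C := M.up h S.C
  isFn := S.isFn.up h
  isListSet := S.isListSet.up h
  cons_mem' := by simpa using fun w'' (h' : w' ≤ w'') => S.cons_mem' w'' (h.trans h')
  cons_nil' := by simpa using fun w'' (h' : w' ≤ w'') => S.cons_nil' w'' (h.trans h')
  cons_snoc' := by simpa using fun w'' (h' : w' ≤ w'') => S.cons_snoc' w'' (h.trans h')

@[simp] theorem up_refl (S : Signature (M := M) w) (h : w ≤ w) : S.up h = S := by
  cases S; simp [up]

@[simp] theorem up_up (S : Signature (M := M) w) {w'' : M.W} (h : w ≤ w') (h' : w' ≤ w'') :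
    (S.up h).up h' = S.up (h.trans h') := by
  simp [up]

variable (S : Signature (M := M) w) {w'' : M.W}

theorem cons_mem {b σ τ : M.Q w} (h : pair b (pair σ τ) ∈ S.C) : b ∈ S.B ∧ σ ∈ S.L ∧ τ ∈ S.L := by
  simpa using S.cons_mem' w le_rfl b σ τ (by simpa using h)

theorem cons_nil {b τ : M.Q w} : pair b (pair empty τ) ∈ S.C ↔ b ∈ S.B ∧ τ = pair empty b := by
  simpa using S.cons_nil' w le_rfl b τ

/-- Induction from the end of the list: putting `b` in front of `σc` means putting it in front of
`σ` and then appending `c`. -/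
theorem existsUnique_cons {b : M.Q w} (hb : b ∈ S.B) : ∀ σ ∈ S.L,
    ∃ τ, ∀ w' (h : w ≤ w') (τ' : M.Q w'),
      pair (M.up h b) (pair (M.up h σ) τ') ∈ M.up h S.C ↔ τ' = M.up h τ := by
  have := S.isListSet.induction (ex (allIff (tripleMem 3 2 0 4) (.eq 0 1))) (scons b fun _ => S.C)
    ?_ ?_
  · simpa using this
  · simp only [sat_ex, sat_allIff, sat_tripleMem, sat_eq, scons_zero, scons_succ]
    refine ⟨pair empty b, fun w' h τ => ?_⟩
    rw [M.up_empty, S.cons_nil' w' h]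
    simp [up_mem h hb]
  · simp only [sat_ex, sat_allIff, sat_tripleMem, sat_eq, scons_zero, scons_succ, M.up_up]
    rintro w' h σ c hσ hc ⟨τ, hτ⟩
    refine ⟨pair τ c, fun w'' h' τ' => ?_⟩
    rw [M.up_pair, S.cons_snoc' w'' (h.trans h')]
    have hc' := up_mem h' hc
    simp only [M.up_up] at hc'
    constructor
    · rintro ⟨τ₁, h₁, -, rfl⟩
      rw [M.up_pair, (hτ w'' h' τ₁).1 h₁]
    · rintro rfl
      exact ⟨M.up h' τ, (hτ w'' h' _).2 rfl, hc', by simp⟩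

theorem cons_unique {b σ τ τ' : M.Q w} (h : pair b (pair σ τ) ∈ S.C)
    (h' : pair b (pair σ τ') ∈ S.C) : τ = τ' := by
  obtain ⟨hb, hσ, -⟩ := S.cons_mem h
  obtain ⟨τ₀, hτ⟩ := S.existsUnique_cons hb σ hσ
  have h1 := hτ w le_rfl
  simp only [M.up_refl] at h1
  rw [(h1 τ).1 h, (h1 τ').1 h']

/-- A set of lists that contains the empty list and is closed under putting an element in front
contains all lists. -/
theorem front_induction {K : M.Q w} (hnil : empty ∈ K)
    (hcons : ∀ w' (h : w ≤ w') (b σ τ : M.Q w'), pair b (pair σ τ) ∈ M.up h S.C →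
      σ ∈ M.up h K → τ ∈ M.up h K) : ∀ σ ∈ S.L, σ ∈ K := by
  have key : ∀ {w : M.W} (σ e C : M.Q w), e = empty →
      (M.sat (allImp (and (.mem 2 0) (all (all (allImp (and (tripleMem 2 1 0 6) (.mem 1 3))
        (.mem 0 3))))) (.mem 1 0)) (scons σ (scons e fun _ => C)) ↔
      ∀ w' (h : w ≤ w') (K : M.Q w'), empty ∈ K →
        (∀ w'' (h' : w' ≤ w'') (b σ τ : M.Q w''), pair b (pair σ τ) ∈ M.up (h.trans h') C →
          σ ∈ M.up h' K → τ ∈ M.up h' K) → M.up h σ ∈ K) := by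
    rintro w σ _ C rfl
    simp only [sat_allImp, sat_and, sat_mem, sat_all, sat_tripleMem, scons_zero, scons_succ, M.up_up]
    refine forall₂_congr fun w' h => forall_congr' fun K => ?_
    rw [and_imp, M.up_empty]
    refine imp_congr Iff.rfl (imp_congr ⟨fun H w'' h' b σ τ h₁ h₂ => ?_,
      fun H w₁ h₁ b w₂ h₂ σ w₃ h₃ τ h₄ => H _ _ _ _ _ h₄.1 h₄.2⟩ Iff.rfl)
    simpa using H w'' h' b w'' le_rfl σ w'' le_rfl τ (by simpa using ⟨h₁, h₂⟩)
  have hρ : ∀ {w' : M.W} (h : w ≤ w'), (fun n => M.up h (scons empty (fun _ => S.C) n)) =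
      scons empty fun _ => M.up h S.C := fun h => by simp [up_scons]
  have := S.isListSet.induction _ (scons empty fun _ => S.C) ((key _ _ _ rfl).2 ?_) ?_
  · intro σ hσ
    have h1 := (key _ _ _ rfl).1 (this σ hσ) w le_rfl K hnil
    rw [M.up_refl] at h1
    exact h1 hcons
  · intro w' h K hK _
    rwa [M.up_empty]
  · intro w' h σ c hσ hc ih
    rw [hρ, key _ _ _ rfl] at ih ⊢
    intro w'' h' K hK hcl
    have hc' := up_mem h' hc
    have hσ' := up_mem h' hσ
    simp only [M.up_up] at hc' hσ' hcl
    -- For `σc` the hypothesis on `σ` is applied to the set of the `τ` with `τc ∈ K`; this is why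
    -- the induction formula quantifies over all `K`.
    obtain ⟨K', hK'⟩ := exists_sep (bex 2 (isPair 0 1 2)) (.bex _ (isBounded_isPair _ _ _))
      (scons (M.up h' c) fun _ => K) (M.up (h.trans h') S.L)
    have hK'' : ∀ w₁ (h₁ : w'' ≤ w₁) (τ : M.Q w₁), τ ∈ M.up h₁ K' ↔
        τ ∈ M.up ((h.trans h').trans h₁) S.L ∧ pair τ (M.up (h'.trans h₁) c) ∈ M.up h₁ K := by
      intro w₁ h₁ τ
      rw [hK' w₁ h₁]
      simp
    have hσK : M.up h' σ ∈ K' := by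
      refine ih w'' h' K' ?_ ?_
      · have := (hK'' w'' le_rfl empty).2
        simp only [M.up_refl] at this
        refine this ⟨by simpa using up_mem (h.trans h') S.isListSet.nil_mem, ?_⟩
        have := hcl w'' le_rfl (M.up h' c) empty (pair empty (M.up h' c))
          ((S.cons_nil' w'' _ _ _).2 ⟨hc', rfl⟩)
        simp only [M.up_refl] at this
        exact this hK
      · intro w₁ h₁ b τ τ' hτ hτK
        rw [M.up_up] at hτ
        rw [hK''] at hτK ⊢
        refine ⟨(S.cons_mem' _ _ _ _ _ hτ).2.2, ?_⟩
        refine hcl w₁ h₁ b _ _ ((S.cons_snoc' _ _ _ _ _ _).2 ⟨τ', hτ, ?_, rfl⟩) hτK.2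
        simpa using up_mem h₁ hc'
    have := (hK'' w'' le_rfl (M.up h' σ)).1 (by simpa using hσK)
    simpa using this.2

end Signature

/-- Every function has a signature. -/
theorem exists_signature (H : M.NID w) {A B f : M.Q w} (hf : IsFnSet f B A) :
    ∃ S : Signature (M := M) w, S.A = A ∧ S.B = B ∧ S.f = f := by
  obtain ⟨L, hL⟩ := exists_isListSet B
  -- Prepending is a special case of runs: the states are lists, the initial state for `b` is the
  -- one-element list of `b`, and the label `c` leads from `σ` to `σc`. Reading `σ` then leads to
  -- `bσ`.
  obtain ⟨I, hI⟩ := exists_sep (bex 1 (bex 3 (and (isPair 2 1 0) (isPair 0 5 1))))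
    (.bex _ (.bex _ (.and (isBounded_isPair _ _ _) (isBounded_isPair _ _ _))))
    (scons B (scons L fun _ => empty)) (prod B L)
  have hI' : ∀ w' (h : w ≤ w') (b τ : M.Q w'), pair b τ ∈ M.up h I ↔
      b ∈ M.up h B ∧ τ = pair empty b := by
    intro w' h b τ
    rw [hI w' h]
    simp only [sat_bex, sat_and, sat_isPair, scons_zero, scons_succ, up_prod, pair_mem_prod,
      pair_inj, up_empty]
    constructor
    · rintro ⟨-, _, hb, _, -, ⟨rfl, rfl⟩, rfl⟩
      exact ⟨hb, rfl⟩
    · rintro ⟨hb, rfl⟩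
      have := hL.snoc_mem' w' h empty b (by simpa using up_mem h hL.nil_mem) hb
      exact ⟨⟨hb, this⟩, b, hb, _, this, ⟨rfl, rfl⟩, rfl⟩
  obtain ⟨E, hE⟩ := exists_sep (bex 1 (and (isPair 1 0 0) (bex 3 (bex 5 (isPair 2 1 0)))))
    (.bex _ (.and (isBounded_isPair _ _ _) (.bex _ (.bex _ (isBounded_isPair _ _ _)))))
    (scons (prod L B) (scons L fun _ => B)) (prod (prod L B) L)
  have hE' : ∀ w' (h : w ≤ w') (σ c τ : M.Q w'), pair (pair σ c) τ ∈ M.up h E ↔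
      σ ∈ M.up h L ∧ c ∈ M.up h B ∧ τ = pair σ c := by
    intro w' h σ c τ
    rw [hE w' h]
    simp only [sat_bex, sat_and, sat_isPair, scons_zero, scons_succ, up_prod, pair_mem_prod,
      pair_inj]
    constructor
    · rintro ⟨⟨⟨hσ, hc⟩, -⟩, _, -, ⟨rfl, rfl⟩, -⟩
      exact ⟨hσ, hc, rfl⟩
    · rintro ⟨hσ, hc, rfl⟩
      exact ⟨⟨⟨hσ, hc⟩, hL.snoc_mem' w' h _ _ hσ hc⟩, _, pair_mem_prod.2 ⟨hσ, hc⟩, ⟨rfl, rfl⟩,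
        σ, hσ, c, hc, rfl⟩
  obtain ⟨C, hC⟩ := exists_isRuns H hL (X := L) (P := B) (I := I) (S := E)
    (fun w' h z hz => ((hI w' h z).1 hz).1) (fun w' h z hz => ((hE w' h z).1 hz).1)
  refine ⟨⟨A, B, f, L, C, hf, hL, ?_, ?_, ?_⟩, rfl, rfl, rfl⟩
  · intro w' h b σ τ hm
    have := hC.subset w' h _ hm
    simpa using this
  · intro w' h b τ
    rw [hC.nil' w' h, hI' w' h]
  · intro w' h b σ c τ
    rw [hC.snoc' w' h]
    refine exists_congr fun τ' => and_congr_right fun hm => ?_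
    rw [hE' w' h]
    have := hC.subset w' h _ hm
    simp only [up_prod, pair_mem_prod] at this
    exact ⟨fun h => h.2, fun h => ⟨this.2.2, h⟩⟩

end KModel

end CZFLogic

namespace CZFLogic
open Fm

/-! ### Labelled trees and why they form a set -/

namespace Fm

/-- The formula for `IsTree`; the value of `e` is the empty set. -/
def isTree (A B f L e T : ℕ) : Fm :=
  and (ball T (bex (L + 1) (bex (A + 2) (isPair 2 1 0))))
  (and (bex A (pairMem (e + 1) 0 (T + 1)))
  (and (ball L (ball (A + 1) (ball (A + 2)
    (imp (and (pairMem 2 1 (T + 3)) (pairMem 2 0 (T + 3))) (eq 1 0)))))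
  (and (ball L (ball (B + 1) (ball (A + 2) (ball (L + 3)
    (imp (and (isPair 0 3 2) (pairMem 0 1 (T + 4)))
      (bex (A + 4) (and (pairMem 3 0 (f + 5)) (pairMem 4 0 (T + 5)))))))))
  (ball L (ball (B + 1) (ball (A + 2) (imp (and (pairMem 1 0 (f + 3)) (pairMem 2 0 (T + 3)))
    (bex (A + 3) (bex (L + 4) (and (isPair 0 4 3) (pairMem 0 1 (T + 5))))))))))))

theorem isBounded_isTree (A B f L e T : ℕ) : (isTree A B f L e T).IsBounded := by
  repeat constructor

end Fm

namespace KModel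

variable {M : KModel} {w w' : M.W} [IsCZF M]

theorem IsListSet.of_snoc_mem {B L σ b : M.Q w} (H : IsListSet B L) (h : pair σ b ∈ L) :
    σ ∈ L ∧ b ∈ B := by
  have := H.induction (or (.eq 0 3) (bex 1 (bex 3 (isPair 2 1 0))))
    (scons L (scons B fun _ => empty)) (Or.inl rfl)
    (fun w' h σ b hσ hb _ => Or.inr ⟨σ, hσ, b, hb, (sat_isPair _ _ _ _).2 rfl⟩) _ h
  simp only [sat_or, sat_eq, sat_bex, sat_isPair, scons_zero, scons_succ, pair_inj] at this
  rcases this with h | ⟨σ', hσ, b', hb, rfl, rfl⟩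
  · exact (pair_ne_empty h).elim
  · exact ⟨hσ, hb⟩

namespace Signature

/-- `T` is a tree: a set of pairs `(σ, a)`, which says that the node with address `σ` has the label
`a`. The immediate successors of this node are indexed by `f⁻¹(a)`. -/
structure IsTree (S : Signature (M := M) w) (T : M.Q w) : Prop where
  subset : Subset T (prod S.L S.A)
  root : ∃ a, pair empty a ∈ T
  unique' : ∀ w' (h : w ≤ w') (σ a a' : M.Q w'), pair σ a ∈ M.up h T → pair σ a' ∈ M.up h T → a = a'
  down' : ∀ w' (h : w ≤ w') (σ b a' : M.Q w'), pair (pair σ b) a' ∈ M.up h T →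
    ∃ a, pair b a ∈ M.up h S.f ∧ pair σ a ∈ M.up h T
  step' : ∀ w' (h : w ≤ w') (σ b a : M.Q w'), pair b a ∈ M.up h S.f → pair σ a ∈ M.up h T →
    ∃ a', pair (pair σ b) a' ∈ M.up h T

namespace IsTree

variable {S : Signature (M := M) w} {T : M.Q w}

theorem up (H : S.IsTree T) (h : w ≤ w') : (S.up h).IsTree (M.up h T) where
  subset := by simpa [Signature.up] using H.subset.up h
  root := by
    obtain ⟨a, ha⟩ := H.root
    exact ⟨M.up h a, by simpa using up_mem h ha⟩
  unique' := by simpa using fun w'' (h' : w' ≤ w'') => H.unique' w'' (h.trans h')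
  down' := by simpa [Signature.up] using fun w'' (h' : w' ≤ w'') => H.down' w'' (h.trans h')
  step' := by simpa [Signature.up] using fun w'' (h' : w' ≤ w'') => H.step' w'' (h.trans h')

theorem mem (H : S.IsTree T) {σ a : M.Q w} (h : pair σ a ∈ T) : σ ∈ S.L ∧ a ∈ S.A := by
  simpa using H.subset.mem h

theorem mem' (H : S.IsTree T) (h : w ≤ w') {σ a : M.Q w'} (hσ : pair σ a ∈ M.up h T) :
    σ ∈ M.up h S.L ∧ a ∈ M.up h S.A := (H.up h).mem hσ

theorem unique (H : S.IsTree T) {σ a a' : M.Q w} (h : pair σ a ∈ T) (h' : pair σ a' ∈ T) :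
    a = a' := H.unique' w le_rfl σ a a' (by simpa using h) (by simpa using h')

theorem step (H : S.IsTree T) {σ b a : M.Q w} (h : pair b a ∈ S.f) (h' : pair σ a ∈ T) :
    ∃ a', pair (pair σ b) a' ∈ T := by
  simpa using H.step' w le_rfl σ b a (by simpa using h) (by simpa using h')

end IsTree

/-- The quantifiers of `isTree` are bounded for the sake of separation. The bounds do no harm, since
addresses of nodes lie in `L` and their labels in `A`. -/
theorem sat_isTree (S : Signature (M := M) w) {A B f L e T : ℕ} {ρ : ℕ → M.Q w} (hA : ρ A = S.A)
    (hB : ρ B = S.B) (hf : ρ f = S.f) (hL : ρ L = S.L) (he : ρ e = empty) :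
    M.sat (isTree A B f L e T) ρ ↔ S.IsTree (ρ T) := by
  simp only [isTree, sat_and, sat_ball, sat_bex, sat_imp, sat_pairMem, sat_isPair, sat_eq,
    scons_zero, scons_succ, M.up_up, hA, hB, hf, hL, he]
  constructor
  · rintro ⟨h₁, ⟨a, -, ha⟩, h₂, h₃, h₄⟩
    have hT : Subset (ρ T) (prod S.L S.A) := by
      intro w' h z hz
      obtain ⟨σ, hσ, a, ha, rfl⟩ := h₁ w' h z hz
      simpa using ⟨hσ, ha⟩
    have hT' : ∀ w' (h : w ≤ w') (σ a : M.Q w'), pair σ a ∈ M.up h (ρ T) →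
        σ ∈ M.up h S.L ∧ a ∈ M.up h S.A := fun w' h σ a hσ => by
      simpa using hT w' h _ hσ
    refine ⟨hT, ⟨a, ha⟩, fun w' h σ a a' ha ha' => ?_, fun w' h σ b a' ha' => ?_,
      fun w' h σ b a hb ha => ?_⟩
    · obtain ⟨hσ, haA⟩ := hT' _ _ _ _ ha
      obtain ⟨-, haA'⟩ := hT' _ _ _ _ ha'
      simpa using h₂ w' h σ hσ w' le_rfl a haA w' le_rfl a' haA' w' le_rfl
        (by simpa using ⟨ha, ha'⟩)
    · obtain ⟨hτ, haA⟩ := hT' _ _ _ _ ha'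
      obtain ⟨hσ, hb⟩ := (S.isListSet.up h).of_snoc_mem hτ
      obtain ⟨a, -, ha⟩ := h₃ w' h σ hσ w' le_rfl b hb w' le_rfl a' haA w' le_rfl (pair σ b) hτ
        w' le_rfl (by simpa using ha')
      exact ⟨a, by simpa using ha⟩
    · obtain ⟨hσ, haA⟩ := hT' _ _ _ _ ha
      have hbB := ((S.isFn.up h).dom hb).1
      obtain ⟨a', -, τ, -, hτ, ha'⟩ := h₄ w' h σ hσ w' le_rfl b hbB w' le_rfl a haA w' le_rfl
        (by simpa using ⟨hb, ha⟩)
      simp only [M.up_refl] at hτ ha'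
      exact ⟨a', hτ ▸ ha'⟩
  · intro H
    obtain ⟨a, ha⟩ := H.root
    refine ⟨fun w' h z hz => ?_, ⟨a, (H.mem ha).2, ha⟩, ?_, ?_, ?_⟩
    · have := H.subset w' h z hz
      rw [up_prod, mem_prod] at this
      exact this
    · exact fun _ _ _ _ _ _ _ _ _ _ _ _ w' _ h => H.unique' w' _ _ _ _ h.1 h.2
    · rintro _ _ _ _ _ _ _ _ _ _ _ _ _ _ _ _ w' _ ⟨e, h⟩
      obtain ⟨a, ha, ha'⟩ := H.down' w' _ _ _ _ (e ▸ h)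
      exact ⟨a, (H.mem' _ ha').2, ha, ha'⟩
    · rintro _ _ _ _ _ _ _ _ _ _ _ _ w' _ ⟨hb, h⟩
      obtain ⟨a, ha⟩ := H.step' w' _ _ _ _ hb h
      exact ⟨a, (H.mem' _ ha).2, _, (H.mem' _ ha).1, rfl, ha⟩

/-- The rules that require of a set of nodes of a tree that it contains successors. -/
theorem exists_treeRules (S : Signature (M := M) w) : ∃ R : M.Q w, Compr R fun _ h r =>
    ∃ σ b a, σ ∈ M.up h S.L ∧ pair b a ∈ M.up h S.f ∧
      r = pair (upair (pair σ a) (pair σ a)) (prod (upair (pair σ b) (pair σ b)) (M.up h S.A)) := by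
  -- There are no terms for products, so the formula for a rule describes the product through its
  -- members.
  have key : ∀ {w' : M.W} (h : w ≤ w') (v τ : M.Q w'),
      (∀ w'' (h' : w' ≤ w'') (z : M.Q w''), z ∈ M.up h' v ↔
        ∃ a ∈ M.up (h.trans h') S.A, z = pair (M.up h' τ) a) ↔
      v = prod (upair τ τ) (M.up h S.A) := by
    intro w' h v τ
    constructor
    · refine fun H => ext fun w' h z => ?_
      rw [H, up_prod, mem_prod]
      simp
    · rintro rfl w' h z
      rw [up_prod, mem_prod]
      simp
  obtain ⟨R, hR⟩ := exists_image (ex (ex (ex (ex (ex (ex (ex (ex (and (isPair 8 7 6)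
    (and (isPair 6 5 4) (and (isPair 3 7 4) (and (isSing 1 3) (and (isPair 2 7 5)
      (and (allIff (.mem 0 1) (bex 11 (isPair 1 4 0))) (isPair 9 1 0)))))))))))))))
    (fun _ => S.A) (prod S.L S.f) fun w' h p hp => by
      rw [up_prod, mem_prod] at hp
      obtain ⟨σ, -, q, hq, rfl⟩ := hp
      obtain ⟨b, a, rfl, -⟩ := S.isFn.rel' w' h q hq
      refine ⟨pair (upair (pair σ a) (pair σ a))
        (prod (upair (pair σ b) (pair σ b)) (M.up h S.A)), fun w'' h' r => ?_⟩
      simp only [sat_ex, sat_and, sat_isPair, sat_isSing, sat_allIff, sat_mem, sat_bex, scons_zero,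
        scons_succ, up_pair, pair_inj, up_upair, up_prod, M.up_up]
      simp only [key (h.trans h')]
      constructor
      · rintro ⟨_, _, _, _, _, _, _, _, ⟨rfl, rfl⟩, e, e₁, e₂, e₃, e₄, e₅⟩
        obtain ⟨rfl, rfl⟩ := pair_inj.1 e
        subst e₁ e₂ e₃ e₄ e₅
        rfl
      · rintro rfl
        exact ⟨_, _, _, _, _, _, _, _, ⟨rfl, rfl⟩, rfl, rfl, rfl, rfl, rfl, rfl⟩
  refine ⟨R, fun w' h r => ?_⟩
  rw [hR w' h]
  simp only [sat_ex, sat_and, sat_isPair, sat_isSing, sat_allIff, sat_mem, sat_bex, scons_zero,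
    scons_succ, M.up_up]
  simp only [key h]
  constructor
  · rintro ⟨_, hp, σ, _, b, a, _, _, _, _, rfl, rfl, rfl, rfl, rfl, rfl, rfl⟩
    rw [up_prod, pair_mem_prod] at hp
    exact ⟨σ, b, a, hp.1, hp.2, rfl⟩
  · rintro ⟨σ, b, a, hσ, hb, rfl⟩
    exact ⟨_, by simpa using ⟨hσ, hb⟩, _, _, _, _, _, _, _, _, rfl, rfl, rfl, rfl, rfl, rfl, rfl⟩

theorem isRuleSet_treeRules {S : Signature (M := M) w} {R : M.Q w} (hR : Compr R fun _ h r =>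
    ∃ σ b a, σ ∈ M.up h S.L ∧ pair b a ∈ M.up h S.f ∧
      r = pair (upair (pair σ a) (pair σ a)) (prod (upair (pair σ b) (pair σ b)) (M.up h S.A))) :
    IsRuleSet R (prod S.L S.A) := by
  intro w' h r hr
  obtain ⟨σ, b, a, hσ, hb, rfl⟩ := (hR w' h r).1 hr
  obtain ⟨hbB, haA⟩ := (S.isFn.up h).dom hb
  refine ⟨_, _, rfl, subset_upair (by simpa using ⟨hσ, haA⟩), fun w'' h' z hz => ?_, _, rfl⟩
  rw [up_prod, mem_prod] at hz
  obtain ⟨τ, hτ, a', ha', rfl⟩ := hz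
  have hτ' : τ = M.up h' (pair σ b) := by simpa using hτ
  subst hτ'
  have := up_mem h' (S.isListSet.snoc_mem' w' h σ b hσ hbB)
  simp only [M.up_up, up_prod, pair_mem_prod] at this ha' ⊢
  exact ⟨this, ha'⟩

/-- Induction on the address. A node of `T` at `σb` has its parent in `β`; then `β` contains `σb`
with some label, and this is the right one because `β ⊆ T` and labels in `T` are unique. -/
theorem IsTree.mem_of_step {S : Signature (M := M) w} {T β : M.Q w} (H : S.IsTree T)
    (hβT : Subset β T) (hroot : ∃ a, pair empty a ∈ β)
    (hβ : ∀ w' (h : w ≤ w') (σ b a : M.Q w'), pair b a ∈ M.up h S.f → pair σ a ∈ M.up h β →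
      ∃ a', pair (pair σ b) a' ∈ M.up h β) :
    ∀ σ ∈ S.L, ∀ a, pair σ a ∈ T → pair σ a ∈ β := by
  have := S.isListSet.induction (allImp (pairMem 1 0 2) (pairMem 1 0 3)) (scons T fun _ => β) ?_ ?_
  · intro σ hσ a ha
    have := this σ hσ
    simp only [sat_allImp, sat_pairMem, scons_zero, scons_succ] at this
    simpa using this w le_rfl a (by simpa using ha)
  · simp only [sat_allImp, sat_pairMem, scons_zero, scons_succ, up_empty]
    intro w' h a ha
    obtain ⟨a', ha'⟩ := hroot
    have h1 := up_mem h ha'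
    rw [up_pair, up_empty] at h1
    rwa [H.unique' w' h _ _ _ ha (hβT w' h _ h1)]
  · simp only [sat_allImp, sat_pairMem, scons_zero, scons_succ, M.up_up, up_pair]
    intro w' h σ b hσ hb ih w'' h' a ha
    obtain ⟨a₀, hb', ha₀⟩ := H.down' w'' _ _ _ _ ha
    obtain ⟨a', ha'⟩ := hβ w'' (h.trans h') _ _ _ hb' (ih w'' h' a₀ ha₀)
    rwa [H.unique' w'' _ _ _ _ ha (hβT w'' _ _ ha')]

/-- The class of trees is a set. -/
theorem exists_treeSet (H : M.NID w) (S : Signature (M := M) w) :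
    ∃ V : M.Q w, Compr V fun _ h T => (S.up h).IsTree T := by
  obtain ⟨R, hR⟩ := S.exists_treeRules
  obtain ⟨G, hG, hG'⟩ := exists_generates H (isRuleSet_treeRules hR)
  have hTG : ∀ w' (h : w ≤ w') (T : M.Q w'), (S.up h).IsTree T → T ∈ M.up h G := by
    intro w' h T hT
    have hcl : IsClosedUnder (M.up h R) (M.up h (prod S.L S.A)) T := by
      refine ⟨by simpa [up] using hT.subset, fun w'' h' a b hab haT => ?_⟩
      rw [M.up_up] at hab
      obtain ⟨σ, b, a, hσ, hb, e⟩ := (hR w'' _ _).1 hab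
      obtain ⟨rfl, rfl⟩ := pair_inj.1 e
      have h1 : pair σ a ∈ M.up h' T := haT.mem (by simp)
      obtain ⟨a', ha'⟩ := hT.step' w'' h' σ b a (by simpa [up] using hb) h1
      have h2 := ((hT.up h').mem ha').2
      exact ⟨_, pair_mem_prod.2 ⟨mem_upair.2 (Or.inl rfl), by simpa [up] using h2⟩, ha'⟩
    -- Set generation is applied at the root only. The generator obtained is closed and contained in
    -- `T`, so it is all of `T`.
    obtain ⟨a₀, ha₀⟩ := hT.root
    obtain ⟨β, hβG, haβ, hβT⟩ := hG' w' h T hcl _ ha₀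
    have hβ := (hG w' h β hβG).2
    have hstep : ∀ w'' (h' : w' ≤ w'') (σ b a : M.Q w''), pair b a ∈ M.up h' (S.up h).f →
        pair σ a ∈ M.up h' β → ∃ a', pair (pair σ b) a' ∈ M.up h' β := by
      intro w'' h' σ b a hb hσ
      have hσT := ((hT.up h').mem (hβT w'' h' _ hσ)).1
      simp only [up, M.up_up] at hb hσT
      obtain ⟨z, hz, hzβ⟩ := hβ w'' h' _ _ (by
        rw [M.up_up]
        exact (hR w'' _ _).2 ⟨σ, b, a, hσT, hb, rfl⟩) (subset_upair hσ)
      rw [mem_prod] at hz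
      obtain ⟨τ, hτ, a', -, rfl⟩ := hz
      rw [mem_upair, or_self] at hτ
      exact ⟨a', hτ ▸ hzβ⟩
    have : T = β := Subset.antisymm (subset_of_pairs hT.subset fun w'' h' σ a ha => by
      refine (hT.up h').mem_of_step (hβT.up h') ⟨M.up h' a₀, ?_⟩ ?_ σ ((hT.up h').mem ha).1 a ha
      · simpa using up_mem h' haβ
      · simpa [up] using fun w₃ (h₃ : w'' ≤ w₃) => hstep w₃ (h'.trans h₃)) hβT
    exact this ▸ hβG
  obtain ⟨V, hV⟩ := exists_sep (isTree 1 2 3 4 5 0) (isBounded_isTree _ _ _ _ _ _)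
    (scons S.A (scons S.B (scons S.f (scons S.L fun _ => empty)))) G
  refine ⟨V, fun w' h T => ?_⟩
  rw [hV w' h]
  beta_reduce
  rw [(S.up h).sat_isTree (by rfl) (by rfl) (by rfl) (by rfl) (by simp)]
  exact ⟨fun h => h.2, fun hT => ⟨hTG w' h T hT, hT⟩⟩

end Signature

end KModel

end CZFLogic

namespace CZFLogic
open Fm

namespace KModel

variable {M : KModel} {w w' : M.W} [IsCZF M]

namespace Signature

/-! ## The coalgebra of trees -/

/-- `V` is the set of trees. -/
def IsTreeSet (S : Signature (M := M) w) (V : M.Q w) : Prop :=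
  Compr V fun _ h T => (S.up h).IsTree T

theorem IsTreeSet.up {S : Signature (M := M) w} {V : M.Q w} (H : S.IsTreeSet V) (h : w ≤ w') :
    (S.up h).IsTreeSet (M.up h V) := by
  intro w'' h' T
  simpa using H w'' (h.trans h') T

theorem IsTreeSet.mem_iff {S : Signature (M := M) w} {V T : M.Q w} (H : S.IsTreeSet V) :
    T ∈ V ↔ S.IsTree T := by
  simpa using H w le_rfl T

/-- The set of the `(x, T)` with `x ∈ X` and a tree `T` that is determined by `x`. -/
theorem exists_pullMap {S : Signature (M := M) w} {V : M.Q w} (hV : S.IsTreeSet V) {C D X : M.Q w}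
    (H : ∀ w' (h : w ≤ w') (x : M.Q w'), x ∈ M.up h X →
      ∃ T, (S.up h).IsTree T ∧ Pull (M.up h C) (M.up h D) x T) :
    ∃ t : M.Q w, Compr t fun _ h z => ∃ x T, z = pair x T ∧ x ∈ M.up h X ∧ T ∈ M.up h V ∧
      Pull (M.up h C) (M.up h D) x T := by
  obtain ⟨t, ht⟩ := exists_image (ex (and (isPair 2 1 0) (and (.mem 0 3) (pull 4 5 1 0))))
    (scons V (scons C fun _ => D)) X fun w' h x hx => by
      obtain ⟨T, hT, hP⟩ := H w' h x hx
      refine ⟨pair x T, fun w'' h' z => ?_⟩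
      simp only [sat_ex, sat_and, sat_isPair, sat_mem, sat_pull, scons_zero, scons_succ, up_pair]
      constructor
      · rintro ⟨T', rfl, hT', hP'⟩
        rw [(hV.up _).mem_iff] at hT'
        have hP := hP.up h'
        have hT := hT.up h'
        simp only [M.up_up, up_up] at hP hT
        rw [hP.unique hT.subset hT'.subset hP']
      · rintro rfl
        refine ⟨_, rfl, ?_, by simpa using hP.up h'⟩
        rw [(hV.up _).mem_iff]
        simpa using hT.up h'
  refine ⟨t, fun w' h z => ?_⟩
  rw [ht w' h]
  simp only [sat_ex, sat_and, sat_isPair, sat_mem, sat_pull, scons_zero, scons_succ]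
  constructor
  · rintro ⟨x, hx, T, rfl, hT, hP⟩
    exact ⟨x, T, rfl, hx, hT, hP⟩
  · rintro ⟨x, T, rfl, hx, hT, hP⟩
    exact ⟨x, hx, T, rfl, hT, hP⟩

/-- The conditions on a tree are inherited because appending commutes with putting `b` in front.
That `b` lies over the root label is what gives the subtree a root. -/
theorem IsTree.exists_subtree {S : Signature (M := M) w} {T a b : M.Q w} (H : S.IsTree T)
    (ha : pair empty a ∈ T) (hb : pair b a ∈ S.f) : ∃ T', S.IsTree T' ∧ Pull S.C T b T' := by
  obtain ⟨T', hT', hP⟩ := exists_pull (L := S.L) (A := S.A) (X := S.L) (C := S.C) (D := T) (x := b)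
    (fun w' h σ τ hm => (S.cons_mem' w' h _ _ _ hm).2) (fun w' h τ a ha => (H.mem' h ha).2)
  have hbB := (S.isFn.dom hb).1
  refine ⟨T', ⟨hT', ?_, ?_, ?_, ?_⟩, hP⟩
  · obtain ⟨a', ha'⟩ := H.step hb ha
    exact ⟨a', hP.iff.2 ⟨_, S.cons_nil.2 ⟨hbB, rfl⟩, ha'⟩⟩
  · intro w' h σ a a' ha ha'
    obtain ⟨τ, hτ, ha⟩ := (hP w' h _ _).1 ha
    obtain ⟨τ', hτ', ha'⟩ := (hP w' h _ _).1 ha'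
    rw [(S.up h).cons_unique hτ hτ'] at ha
    exact H.unique' w' h _ _ _ ha ha'
  · intro w' h σ c a' ha'
    obtain ⟨τ, hτ, ha'⟩ := (hP w' h _ _).1 ha'
    obtain ⟨τ', hτ', -, rfl⟩ := (S.cons_snoc' w' h _ _ _ _).1 hτ
    obtain ⟨a, hc, ha⟩ := H.down' w' h _ _ _ ha'
    exact ⟨a, hc, (hP w' h _ _).2 ⟨τ', hτ', ha⟩⟩
  · intro w' h σ c a hc ha
    obtain ⟨τ, hτ, ha⟩ := (hP w' h _ _).1 ha
    obtain ⟨a', ha'⟩ := H.step' w' h _ _ _ hc ha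
    exact ⟨a', (hP w' h _ _).2 ⟨_, (S.cons_snoc' w' h _ _ _ _).2
      ⟨τ, hτ, ((S.up h).isFn.dom hc).1, rfl⟩, ha'⟩⟩

/-- `t` is the function that maps `b ∈ f⁻¹(a)` to the subtree of `T` at `b`. -/
def IsBranches (S : Signature (M := M) w) (V T a t : M.Q w) : Prop :=
  Compr t fun _ h z => ∃ b T', z = pair b T' ∧ pair b (M.up h a) ∈ M.up h S.f ∧ T' ∈ M.up h V ∧
    Pull (M.up h S.C) (M.up h T) b T'

theorem IsBranches.mem_iff {S : Signature (M := M) w} {V T a t b T' : M.Q w}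
    (H : S.IsBranches V T a t) :
    pair b T' ∈ t ↔ pair b a ∈ S.f ∧ T' ∈ V ∧ Pull S.C T b T' := by
  rw [mem_of_compr H]
  simp only [M.up_refl]
  constructor
  · rintro ⟨b', T'', e, h⟩
    obtain ⟨rfl, rfl⟩ := pair_inj.1 e
    exact h
  · exact fun h => ⟨b, T', rfl, h⟩

theorem IsBranches.up {S : Signature (M := M) w} {V T a t : M.Q w} (H : S.IsBranches V T a t)
    (h : w ≤ w') : (S.up h).IsBranches (M.up h V) (M.up h T) (M.up h a) (M.up h t) := by
  intro w'' h' z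
  simpa [Signature.up] using H w'' (h.trans h') z

theorem exists_isBranches {S : Signature (M := M) w} {V : M.Q w} (hV : S.IsTreeSet V) {T a : M.Q w}
    (H : S.IsTree T) (ha : pair empty a ∈ T) : ∃ t, S.IsBranches V T a t := by
  obtain ⟨F, hF⟩ := exists_sep (pairMem 0 1 2) (isBounded_pairMem _ _ _) (scons a fun _ => S.f) S.B
  have hF' : ∀ w' (h : w ≤ w') (b : M.Q w'), b ∈ M.up h F ↔ pair b (M.up h a) ∈ M.up h S.f := by
    intro w' h b
    rw [hF w' h]
    simp only [sat_pairMem, scons_zero, scons_succ]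
    exact ⟨fun h => h.2, fun hb => ⟨((S.isFn.up h).dom hb).1, hb⟩⟩
  obtain ⟨t, ht⟩ := exists_pullMap hV (C := S.C) (D := T) (X := F) fun w' h b hb => by
    have h1 := up_mem h ha
    rw [up_pair, up_empty] at h1
    exact (H.up h).exists_subtree h1 ((hF' w' h b).1 hb)
  refine ⟨t, fun w' h z => (ht w' h z).trans ?_⟩
  simp only [hF']

/-- The structure map of the coalgebra of trees. -/
def IsTreeMap (S : Signature (M := M) w) (V u : M.Q w) : Prop :=
  Compr u fun _ h z => ∃ T a t, z = pair T (pair a t) ∧ T ∈ M.up h V ∧ pair empty a ∈ T ∧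
    (S.up h).IsBranches (M.up h V) T a t

theorem IsTreeMap.up {S : Signature (M := M) w} {V u : M.Q w} (H : S.IsTreeMap V u) (h : w ≤ w') :
    (S.up h).IsTreeMap (M.up h V) (M.up h u) := by
  intro w'' h' z
  simpa using H w'' (h.trans h') z

theorem IsTreeMap.mem_iff {S : Signature (M := M) w} {V u T q : M.Q w} (H : S.IsTreeMap V u) :
    pair T q ∈ u ↔ ∃ a t, q = pair a t ∧ T ∈ V ∧ pair empty a ∈ T ∧ S.IsBranches V T a t := by
  rw [mem_of_compr H]
  simp only [M.up_refl, up_refl]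
  constructor
  · rintro ⟨T', a, t, e, h⟩
    obtain ⟨rfl, rfl⟩ := pair_inj.1 e
    exact ⟨a, t, rfl, h⟩
  · rintro ⟨a, t, rfl, h⟩
    exact ⟨T, a, t, rfl, h⟩

theorem IsBranches.unique {S : Signature (M := M) w} {V T a t t' : M.Q w}
    (H : S.IsBranches V T a t) (H' : S.IsBranches V T a t') : t = t' :=
  ext fun w' h z => (H w' h z).trans (H' w' h z).symm

theorem exists_isTreeMap {S : Signature (M := M) w} {V : M.Q w} (hV : S.IsTreeSet V) :
    ∃ u, S.IsTreeMap V u := by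
  have key : ∀ {w₁ w₂ : M.W} (h₁ : w ≤ w₁) (h₂ : w₁ ≤ w₂) (T : M.Q w₁) (a t : M.Q w₂),
      (∀ w' (h : w₂ ≤ w') (z : M.Q w'), z ∈ M.up h t ↔ ∃ b T', z = pair b T' ∧
        pair b (M.up h a) ∈ M.up ((h₁.trans h₂).trans h) S.f ∧
        T' ∈ M.up ((h₁.trans h₂).trans h) V ∧
        Pull (M.up ((h₁.trans h₂).trans h) S.C) (M.up (h₂.trans h) T) b T') ↔
      (S.up (h₁.trans h₂)).IsBranches (M.up (h₁.trans h₂) V) (M.up h₂ T) a t := by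
    intro w₁ w₂ h₁ h₂ T a t
    simp only [IsBranches, Compr, Signature.up, M.up_up]
  obtain ⟨u, hu⟩ := exists_image (ex (ex (ex (and (isPair 4 3 0) (and (isPair 0 2 1)
    (and (pairMem 6 2 3) (allIff (.mem 0 2) (ex (ex (and (isPair 2 1 0) (and (pairMem 1 5 8)
      (and (.mem 0 10) (pull 11 6 1 0)))))))))))))
    (scons S.f (scons empty (scons V fun _ => S.C))) V fun w' h T hT => by
      rw [(hV.up h).mem_iff] at hT
      obtain ⟨a, ha⟩ := hT.root
      obtain ⟨t, ht⟩ := exists_isBranches (hV.up h) hT ha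
      refine ⟨pair T (pair a t), fun w'' h' z => ?_⟩
      simp only [sat_ex, sat_and, sat_isPair, sat_mem, sat_pull, sat_pairMem, sat_allIff, scons_zero,
        scons_succ, up_pair, M.up_up, up_empty]
      simp only [key h h']
      have ha' := up_mem h' ha
      have ht' := ht.up h'
      simp only [up_pair, up_empty, M.up_up, up_up] at ha' ht'
      constructor
      · rintro ⟨a₁, t₁, _, rfl, rfl, ha₁, ht₁⟩
        cases (hT.up h').unique ha' ha₁
        rw [ht'.unique ht₁]
      · rintro rfl
        exact ⟨_, _, _, rfl, rfl, ha', ht'⟩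
  refine ⟨u, fun w' h z => ?_⟩
  rw [hu w' h]
  simp only [sat_ex, sat_and, sat_isPair, sat_mem, sat_pull, sat_pairMem, sat_allIff, scons_zero,
    scons_succ, M.up_up, up_empty]
  simp only [key h le_rfl, M.up_refl]
  constructor
  · rintro ⟨T, hT, a, t, _, rfl, rfl, ha, ht⟩
    exact ⟨T, a, t, rfl, hT, ha, ht⟩
  · rintro ⟨T, a, t, rfl, hT, ha, ht⟩
    exact ⟨T, hT, a, t, _, rfl, rfl, ha, ht⟩

/-! ## Coalgebras and their morphisms -/

/-- `p ∈ P_f(X)` -/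
def MemPoly (S : Signature (M := M) w) (X p : M.Q w) : Prop :=
  ∃ a t, p = pair a t ∧ a ∈ S.A ∧ IsFn t
    (fun _ h b => b ∈ M.up h S.B ∧ pair b (M.up h a) ∈ M.up h S.f) fun _ h x => x ∈ M.up h X

/-- `v` is a function from `X` to `P_f(X)`. -/
def IsCoalg (S : Signature (M := M) w) (X v : M.Q w) : Prop :=
  IsFn v (fun _ h x => x ∈ M.up h X) fun _ h p => (S.up h).MemPoly (M.up h X) p

theorem IsCoalg.up {S : Signature (M := M) w} {X v : M.Q w} (H : S.IsCoalg X v) (h : w ≤ w') :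
    (S.up h).IsCoalg (M.up h X) (M.up h v) := by
  simpa [IsCoalg] using IsFn.up H h

/-- A tree has exactly one root label `a`, and exactly one subtree at each `b` with `f(b) = a`. -/
theorem isCoalg_treeMap {S : Signature (M := M) w} {V u : M.Q w} (hV : S.IsTreeSet V)
    (hu : S.IsTreeMap V u) : S.IsCoalg V u where
  rel' w' h p hp := by
    obtain ⟨T, a, t, rfl, hT, ha, ht⟩ := (hu w' h p).1 hp
    have hT' := (hV.up h).mem_iff.1 hT
    refine ⟨T, _, rfl, hT, a, t, rfl, (hT'.mem ha).2, ?_, ?_, ?_⟩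
    · intro w'' h' p hp
      obtain ⟨b, T', rfl, hb, hT', -⟩ := (ht w'' h' p).1 hp
      exact ⟨b, T', rfl, ⟨((S.up h).isFn.up h').dom hb |>.1, hb⟩, hT'⟩
    · intro w'' h' b hb
      have ha' := up_mem h' ha
      rw [up_pair, up_empty] at ha'
      obtain ⟨T', hT₁, hP⟩ := (hT'.up h').exists_subtree ha' hb.2
      exact ⟨T', (ht w'' h' _).2 ⟨b, T', rfl, hb.2, ((hV.up h).up h').mem_iff.2 hT₁, hP⟩⟩
    · intro w'' h' b T₁ T₂ h₁ h₂
      obtain ⟨-, hT₁, hP₁⟩ := (ht.up h').mem_iff.1 h₁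
      obtain ⟨-, hT₂, hP₂⟩ := (ht.up h').mem_iff.1 h₂
      rw [((hV.up h).up h').mem_iff] at hT₁ hT₂
      exact hP₁.unique hT₁.subset hT₂.subset hP₂
  total' w' h T hT := by
    have hT' := (hV.up h).mem_iff.1 hT
    obtain ⟨a, ha⟩ := hT'.root
    obtain ⟨t, ht⟩ := exists_isBranches (hV.up h) hT' ha
    exact ⟨_, (hu.up h).mem_iff.2 ⟨a, t, rfl, hT, ha, ht⟩⟩
  unique' w' h T q q' hq hq' := by
    obtain ⟨a, t, rfl, hT, ha, ht⟩ := (hu.up h).mem_iff.1 hq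
    obtain ⟨a', t', rfl, -, ha', ht'⟩ := (hu.up h).mem_iff.1 hq'
    cases ((hV.up h).mem_iff.1 hT).unique ha ha'
    rw [ht.unique ht']

end Signature

/-- `s = h ∘ t` -/
def IsComp (s k t : M.Q w) : Prop :=
  Compr s fun _ h p => ∃ b x y, p = pair b y ∧ pair b x ∈ M.up h t ∧ pair x y ∈ M.up h k

theorem IsComp.mem_iff {s k t b y : M.Q w} (H : IsComp s k t) :
    pair b y ∈ s ↔ ∃ x, pair b x ∈ t ∧ pair x y ∈ k := by
  rw [mem_of_compr H]
  simp only [M.up_refl]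
  constructor
  · rintro ⟨b', x, y', e, h⟩
    obtain ⟨rfl, rfl⟩ := pair_inj.1 e
    exact ⟨x, h⟩
  · rintro ⟨x, h⟩
    exact ⟨b, x, y, rfl, h⟩

/-- `q = P_f(k)(p)` -/
def IsPolyMap (k p q : M.Q w) : Prop :=
  ∃ a t s, p = pair a t ∧ q = pair a s ∧ IsComp s k t

/-- `k` is a morphism of coalgebras from `(X, v)` to `(Y, u)`. -/
def IsMorphism (k X v Y u : M.Q w) : Prop :=
  IsFnSet k X Y ∧ ∀ w' (h : w ≤ w') (x : M.Q w'), x ∈ M.up h X → ∃ p y q,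
    pair x p ∈ M.up h v ∧ pair x y ∈ M.up h k ∧ pair y q ∈ M.up h u ∧ IsPolyMap (M.up h k) p q

theorem IsMorphism.up {k X v Y u : M.Q w} (H : IsMorphism k X v Y u) (h : w ≤ w') :
    IsMorphism (M.up h k) (M.up h X) (M.up h v) (M.up h Y) (M.up h u) :=
  ⟨H.1.up h, fun w'' h' => by simpa using H.2 w'' (h.trans h')⟩

end KModel

end CZFLogic

namespace CZFLogic
open Fm

namespace KModel

variable {M : KModel} {w w' : M.W} [IsCZF M]

namespace Signature

/-! ## Labels and transitions of a coalgebra -/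

namespace IsCoalg

variable {S : Signature (M := M) w} {X v : M.Q w}

theorem dom (H : S.IsCoalg X v) {x p : M.Q w} (h : pair x p ∈ v) : x ∈ X ∧ S.MemPoly X p := by
  simpa using IsFn.dom H h

theorem exists_value (H : S.IsCoalg X v) {x : M.Q w} (hx : x ∈ X) :
    ∃ a t, pair x (pair a t) ∈ v := by
  obtain ⟨p, hp⟩ := IsFn.total H (by simpa using hx)
  obtain ⟨-, a, t, rfl, -⟩ := H.dom hp
  exact ⟨a, t, hp⟩

theorem value (H : S.IsCoalg X v) {x a t : M.Q w} (h : pair x (pair a t) ∈ v) :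
    a ∈ S.A ∧ IsFn t (fun _ h b => b ∈ M.up h S.B ∧ pair b (M.up h a) ∈ M.up h S.f)
      fun _ h x => x ∈ M.up h X := by
  obtain ⟨-, a', t', e, h'⟩ := H.dom h
  obtain ⟨rfl, rfl⟩ := pair_inj.1 e
  exact h'

theorem succ (H : S.IsCoalg X v) {x a t b y : M.Q w} (h : pair x (pair a t) ∈ v)
    (hy : pair b y ∈ t) : b ∈ S.B ∧ pair b a ∈ S.f ∧ y ∈ X := by
  simpa [and_assoc] using (H.value h).2.dom hy

theorem exists_succ (H : S.IsCoalg X v) {x a t b : M.Q w} (h : pair x (pair a t) ∈ v)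
    (hb : pair b a ∈ S.f) : ∃ y, pair b y ∈ t :=
  (H.value h).2.total (by simpa using ⟨(S.isFn.dom hb).1, hb⟩)

theorem value_unique (H : S.IsCoalg X v) {x a t a' t' : M.Q w} (h : pair x (pair a t) ∈ v)
    (h' : pair x (pair a' t') ∈ v) : a = a' ∧ t = t' :=
  pair_inj.1 (IsFn.unique H h h')

end IsCoalg

/-- A coalgebra `(X, v)` with its labels, transitions and runs. -/
structure Behaviour (S : Signature (M := M) w) (X v D R : M.Q w) : Prop where
  coalg : S.IsCoalg X v
  label' : ∀ w' (h : w ≤ w') (x a : M.Q w'), pair x a ∈ M.up h D ↔ ∃ t, pair x (pair a t) ∈ M.up h v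
  run_mem' : ∀ w' (h : w ≤ w') (x σ y : M.Q w'), pair x (pair σ y) ∈ M.up h R →
    x ∈ M.up h X ∧ σ ∈ M.up h S.L ∧ y ∈ M.up h X
  run_nil' : ∀ w' (h : w ≤ w') (x y : M.Q w'), pair x (pair empty y) ∈ M.up h R ↔
    x ∈ M.up h X ∧ y = x
  run_snoc' : ∀ w' (h : w ≤ w') (x σ b y' : M.Q w'), pair x (pair (pair σ b) y') ∈ M.up h R ↔
    ∃ y, pair x (pair σ y) ∈ M.up h R ∧ ∃ a t, pair y (pair a t) ∈ M.up h v ∧ pair b y' ∈ t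

theorem exists_labels {S : Signature (M := M) w} {X v : M.Q w} (H : S.IsCoalg X v) :
    ∃ D : M.Q w, ∀ w' (h : w ≤ w') (x a : M.Q w'), pair x a ∈ M.up h D ↔
      ∃ t, pair x (pair a t) ∈ M.up h v := by
  obtain ⟨D, hD⟩ := exists_image (ex (ex (ex (ex (and (isPair 4 3 0) (and (isPair 0 2 1)
    (isPair 5 3 2))))))) (fun _ => v) v fun w' h p hp => by
      obtain ⟨x, q, rfl, -⟩ := H.rel' w' h p hp
      obtain ⟨-, a, t, rfl, -⟩ := (H.up h).dom hp
      refine ⟨pair x a, fun w'' h' z => ?_⟩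
      simp only [sat_ex, sat_and, sat_isPair, scons_zero, scons_succ, up_pair]
      constructor
      · rintro ⟨_, _, _, q, e, rfl, rfl⟩
        simp only [pair_inj] at e
        obtain ⟨rfl, rfl, rfl⟩ := e
        rfl
      · rintro rfl
        exact ⟨_, _, _, _, rfl, rfl, rfl⟩
  refine ⟨D, fun w' h x a => ?_⟩
  rw [hD w' h]
  simp only [sat_ex, sat_and, sat_isPair, scons_zero, scons_succ]
  constructor
  · rintro ⟨_, hp, x', a', t, _, rfl, rfl, e⟩
    obtain ⟨rfl, rfl⟩ := pair_inj.1 e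
    exact ⟨t, hp⟩
  · rintro ⟨t, ht⟩
    exact ⟨_, ht, _, _, _, _, rfl, rfl, rfl⟩

theorem exists_transitions {S : Signature (M := M) w} {X v : M.Q w} (H : S.IsCoalg X v) :
    ∃ E : M.Q w, Subset E (prod (prod X S.B) X) ∧
      ∀ w' (h : w ≤ w') (x b y : M.Q w'), pair (pair x b) y ∈ M.up h E ↔
        ∃ a t, pair x (pair a t) ∈ M.up h v ∧ pair b y ∈ t := by
  -- The parts of a value of `v` are reached through the members of Kuratowski pairs, which bounds
  -- every quantifier.
  obtain ⟨E, hE⟩ := exists_sep (bex 1 (bex 3 (bex 4 (bex 6 (and (isPair 4 3 2) (and (isPair 3 1 0)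
      (bex 8 (bex 0 (bex 0 (and (isPair 2 4 0) (bex 0 (bex 0 (bex 14 (and (isPair 3 0 1)
        (pairMem 6 8 1)))))))))))))))
    (by repeat constructor)
    (scons (prod X S.B) (scons X (scons S.B (scons v fun _ => S.A)))) (prod (prod X S.B) X)
  refine ⟨E, fun w' h z hz => ((hE w' h z).1 hz).1, fun w' h x b y => ?_⟩
  rw [hE w' h]
  simp only [sat_bex, sat_and, sat_isPair, sat_pairMem, scons_zero, scons_succ, up_prod,
    pair_mem_prod]
  constructor
  · rintro ⟨-, _, -, _, -, _, -, _, -, e, rfl, _, hp, _, -, _, -, rfl, _, -, t, -, a, -, rfl, ht⟩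
    simp only [pair_inj] at e
    obtain ⟨⟨rfl, rfl⟩, rfl⟩ := e
    exact ⟨a, t, hp, ht⟩
  · rintro ⟨a, t, hp, ht⟩
    have hx := ((H.up h).dom hp).1
    have ha := ((H.up h).value hp).1
    obtain ⟨hb, -, hy⟩ := (H.up h).succ hp ht
    exact ⟨⟨⟨hx, hb⟩, hy⟩, _, pair_mem_prod.2 ⟨hx, hb⟩, y, hy, x, hx, b, hb, rfl, rfl, _, hp,
      upair x (pair a t), by simp [pair], _, by simp, rfl, upair a t, by simp [pair], t, by simp,
      a, ha, rfl, ht⟩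

theorem IsCoalg.exists_behaviour {S : Signature (M := M) w} {X v : M.Q w} (H : M.NID w)
    (hv : S.IsCoalg X v) : ∃ D R, S.Behaviour X v D R := by
  obtain ⟨D, hD⟩ := exists_labels hv
  obtain ⟨E, hE, hE'⟩ := exists_transitions hv
  -- The initial relation is the diagonal: a run with parameter `x` starts in `x`.
  obtain ⟨I, hI⟩ := exists_sep (bex 1 (isPair 1 0 0)) (.bex _ (isBounded_isPair _ _ _)) (fun _ => X)
    (prod X X)
  obtain ⟨R, hR⟩ := exists_isRuns H S.isListSet (X := X) (P := X) (I := I) (S := E)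
    (fun w' h z hz => ((hI w' h z).1 hz).1) hE
  refine ⟨D, R, hv, hD, fun w' h x σ y hm => ?_, fun w' h x y => ?_, fun w' h x σ b y' => ?_⟩
  · have := hR.subset w' h _ hm
    simpa using this
  · rw [hR.nil' w' h, hI w' h]
    simp only [sat_bex, sat_isPair, scons_zero, scons_succ, up_prod, pair_mem_prod, pair_inj]
    constructor
    · rintro ⟨-, _, hx, rfl, rfl⟩
      exact ⟨hx, rfl⟩
    · rintro ⟨hx, rfl⟩
      exact ⟨⟨hx, hx⟩, _, hx, rfl, rfl⟩
  · rw [hR.snoc' w' h]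
    simp only [hE' w' h]

namespace Behaviour

variable {S : Signature (M := M) w} {X v D R : M.Q w}

theorem up (H : S.Behaviour X v D R) (h : w ≤ w') :
    (S.up h).Behaviour (M.up h X) (M.up h v) (M.up h D) (M.up h R) where
  coalg := H.coalg.up h
  label' := by simpa using fun w'' (h' : w' ≤ w'') => H.label' w'' (h.trans h')
  run_mem' := by simpa [Signature.up] using fun w'' (h' : w' ≤ w'') => H.run_mem' w'' (h.trans h')
  run_nil' := by simpa using fun w'' (h' : w' ≤ w'') => H.run_nil' w'' (h.trans h')
  run_snoc' := by simpa using fun w'' (h' : w' ≤ w'') => H.run_snoc' w'' (h.trans h')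

theorem label (H : S.Behaviour X v D R) {x a : M.Q w} :
    pair x a ∈ D ↔ ∃ t, pair x (pair a t) ∈ v := by
  simpa using H.label' w le_rfl x a

theorem run_nil (H : S.Behaviour X v D R) {x y : M.Q w} :
    pair x (pair empty y) ∈ R ↔ x ∈ X ∧ y = x := by
  simpa using H.run_nil' w le_rfl x y

theorem run_snoc (H : S.Behaviour X v D R) {x σ b y' : M.Q w} :
    pair x (pair (pair σ b) y') ∈ R ↔
      ∃ y, pair x (pair σ y) ∈ R ∧ ∃ a t, pair y (pair a t) ∈ v ∧ pair b y' ∈ t := by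
  simpa using H.run_snoc' w le_rfl x σ b y'

theorem run_mem (H : S.Behaviour X v D R) {x σ y : M.Q w} (h : pair x (pair σ y) ∈ R) :
    x ∈ X ∧ σ ∈ S.L ∧ y ∈ X := by
  simpa using H.run_mem' w le_rfl x σ y (by simpa using h)

/-- Transitions are deterministic, since `v` and the second components of its values are functions.
-/
theorem run_unique (H : S.Behaviour X v D R) {x σ y y' : M.Q w} (h : pair x (pair σ y) ∈ R)
    (h' : pair x (pair σ y') ∈ R) : y = y' := by
  have := S.isListSet.induction (allImp (tripleMem 2 1 0 3) (allImp (tripleMem 3 2 0 4) (.eq 0 1)))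
    (scons x fun _ => R) ?_ ?_ σ (H.run_mem h).2.1
  · simp only [sat_allImp, sat_tripleMem, sat_eq, scons_zero, scons_succ] at this
    simpa using (this w le_rfl y (by simpa using h) w le_rfl y' (by simpa using h')).symm
  · simp only [sat_allImp, sat_tripleMem, sat_eq, scons_zero, scons_succ, up_empty, M.up_up]
    intro w' h y hy w'' h' y' hy'
    rw [((H.up _).run_nil.1 hy).2, ((H.up _).run_nil.1 hy').2, M.up_up]
  · simp only [sat_allImp, sat_tripleMem, sat_eq, scons_zero, scons_succ, up_pair, M.up_up]
    intro w' h σ b hσ hb ih w₁ h₁ y hy w₂ h₂ y' hy'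
    obtain ⟨z, hz, a, t, hat, hbt⟩ := (H.up (h.trans h₁)).run_snoc.1 hy
    obtain ⟨z', hz', a', t', hat', hbt'⟩ := (H.up (h.trans (h₁.trans h₂))).run_snoc.1 hy'
    have e : z' = M.up h₂ z := ih w₁ h₁ z hz w₂ h₂ z' hz'
    subst e
    have hc := (H.coalg.up (h.trans (h₁.trans h₂)))
    have hat₂ := up_mem h₂ hat
    have hbt₂ := up_mem h₂ hbt
    simp only [up_pair, M.up_up] at hat₂ hbt₂
    obtain ⟨rfl, rfl⟩ := hc.value_unique hat' hat₂
    exact (hc.value hat').2.unique hbt' hbt₂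

/-- Labels are unique because runs are. A run to `σb` passes through a state with label `f(b)`, and
conversely a state with label `a` has a successor for every `b` with `f(b) = a`. -/
theorem exists_tree (H : S.Behaviour X v D R) {x : M.Q w} (hx : x ∈ X) :
    ∃ T, S.IsTree T ∧ Pull R D x T := by
  have hD : ∀ w' (h : w ≤ w') (y a : M.Q w'), pair y a ∈ M.up h D → a ∈ M.up h S.A := by
    intro w' h y a hm
    obtain ⟨t, ht⟩ := (H.label' w' h y a).1 hm
    exact ((H.coalg.up h).value ht).1
  obtain ⟨T, hT, hP⟩ := exists_pull (L := S.L) (A := S.A) (X := X) (C := R) (D := D) (x := x)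
    (fun w' h σ y hm => (H.run_mem' w' h _ _ _ hm).2) hD
  refine ⟨T, ⟨hT, ?_, ?_, ?_, ?_⟩, hP⟩
  · obtain ⟨a, t, hat⟩ := H.coalg.exists_value hx
    exact ⟨a, hP.iff.2 ⟨x, H.run_nil.2 ⟨hx, rfl⟩, H.label.2 ⟨t, hat⟩⟩⟩
  · intro w' h σ a a' ha ha'
    obtain ⟨y, hy, ha⟩ := (hP w' h _ _).1 ha
    obtain ⟨y', hy', ha'⟩ := (hP w' h _ _).1 ha'
    obtain rfl := (H.up h).run_unique hy hy'
    obtain ⟨t, ht⟩ := (H.up h).label.1 ha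
    obtain ⟨t', ht'⟩ := (H.up h).label.1 ha'
    exact ((H.coalg.up h).value_unique ht ht').1
  · intro w' h σ b a' ha'
    obtain ⟨y', hy', -⟩ := (hP w' h _ _).1 ha'
    obtain ⟨y, hy, a, t, hat, hbt⟩ := (H.up h).run_snoc.1 hy'
    exact ⟨a, ((H.coalg.up h).succ hat hbt).2.1,
      (hP w' h _ _).2 ⟨y, hy, (H.up h).label.2 ⟨t, hat⟩⟩⟩
  · intro w' h σ b a hb ha
    obtain ⟨y, hy, ha⟩ := (hP w' h _ _).1 ha
    obtain ⟨t, hat⟩ := (H.up h).label.1 ha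
    obtain ⟨y', hy'⟩ := (H.coalg.up h).exists_succ hat hb
    obtain ⟨a', t', hat'⟩ := (H.coalg.up h).exists_value ((H.coalg.up h).succ hat hy').2.2
    exact ⟨a', (hP w' h _ _).2 ⟨y', (H.up h).run_snoc.2 ⟨y, hy, a, t, hat, hy'⟩,
      (H.up h).label.2 ⟨t', hat'⟩⟩⟩

/-- A run along `bσ` begins with the step to `x'`. Both sides follow the same rule for appending to
`σ`, so the transition itself enters only for empty `σ`. -/
theorem run_cons (H : S.Behaviour X v D R) {x a t b x' : M.Q w} (hat : pair x (pair a t) ∈ v)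
    (hx' : pair b x' ∈ t) : ∀ σ ∈ S.L, ∀ y, pair x' (pair σ y) ∈ R ↔
      ∃ τ, pair b (pair σ τ) ∈ S.C ∧ pair x (pair τ y) ∈ R := by
  obtain ⟨hb, -, hx'X⟩ := H.coalg.succ hat hx'
  have hx := (H.coalg.dom hat).1
  have := S.isListSet.induction (allIff (tripleMem 2 1 0 5) (ex (and (tripleMem 5 2 0 7)
    (tripleMem 4 0 1 6)))) (scons x' (scons x (scons b (scons R fun _ => S.C)))) ?_ ?_
  · intro σ hσ y
    have := this σ hσ
    simp only [sat_allIff, sat_ex, sat_and, sat_tripleMem, scons_zero, scons_succ] at this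
    simpa using this w le_rfl y
  · simp only [sat_allIff, sat_ex, sat_and, sat_tripleMem, scons_zero, scons_succ, up_empty]
    intro w' h y
    have hat' := up_mem h hat
    have hx'' := up_mem h hx'
    simp only [up_pair] at hat' hx''
    rw [H.run_nil' w' h]
    simp only [S.cons_nil' w' h]
    constructor
    · rintro ⟨-, rfl⟩
      exact ⟨_, ⟨up_mem h hb, rfl⟩, (H.run_snoc' w' h _ _ _ _).2
        ⟨_, (H.run_nil' w' h _ _).2 ⟨up_mem h hx, rfl⟩, _, _, hat', hx''⟩⟩
    · rintro ⟨_, ⟨-, rfl⟩, hy⟩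
      obtain ⟨y', hy', a', t', hat₁, hbt⟩ := (H.run_snoc' w' h _ _ _ _).1 hy
      rw [((H.run_nil' w' h _ _).1 hy').2] at hat₁
      obtain ⟨rfl, rfl⟩ := (H.coalg.up h).value_unique hat₁ hat'
      exact ⟨up_mem h hx'X, ((H.coalg.up h).value hat').2.unique hbt hx''⟩
  · simp only [sat_allIff, sat_ex, sat_and, sat_tripleMem, scons_zero, scons_succ, M.up_up, up_pair]
    intro w' h σ c hσ hc ih w'' h' y
    rw [H.run_snoc' w'' (h.trans h')]
    simp only [S.cons_snoc' w'' (h.trans h'), ih w'' h']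
    constructor
    · rintro ⟨y', ⟨τ, hτ, hy'⟩, hy⟩
      have := up_mem h' hc
      rw [M.up_up] at this
      exact ⟨_, ⟨τ, hτ, this, rfl⟩, (H.run_snoc' w'' _ _ _ _ _).2 ⟨y', hy', hy⟩⟩
    · rintro ⟨_, ⟨τ, hτ, -, rfl⟩, hy⟩
      obtain ⟨y', hy', hy⟩ := (H.run_snoc' w'' _ _ _ _ _).1 hy
      exact ⟨y', ⟨τ, hτ, hy'⟩, hy⟩

end Behaviour

end Signature

end KModel

end CZFLogic

namespace CZFLogic
open Fm

namespace KModel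

variable {M : KModel} {w w' : M.W} [IsCZF M]

namespace Signature

/-! ## The coalgebra of trees is final -/

namespace Behaviour

variable {S : Signature (M := M) w} {X v D R : M.Q w}

/-- By `run_cons`, the subtree at `b` of the tree of `x` is the tree of the successor `x'`. This is
the morphism equation for `exists_isMorphism`. -/
theorem pull_iff (H : S.Behaviour X v D R) {x a t b x' T T' : M.Q w} (hat : pair x (pair a t) ∈ v)
    (hx' : pair b x' ∈ t) (hT : Pull R D x T) : Pull S.C T b T' ↔ Pull R D x' T' := by
  refine forall₂_congr fun w' h => forall₂_congr fun σ c => iff_congr Iff.rfl ?_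
  have hat' := up_mem h hat
  have hx'' := up_mem h hx'
  simp only [up_pair] at hat' hx''
  constructor
  · rintro ⟨τ, hτ, hc⟩
    obtain ⟨y, hy, hyc⟩ := (hT w' h _ _).1 hc
    exact ⟨y, ((H.up h).run_cons hat' hx'' σ (S.cons_mem' w' h _ _ _ hτ).2.1 y).2 ⟨τ, hτ, hy⟩, hyc⟩
  · rintro ⟨y, hy, hyc⟩
    obtain ⟨τ, hτ, hy⟩ := ((H.up h).run_cons hat' hx'' σ (H.run_mem' w' h _ _ _ hy).2.1 y).1 hy
    exact ⟨τ, hτ, (hT w' h _ _).2 ⟨y, hy, hyc⟩⟩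

theorem exists_isMorphism (H : S.Behaviour X v D R) {V u : M.Q w} (hV : S.IsTreeSet V)
    (hu : S.IsTreeMap V u) : ∃ k, IsMorphism k X v V u := by
  obtain ⟨k, hk⟩ := exists_pullMap hV (C := R) (D := D) (X := X)
    fun w' h x hx => (H.up h).exists_tree hx
  have hk' : ∀ w' (h : w ≤ w') (x T : M.Q w'), pair x T ∈ M.up h k ↔
      x ∈ M.up h X ∧ T ∈ M.up h V ∧ Pull (M.up h R) (M.up h D) x T := by
    intro w' h x T
    rw [hk w' h]
    constructor
    · rintro ⟨x', T', e, h⟩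
      obtain ⟨rfl, rfl⟩ := pair_inj.1 e
      exact h
    · exact fun h => ⟨x, T, rfl, h⟩
  have htot : ∀ w' (h : w ≤ w') (x : M.Q w'), x ∈ M.up h X → ∃ T, pair x T ∈ M.up h k := by
    intro w' h x hx
    obtain ⟨T, hT, hP⟩ := (H.up h).exists_tree hx
    exact ⟨T, (hk' w' h x T).2 ⟨hx, (hV.up h).mem_iff.2 hT, hP⟩⟩
  refine ⟨k, ⟨fun w' h p hp => ?_, htot, fun w' h x T T' hT hT' => ?_⟩, fun w' h x hx => ?_⟩
  · obtain ⟨x, T, rfl, hx, hT, -⟩ := (hk w' h p).1 hp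
    exact ⟨x, T, rfl, hx, hT⟩
  · obtain ⟨-, hTV, hP⟩ := (hk' w' h _ _).1 hT
    obtain ⟨-, hTV', hP'⟩ := (hk' w' h _ _).1 hT'
    exact hP.unique ((hV.up h).mem_iff.1 hTV).subset ((hV.up h).mem_iff.1 hTV').subset hP'
  · obtain ⟨a, t, hat⟩ := (H.coalg.up h).exists_value hx
    obtain ⟨T, hT⟩ := htot w' h x hx
    obtain ⟨-, hTV, hP⟩ := (hk' w' h _ _).1 hT
    have ha : pair empty a ∈ T := hP.iff.2
      ⟨x, (H.up h).run_nil.2 ⟨hx, rfl⟩, (H.up h).label.2 ⟨t, hat⟩⟩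
    obtain ⟨s, hs⟩ := exists_isBranches (hV.up h) ((hV.up h).mem_iff.1 hTV) ha
    refine ⟨_, T, pair a s, hat, hT, (hu.up h).mem_iff.2 ⟨a, s, rfl, hTV, ha, hs⟩, a, t, s, rfl, rfl,
      fun w'' h' z => ?_⟩
    rw [hs w'' h' z]
    have hat' := up_mem h' hat
    simp only [up_pair, M.up_up] at hat'
    have hP' := hP.up h'
    simp only [M.up_up] at hP'
    have H' := H.up (h.trans h')
    simp only [Signature.up, M.up_up, hk' w'' (h.trans h')]
    constructor
    · rintro ⟨b, T', rfl, hb, hT', hTb⟩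
      obtain ⟨x', hx'⟩ := H'.coalg.exists_succ hat' hb
      exact ⟨b, x', T', rfl, hx', (H'.coalg.succ hat' hx').2.2, hT',
        (H'.pull_iff hat' hx' hP').1 hTb⟩
    · rintro ⟨b, x', T', rfl, hx', -, hT', hTb⟩
      exact ⟨b, T', rfl, (H'.coalg.succ hat' hx').2.1, hT', (H'.pull_iff hat' hx' hP').2 hTb⟩

end Behaviour

/-- Passing to initial parts of the address `bσ` leads down to the one-element list of `b`, whose
parent is the root. -/
theorem IsTree.root_of_cons {S : Signature (M := M) w} {T b σ τ a : M.Q w} (H : S.IsTree T)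
    (hτ : pair b (pair σ τ) ∈ S.C) (ha : pair τ a ∈ T) :
    ∃ a₀, pair empty a₀ ∈ T ∧ pair b a₀ ∈ S.f := by
  have := S.isListSet.induction (allImp (tripleMem 2 1 0 3) (allImp (pairMem 1 0 5)
    (ex (and (pairMem 7 0 6) (pairMem 4 0 8)))))
    (scons b (scons S.C (scons T (scons empty fun _ => S.f)))) ?_ ?_ σ (S.cons_mem hτ).2.1
  · simp only [sat_allImp, sat_ex, sat_and, sat_tripleMem, sat_pairMem, scons_zero,
      scons_succ] at this
    simpa using this w le_rfl τ (by simpa using hτ) w le_rfl a (by simpa using ha)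
  · simp only [sat_allImp, sat_ex, sat_and, sat_tripleMem, sat_pairMem, scons_zero, scons_succ,
      up_empty, M.up_up]
    intro w₁ h₁ τ hτ w₂ h₂ a ha
    obtain ⟨-, rfl⟩ := (S.cons_nil' w₁ h₁ _ _).1 hτ
    rw [up_pair, up_empty, M.up_up] at ha
    obtain ⟨a₀, hb, ha₀⟩ := H.down' w₂ _ _ _ _ ha
    exact ⟨a₀, ha₀, hb⟩
  · simp only [sat_allImp, sat_ex, sat_and, sat_tripleMem, sat_pairMem, scons_zero, scons_succ,
      up_empty, M.up_up, up_pair]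
    intro w' h σ c hσ hc ih w₁ h₁ τ hτ w₂ h₂ a ha
    obtain ⟨τ', hτ', -, rfl⟩ := (S.cons_snoc' w₁ (h.trans h₁) _ _ _ _).1 hτ
    rw [up_pair] at ha
    obtain ⟨a', -, ha'⟩ := H.down' w₂ _ _ _ _ ha
    exact ih w₁ h₁ τ' hτ' w₂ h₂ a' ha'

variable {S : Signature (M := M) w} {X v V u k l : M.Q w}

/-- The morphism equation at one element, in terms of trees: the image has the label of `x` at its
root, and its subtrees are the images of the successors of `x`. -/
theorem mem_of_isMorphism (hu : S.IsTreeMap V u) (hv : S.IsCoalg X v)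
    (hk : IsMorphism k X v V u) {x T a t : M.Q w} (hT : pair x T ∈ k)
    (hat : pair x (pair a t) ∈ v) : pair empty a ∈ T ∧ ∀ b T',
      (pair b a ∈ S.f ∧ T' ∈ V ∧ Pull S.C T b T') ↔ ∃ x', pair b x' ∈ t ∧ pair x' T' ∈ k := by
  obtain ⟨p, y, q, hp, hy, hq, a', t', s, rfl, rfl, hs⟩ := hk.2 w le_rfl x
    (by simpa using (hv.dom hat).1)
  simp only [M.up_refl] at hp hy hq hs
  obtain ⟨rfl, rfl⟩ := hv.value_unique hat hp
  obtain rfl := hk.1.unique hT hy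
  obtain ⟨a', s', e, -, ha, hs'⟩ := hu.mem_iff.1 hq
  obtain ⟨rfl, rfl⟩ := pair_inj.1 e
  exact ⟨ha, fun b T' => by rw [← hs'.mem_iff, hs.mem_iff]⟩

/-- Two morphisms of coalgebras to the trees that come from the same element of the source. -/
theorem mem_of_mem_of_isMorphism (hV : S.IsTreeSet V) (hu : S.IsTreeMap V u) (hv : S.IsCoalg X v)
    (hk : IsMorphism k X v V u) (hl : IsMorphism l X v V u) {x T T' σ a : M.Q w}
    (hT : pair x T ∈ k) (hT' : pair x T' ∈ l) (ha : pair σ a ∈ T) : pair σ a ∈ T' := by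
  -- The element `x` is quantified inside `K`, because the inductive step passes to a successor of
  -- `x`. Since trees range over the set `V`, the formula is bounded.
  obtain ⟨K, hK⟩ := exists_sep (ball 1 (ball 3 (ball 4 (ball 6
    (imp (and (pairMem 3 2 8) (and (pairMem 3 1 9) (pairMem 4 0 2))) (pairMem 4 0 1))))))
    (by repeat constructor) (scons X (scons V (scons S.A (scons k fun _ => l)))) S.L
  have hK' : ∀ w' (h : w ≤ w') (σ : M.Q w'), σ ∈ M.up h K ↔ σ ∈ M.up h S.L ∧
      ∀ w'' (h' : w' ≤ w'') (x T T' a : M.Q w''), pair x T ∈ M.up (h.trans h') k →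
        pair x T' ∈ M.up (h.trans h') l → pair (M.up h' σ) a ∈ T → pair (M.up h' σ) a ∈ T' := by
    intro w' h σ
    rw [hK w' h]
    refine and_congr_right fun hσ => ?_
    simp only [sat_ball, sat_imp, sat_and, sat_pairMem, scons_zero, scons_succ, M.up_up]
    constructor
    · intro H w'' h' x T T' a hT hT' ha
      obtain ⟨hx, hTV⟩ := (hk.1.up _).dom hT
      obtain ⟨-, hTV'⟩ := (hl.1.up _).dom hT'
      have haA := ((((hV.up _).mem_iff).1 hTV).mem ha).2
      simpa using H w'' h' x hx w'' le_rfl T hTV w'' le_rfl T' hTV' w'' le_rfl a haA w'' le_rfl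
        (by simpa using ⟨hT, hT', ha⟩)
    · intro H w₁ h₁ x hx w₂ h₂ T hT w₃ h₃ T' hT' w₄ h₄ a ha w₅ h₅ h
      exact H w₅ _ _ _ _ _ h.1 h.2.1 h.2.2
  have key := S.front_induction (K := K) ?_ ?_ σ (((hV.mem_iff.1 (hk.1.dom hT).2).mem ha).1)
  · have := ((hK' w le_rfl σ).1 (by simpa using key)).2 w le_rfl x T T' a
    simp only [M.up_refl] at this
    exact this hT hT' ha
  · refine M.up_refl le_rfl K ▸ (hK' w le_rfl empty).2 ⟨by simpa using S.isListSet.nil_mem,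
      fun w' h x T T' a hT hT' ha => ?_⟩
    rw [up_empty] at ha ⊢
    obtain ⟨a₀, t, hat⟩ := (hv.up h).exists_value ((hk.1.up h).dom hT).1
    have h₁ := (mem_of_isMorphism (hu.up h) (hv.up h) (hk.up h) hT hat).1
    have h₂ := (mem_of_isMorphism (hu.up h) (hv.up h) (hl.up h) hT' hat).1
    rwa [((hV.up h).mem_iff.1 ((hk.1.up h).dom hT).2).unique ha h₁]
  · intro w₁ h₁ b σ τ hτ hσ
    rw [hK'] at hσ ⊢
    refine ⟨(S.cons_mem' w₁ h₁ _ _ _ hτ).2.2, fun w' h' x T T' a hT hT' ha => ?_⟩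
    have h := h₁.trans h'
    have hτ' := up_mem h' hτ
    simp only [up_pair, M.up_up] at hτ'
    have hTt := (hV.up h).mem_iff.1 ((hk.1.up h).dom hT).2
    obtain ⟨a₀, ha₀, hb⟩ := hTt.root_of_cons hτ' ha
    obtain ⟨a₁, t, hat⟩ := (hv.up h).exists_value ((hk.1.up h).dom hT).1
    have h₁ := mem_of_isMorphism (hu.up h) (hv.up h) (hk.up h) hT hat
    have h₂ := mem_of_isMorphism (hu.up h) (hv.up h) (hl.up h) hT' hat
    obtain rfl := hTt.unique ha₀ h₁.1
    -- The subtree of `T` at `b` is the value of `k` at a successor `x'`, and the value of `l` at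
    -- `x'` is the subtree of `T'` at `b`. The hypothesis for `σ` compares these two.
    obtain ⟨Tb, hTb, hP⟩ := hTt.exists_subtree ha₀ hb
    obtain ⟨x', hx', hxT⟩ := (h₁.2 _ _).1 ⟨hb, (hV.up h).mem_iff.2 hTb, hP⟩
    obtain ⟨T'', hT''⟩ := (hl.1.up h).total' w' le_rfl x'
      (by simpa using ((hk.1.up h).dom hxT).1)
    rw [M.up_refl] at hT''
    obtain ⟨-, -, hP'⟩ := (h₂.2 _ _).2 ⟨x', hx', hT''⟩
    obtain ⟨τ', hτ'', ha'⟩ := hP'.iff.1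
      (hσ.2 w' h' x' Tb T'' a hxT hT'' (hP.iff.2 ⟨_, hτ', ha⟩))
    rwa [(S.up h).cons_unique hτ' hτ'']

theorem subset_of_isMorphism (hV : S.IsTreeSet V) (hu : S.IsTreeMap V u) (hv : S.IsCoalg X v)
    (hk : IsMorphism k X v V u) (hl : IsMorphism l X v V u) : Subset k l := by
  intro w' h p hp
  obtain ⟨x, T, rfl, hx, hT⟩ := hk.1.rel' w' h p hp
  obtain ⟨T', hT'⟩ := hl.1.total' w' h x hx
  have htree := ((hV.up h).mem_iff.1 hT)
  have htree' := ((hV.up h).mem_iff.1 ((hl.1.up h).dom hT').2)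
  have : T = T' := by
    refine (subset_of_pairs htree.subset fun w'' h' σ a ha => ?_).antisymm
      (subset_of_pairs htree'.subset fun w'' h' σ a ha => ?_)
    · have h₁ := up_mem h' hp
      have h₂ := up_mem h' hT'
      simp only [up_pair, M.up_up] at h₁ h₂
      exact mem_of_mem_of_isMorphism (hV.up _) (hu.up _) (hv.up _) (hk.up _) (hl.up _) h₁ h₂ ha
    · have h₁ := up_mem h' hp
      have h₂ := up_mem h' hT'
      simp only [up_pair, M.up_up] at h₁ h₂
      exact mem_of_mem_of_isMorphism (hV.up _) (hu.up _) (hv.up _) (hl.up _) (hk.up _) h₂ h₁ ha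
  exact this ▸ hT'

/-- `(V, u)` is a final coalgebra. -/
def IsFinal (S : Signature (M := M) w) (V u : M.Q w) : Prop :=
  S.IsCoalg V u ∧ ∀ w' (h : w ≤ w') (X v : M.Q w'), (S.up h).IsCoalg X v →
    ∃ k, IsMorphism k X v (M.up h V) (M.up h u) ∧ ∀ w'' (h' : w' ≤ w'') (l : M.Q w''),
      IsMorphism l (M.up h' X) (M.up h' v) (M.up (h.trans h') V) (M.up (h.trans h') u) →
        l = M.up h' k

theorem exists_isFinal (H : M.NID w) (S : Signature (M := M) w) : ∃ V u, S.IsFinal V u := by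
  obtain ⟨V, hV⟩ := exists_treeSet H S
  obtain ⟨u, hu⟩ := exists_isTreeMap hV
  refine ⟨V, u, isCoalg_treeMap hV hu, fun w' h X v hv => ?_⟩
  obtain ⟨D, R, hB⟩ := hv.exists_behaviour (H.up h)
  have hV : S.IsTreeSet V := hV
  obtain ⟨k, hk⟩ := hB.exists_isMorphism (hV.up h) (hu.up h)
  refine ⟨k, hk, fun w'' h' l hl => ?_⟩
  have hV' := hV.up (h.trans h')
  have hu' := hu.up (h.trans h')
  have hv' := hv.up h'
  have hk' := hk.up h'
  rw [up_up] at hv'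
  simp only [M.up_up] at hk'
  exact (subset_of_isMorphism hV' hu' hv' hl hk').antisymm
    (subset_of_isMorphism hV' hu' hv' hk' hl)

end Signature

end KModel

end CZFLogic

namespace CZFLogic
open Fm

namespace Fm

/-! ## The principles as de Bruijn formulas -/

/-- `x ⊆ y` -/
def subset (x y : ℕ) : Fm := ball x (mem 0 (y + 1))

/-- `R` is a set of elementary rules on `X`. -/
def isRuleSet (R X : ℕ) : Fm :=
  ball R (ex (ex (and (isPair 2 1 0) (and (subset 1 (X + 3)) (and (subset 0 (X + 3))
    (ex (isSing 2 0)))))))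

/-- `Y` is an `R`-closed subset of `X`. -/
def isClosedUnder (R X Y : ℕ) : Fm :=
  and (subset Y X) (all (all (imp (pairMem 1 0 (R + 2)) (imp (subset 1 (Y + 2))
    (bex 0 (mem 0 (Y + 3)))))))

/-- `G` generates the class of `R`-closed subsets of `X`. -/
def generates (R X G : ℕ) : Fm :=
  and (ball G (isClosedUnder (R + 1) (X + 1) 0)) (allImp (isClosedUnder (R + 1) (X + 1) 0)
    (ball 0 (bex (G + 2) (and (mem 1 0) (subset 0 2)))))

/-- `g` is a function from the class `D` to the class `C`; both `D` and `D'` say that an element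
belongs to the domain. -/
def isFn (g : ℕ) (D D' C : Fm) : Fm :=
  and (ball g (ex (ex (and (isPair 2 1 0) (and D C)))))
    (allImp D' (ex (and (pairMem 1 0 (g + 2)) (allImp (pairMem 2 0 (g + 3)) (eq 0 1)))))

/-- `g` is a function from the set `X` to the set `Y`. -/
def isFnSet (g X Y : ℕ) : Fm := isFn g (mem 1 (X + 3)) (mem 0 (X + 1)) (mem 0 (Y + 3))

/-- `p ∈ P_f(X)` -/
def memPoly (A B f X p : ℕ) : Fm :=
  ex (ex (and (isPair (p + 2) 1 0) (and (mem 1 (A + 2)) (isFn 0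
    (and (mem 1 (B + 5)) (pairMem 1 4 (f + 5))) (and (mem 0 (B + 3)) (pairMem 0 2 (f + 3)))
    (mem 0 (X + 5))))))

/-- `v` is a function from `X` to `P_f(X)`. -/
def isCoalg (A B f X v : ℕ) : Fm :=
  isFn v (mem 1 (X + 3)) (mem 0 (X + 1)) (memPoly (A + 3) (B + 3) (f + 3) (X + 3) 0)

/-- `s = k ∘ t` -/
def isComp (s k t : ℕ) : Fm :=
  allIff (mem 0 (s + 1))
    (ex (ex (ex (and (isPair 3 2 0) (and (pairMem 2 1 (t + 4)) (pairMem 1 0 (k + 4)))))))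

/-- `q = P_f(k)(p)` -/
def isPolyMap (k p q : ℕ) : Fm :=
  ex (ex (ex (and (isPair (p + 3) 2 1) (and (isPair (q + 3) 2 0) (isComp 0 (k + 3) 1)))))

/-- `k` is a morphism of coalgebras from `(X, v)` to `(Y, u)`. -/
def isMorphism (k X v Y u : ℕ) : Fm :=
  and (isFnSet k X Y) (ball X (ex (ex (ex (and (pairMem 3 2 (v + 4)) (and (pairMem 3 1 (k + 4))
    (and (pairMem 1 0 (u + 4)) (isPolyMap (k + 4) 2 0))))))))

/-- `(V, u)` is a final coalgebra. -/
def isFinal (A B f V u : ℕ) : Fm :=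
  and (isCoalg A B f V u) (all (all (imp (isCoalg (A + 2) (B + 2) (f + 2) 1 0)
    (ex (and (isMorphism 0 2 1 (V + 3) (u + 3))
      (allImp (isMorphism 0 3 2 (V + 4) (u + 4)) (eq 0 1)))))))

/-- The formulas with named variables compute to these, so the statement and its de Bruijn form
agree definitionally. -/
theorem elementaryNID_eq :
    Form.elementaryNID 0 = all (all (imp (isRuleSet 0 1) (ex (generates 1 2 0)))) := rfl

theorem allMTypesExist_eq :
    Form.allMTypesExist 0 = all (all (all (imp (isFnSet 0 1 2) (ex (ex (isFinal 4 3 2 1 0)))))) :=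
  rfl

end Fm

/-! ### The meaning of the two principles in a model -/

namespace KModel

@[simp] theorem sat_subset {M : KModel} {w : M.W} (x y : ℕ) (ρ : ℕ → M.Q w) :
    M.sat (subset x y) ρ ↔ Subset (ρ x) (ρ y) := sat_ball _ _ _

variable {M : KModel} {w w' : M.W} [IsCZF M]

@[simp] theorem sat_isRuleSet (R X : ℕ) (ρ : ℕ → M.Q w) :
    M.sat (isRuleSet R X) ρ ↔ IsRuleSet (ρ R) (ρ X) := by
  simp [isRuleSet, IsRuleSet]

@[simp] theorem sat_isClosedUnder (R X Y : ℕ) (ρ : ℕ → M.Q w) :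
    M.sat (isClosedUnder R X Y) ρ ↔ IsClosedUnder (ρ R) (ρ X) (ρ Y) := by
  simp only [isClosedUnder, sat_and, sat_subset, sat_all, sat_imp, sat_pairMem, sat_bex, sat_mem,
    scons_zero, scons_succ, up_up]
  refine and_congr Iff.rfl ⟨fun H w' h a b hab ha => ?_,
    fun H w₁ h₁ a w₂ h₂ b w₃ h₃ hab w₄ h₄ ha => ?_⟩
  · simpa using H w' h a w' le_rfl b w' le_rfl (by simpa using hab) w' le_rfl (by simpa using ha)
  · have := up_mem h₄ hab
    simp only [up_pair, up_up] at this
    exact H w₄ _ _ _ this ha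

@[simp] theorem sat_generates (R X G : ℕ) (ρ : ℕ → M.Q w) :
    M.sat (generates R X G) ρ ↔ Generates (ρ R) (ρ X) (ρ G) := by
  simp only [generates, Generates, sat_and, sat_ball, sat_allImp, sat_isClosedUnder, sat_bex, sat_mem,
    sat_subset, scons_zero, scons_succ, up_up]
  refine and_congr Iff.rfl ⟨fun H w' h α hα a ha => ?_, fun H w₁ h₁ α hα w₂ h₂ a ha => ?_⟩
  · simpa using H w' h α hα w' le_rfl a (by simpa using ha)
  · have : IsClosedUnder (M.up (h₁.trans h₂) (ρ R)) (M.up (h₁.trans h₂) (ρ X)) (M.up h₂ α) := by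
      have := sat_up (isClosedUnder 0 1 2) h₂
        ((sat_isClosedUnder 0 1 2 (scons (M.up h₁ (ρ R)) (scons (M.up h₁ (ρ X)) fun _ => α))).2 hα)
      simpa using this
    exact H w₂ _ _ this a ha

/-- The domain is mentioned at two depths, under the quantifiers for `p`, `x`, `y` and under that
for `x` alone; `D` and `D'` are its forms at these depths. -/
theorem sat_isFn {g : ℕ} {D D' C : Fm} {ρ : ℕ → M.Q w} {P Q : ∀ w', w ≤ w' → M.Q w' → Prop}
    (hD : ∀ w' (h : w ≤ w') (x y p : M.Q w'),
      M.sat D (scons y (scons x (scons p fun n => M.up h (ρ n)))) ↔ P w' h x)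
    (hD' : ∀ w' (h : w ≤ w') (x : M.Q w'), M.sat D' (scons x fun n => M.up h (ρ n)) ↔ P w' h x)
    (hC : ∀ w' (h : w ≤ w') (x y p : M.Q w'),
      M.sat C (scons y (scons x (scons p fun n => M.up h (ρ n)))) ↔ Q w' h y) :
    M.sat (isFn g D D' C) ρ ↔ IsFn (ρ g) P Q := by
  simp only [isFn, sat_and, sat_ball, sat_ex, sat_isPair, sat_allImp, sat_pairMem, sat_eq, hD, hD', hC,
    scons_zero, scons_succ, up_up]
  constructor
  · rintro ⟨h₁, h₂⟩
    refine ⟨h₁, fun w' h x hx => ?_, fun w' h x y y' hy hy' => ?_⟩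
    · obtain ⟨y, hy, -⟩ := h₂ w' h x hx
      exact ⟨y, hy⟩
    · obtain ⟨x', y₁, e, hx, -⟩ := h₁ w' h _ hy
      obtain ⟨rfl, rfl⟩ := pair_inj.1 e
      obtain ⟨z, -, hz⟩ := h₂ w' h x hx
      have hz' := hz w' le_rfl
      simp only [up_refl] at hz'
      rw [hz' y hy, hz' y' hy']
  · intro H
    refine ⟨H.rel', fun w' h x hx => ?_⟩
    obtain ⟨y, hy⟩ := H.total' w' h x hx
    refine ⟨y, hy, fun w'' h' y' hy' => H.unique' w'' (h.trans h') _ _ _ hy' ?_⟩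
    simpa using up_mem h' hy

@[simp] theorem sat_isFnSet (g X Y : ℕ) (ρ : ℕ → M.Q w) :
    M.sat (isFnSet g X Y) ρ ↔ IsFnSet (ρ g) (ρ X) (ρ Y) :=
  sat_isFn (fun _ _ _ _ _ => Iff.rfl) (fun _ _ _ => Iff.rfl) fun _ _ _ _ _ => Iff.rfl

@[simp] theorem sat_isComp (s k t : ℕ) (ρ : ℕ → M.Q w) :
    M.sat (isComp s k t) ρ ↔ IsComp (ρ s) (ρ k) (ρ t) := by
  simp [isComp, IsComp, Compr]

@[simp] theorem sat_isPolyMap (k p q : ℕ) (ρ : ℕ → M.Q w) :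
    M.sat (isPolyMap k p q) ρ ↔ IsPolyMap (ρ k) (ρ p) (ρ q) := by
  simp [isPolyMap, IsPolyMap]

@[simp] theorem sat_isMorphism (k X v Y u : ℕ) (ρ : ℕ → M.Q w) :
    M.sat (isMorphism k X v Y u) ρ ↔ IsMorphism (ρ k) (ρ X) (ρ v) (ρ Y) (ρ u) := by
  simp [isMorphism, IsMorphism]

namespace Signature

theorem sat_memPoly (S : Signature (M := M) w) {A B f X p : ℕ} {ρ : ℕ → M.Q w} (hA : ρ A = S.A)
    (hB : ρ B = S.B) (hf : ρ f = S.f) :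
    M.sat (memPoly A B f X p) ρ ↔ S.MemPoly (ρ X) (ρ p) := by
  simp only [memPoly, MemPoly, sat_ex, sat_and, sat_isPair, sat_mem, scons_zero, scons_succ, hA]
  refine exists_congr fun a => exists_congr fun t => and_congr Iff.rfl (and_congr Iff.rfl ?_)
  refine sat_isFn ?_ ?_ ?_ <;> intros <;> simp [hB, hf]

theorem sat_isCoalg (S : Signature (M := M) w) {A B f X v : ℕ} {ρ : ℕ → M.Q w} (hA : ρ A = S.A)
    (hB : ρ B = S.B) (hf : ρ f = S.f) :
    M.sat (isCoalg A B f X v) ρ ↔ S.IsCoalg (ρ X) (ρ v) := by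
  refine sat_isFn (fun _ _ _ _ _ => Iff.rfl) (fun _ _ _ => Iff.rfl) fun w' h x y p => ?_
  rw [(S.up h).sat_memPoly (by simp [hA, Signature.up]) (by simp [hB, Signature.up])
    (by simp [hf, Signature.up])]
  rfl

theorem sat_isFinal (S : Signature (M := M) w) {A B f V u : ℕ} {ρ : ℕ → M.Q w} (hA : ρ A = S.A)
    (hB : ρ B = S.B) (hf : ρ f = S.f) (H : S.IsFinal (ρ V) (ρ u)) :
    M.sat (isFinal A B f V u) ρ := by
  refine ⟨(S.sat_isCoalg hA hB hf).2 H.1, fun w₁ h₁ X w₂ h₂ v w₃ h₃ hv => ?_⟩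
  rw [(S.up ((h₁.trans h₂).trans h₃)).sat_isCoalg (by simp [hA, Signature.up])
    (by simp [hB, Signature.up]) (by simp [hf, Signature.up])] at hv
  obtain ⟨k, hk, hk'⟩ := H.2 w₃ _ _ _ hv
  refine ⟨k, ?_, ?_⟩
  · simpa using hk
  · rw [sat_allImp]
    intro w₄ h₄ l hl
    simp only [sat_isMorphism, sat_eq, scons_zero, scons_succ, M.up_up] at hl ⊢
    exact hk' w₄ h₄ l (by simpa using hl)

end Signature

theorem NID_of_sat {ρ : ℕ → M.Q w} (H : M.sat (Form.elementaryNID 0) ρ) : M.NID w := by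
  rw [elementaryNID_eq] at H
  simp only [sat_all, sat_imp, sat_ex, sat_isRuleSet, sat_generates, scons_zero, scons_succ,
    up_up] at H
  intro w' h X R hR
  simpa using H w' h X w' le_rfl R w' le_rfl (by simpa using hR)

theorem sat_allMTypesExist (H : M.NID w) (ρ : ℕ → M.Q w) : M.sat (Form.allMTypesExist 0) ρ := by
  rw [allMTypesExist_eq]
  intro w₁ h₁ A w₂ h₂ B w₃ h₃ f w₄ h₄ hf
  rw [sat_isFnSet] at hf
  have H' := H.up (h₁.trans (h₂.trans (h₃.trans h₄)))
  obtain ⟨S, hA, hB, hf⟩ := exists_signature H' hf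
  obtain ⟨V, u, hV⟩ := S.exists_isFinal H'
  exact ⟨V, u, S.sat_isFinal hA.symm hB.symm hf.symm hV⟩

end KModel

end CZFLogic

theorem mainTheorem4 :
    CZFLogic.CZFProves
      (CZFLogic.Form.imp CZFLogic.Form.elementaryNID CZFLogic.Form.allMTypesExist) := by
  refine CZFLogic.derivable_of_forall_model (fun φ h σ => h.rename σ) _ fun M hM w ρ => ?_
  have : CZFLogic.KModel.IsCZF M := ⟨hM⟩
  exact fun w' h H => CZFLogic.KModel.sat_allMTypesExist (CZFLogic.KModel.NID_of_sat H) _
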